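/- Manifolds and manifolds-with-boundary are smooth, finite dimensional, Hausdorff and second countable. Let $N$ be a manifold-with-boundary with a free smooth action of the circle $S^1$ on an open neighbourhood $U_N$ of $\partial N$. **Definitions.** An *invariant boundary defining function* on $N$ is a smooth $f\colon N\to\mathbb R_{\ge 0}$ with $f^{-1}(0)=\partial N$ and $df\neq 0$ at every point of $\partial N$, which is $S^1$-invariant on some $S^1$-invariant neighbourhood of $\partial N$ in $U_N$. The *cut space* $N_{\mathrm{cut}}$ is the quotient, with quotient map $c_N\colon N\to N_{\mathrm{cut}}$ and the quotient topology, of $N$ by the relation in which distinct points are equivalent iff both lie in $\partial N$ and in the same $S^1$-orbit. Let $\mathcal F_N$ be the set of functions $h\colon N_{\mathrm{cut}}\to\mathbb R$ such that, for an invariant boundary defining function $f$, (1) $h\circ c_N$ is smooth on the interior of $N$, and (2) there are an $S^1$-invariant open neighbourhood $V$ of $\partial N$ in $U_N$ and a smooth $H\colon V\times\mathbb C\to\mathbb R$ with $H(a\cdot x,z)=H(x,az)$ for all $a\in S^1$, $(x,z)\in V\times\mathbb C$, and $h(c_N(x))=H(x,\sqrt{f(x)})$ for all $x\in V$. The same definitions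 apply to a manifold-with-boundary $M$ with a free circle action on an open neighbourhood $U_M$ of $\partial M$. A map $\psi\colon M\to N$ is *equivariant transverse* if it is smooth, $f\circ\psi$ is an invariant boundary defining function on $M$ for some invariant boundary defining function $f$ on $N$, and there is an $S^1$-invariant neighbourhood $V\subseteq U_M\cap\psi^{-1}(U_N)$ of $\partial M$ on which $\psi$ is $S^1$-equivariant; it then induces a unique map $\psi_{\mathrm{cut}}\colon M_{\mathrm{cut}}\to N_{\mathrm{cut}}$ with $\psi_{\mathrm{cut}}\circ c_M=c_N\circ\psi$. An *immersion* (resp. *submersion*) is a smooth map whose differential is injective (resp. surjective) at every point; an *embedding* is an immersion that is a homeomorphism with its image. On a subset $T$ of a space $X$ with a given set of "smooth" real valued functions, the *subset differential structure* is the set of functions $T\to\mathbb R$ that near each point of $T$ agree with the restriction of a smooth function on $X$. A *submanifold* (resp. *submanifold-with-boundary*) is a subset that, with the subset differential structure, is a manifold (resp. manifold-with-boundary). **(A)** Let $M$ be a manifold-with-boundary with a free circle action on an open neighbourhood of $\partial M$, and let $\psi\colon M\to N$ be an equivariant transverse map. Then $M_{\mathrm{cut}}$ and $N_{\mathrm{cut}}$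 carry manifold structures, compatible with their topologies, of the dimensions of $M$ and $N$, whose sets of real valued smooth functions are $\mathcal F_M$ and $\mathcal F_N$. For any such structures $\psi_{\mathrm{cut}}$ is smooth and: if $\psi$ is an immersion, so is $\psi_{\mathrm{cut}}$; if $\psi$ is a submersion, so is $\psi_{\mathrm{cut}}$; if $\psi$ is an embedding, so is $\psi_{\mathrm{cut}}$. **(B)** Let $S\subseteq N$ be a submanifold-with-boundary with $\partial S\subseteq\partial N$. Suppose that $S\cap V$ is $S^1$-invariant for some $S^1$-invariant open neighbourhood $V$ of $\partial N$ in $U_N$ and that the inclusion $\iota\colon S\to N$ is an equivariant transverse map, where $S$ carries the circle action restricted to $S\cap V$. Then $S_{\mathrm{cut}}$ is a submanifold of $N_{\mathrm{cut}}$. That is: $S_{\mathrm{cut}}$ (with $\mathcal F_S$) and $N_{\mathrm{cut}}$ (with $\mathcal F_N$) are manifolds; $c_N(S)$ with the subset differential structure induced by $\mathcal F_N$ is a manifold, of the dimension of $S$; and $\iota_{\mathrm{cut}}\colon S_{\mathrm{cut}}\to N_{\mathrm{cut}}$ is an embedding whose image is $c_N(S)$ and is a diffeomorphism of $S_{\mathrm{cut}}$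 with $c_N(S)$. -/

import Mathlib

open Set Topology TopologicalSpace
open scoped Manifold ContDiff

namespace Cutting

noncomputable section

/-- The model `I` has finite dimensional manifolds-with-boundary as its manifolds (and no corners):
its range is a closed half-space `{v | 0 ≤ ℓ v}`. For `ℓ = 0` this is the whole space
(manifolds without boundary, including those of dimension `0`). -/
def IsHalfSpaceModel {E H : Type*} [NormedAddCommGroup E] [NormedSpace ℝ E] [TopologicalSpace H]
    (I : ModelWithCorners ℝ E H) : Prop :=
  FiniteDimensional ℝ E ∧ ∃ ℓ : E →L[ℝ] ℝ, range I = {v | 0 ≤ ℓ v}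

/-! ### Immersions, submersions, embeddings -/

section Maps

variable {E H E' H' : Type*} [NormedAddCommGroup E] [NormedSpace ℝ E] [TopologicalSpace H]
  [NormedAddCommGroup E'] [NormedSpace ℝ E'] [TopologicalSpace H']
  (I : ModelWithCorners ℝ E H) (I' : ModelWithCorners ℝ E' H')
  {M N : Type*} [TopologicalSpace M] [ChartedSpace H M] [TopologicalSpace N] [ChartedSpace H' N]

/-- A smooth map whose differential is injective at every point. -/
def IsImmersion (ψ : M → N) : Prop :=
  ContMDiff I I' ∞ ψ ∧ ∀ x, Function.Injective (mfderiv I I' ψ x)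

/-- A smooth map whose differential is surjective at every point. -/
def IsSubmersion (ψ : M → N) : Prop :=
  ContMDiff I I' ∞ ψ ∧ ∀ x, Function.Surjective (mfderiv I I' ψ x)

/-- An immersion that is a homeomorphism with its image. -/
def IsSmoothEmbedding (ψ : M → N) : Prop :=
  IsImmersion I I' ψ ∧ IsEmbedding ψ

end Maps

/-! ### Manifolds described by their real valued smooth functions -/

/-- The subset differential structure: the real valued functions on `T ⊆ X` that locally,
near each point of `T`, extend to members of `F`. -/
def subsetFunctions {X : Type*} [TopologicalSpace X] (F : Set (X → ℝ)) (T : Set X) :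
    Set (T → ℝ) :=
  {h | ∀ x : T, ∃ O : Set X, IsOpen O ∧ (x : X) ∈ O ∧ ∃ g ∈ F, ∀ y : T, (y : X) ∈ O → h y = g y}

/-- A structure of smooth manifold (Hausdorff, second countable, without boundary, modelled on
`E`) on the topological space `X`, whose real valued smooth functions are exactly those in `F`. -/
structure ManifoldStructure (E : Type*) [NormedAddCommGroup E] [NormedSpace ℝ E]
    (X : Type*) [TopologicalSpace X] (F : Set (X → ℝ)) where
  t2 : T2Space X
  secondCountable : SecondCountableTopology X
  charted : ChartedSpace E X
  isManifold : IsManifold 𝓘(ℝ, E) ∞ X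
  smooth_iff : ∀ h : X → ℝ, ContMDiff 𝓘(ℝ, E) 𝓘(ℝ) ∞ h ↔ h ∈ F

/-- `φ` is a diffeomorphism (of differential spaces) of `(X, F)` with its image in `(Y, G)`, the
image being equipped with the subset differential structure. -/
def IsDiffeoOntoImage {X Y : Type*} [TopologicalSpace Y] (F : Set (X → ℝ)) (G : Set (Y → ℝ))
    (φ : X → Y) : Prop :=
  Function.Injective φ ∧
    ∀ h : range φ → ℝ, h ∈ subsetFunctions G (range φ) ↔ (fun x => h ⟨φ x, x, rfl⟩) ∈ F

/-! ### Circle actions near the boundary -/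

/-- An action of the circle group on an open subset `dom` of `M`. -/
structure LocalCircleAction (M : Type*) [TopologicalSpace M] where
  dom : Opens M
  act : MulAction Circle dom

attribute [instance] LocalCircleAction.act

section Cut

variable {E H : Type*} [NormedAddCommGroup E] [NormedSpace ℝ E] [TopologicalSpace H]
  (I : ModelWithCorners ℝ E H) {M : Type*} [TopologicalSpace M] [ChartedSpace H M]
  (A : LocalCircleAction M)

/-- `A` is a free (smooth) circle action on an open neighbourhood of the boundary. -/
structure IsFreeNearBoundary : Prop where
  boundary_subset : ∀ x ∈ I.boundary M, x ∈ A.dom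
  smooth : ContMDiff ((𝓡 1).prod I) I ∞ (fun p : Circle × A.dom => p.1 • p.2)
  free : ∀ (a : Circle) (x : A.dom), a • x = x → a = 1

/-- `V` is an invariant open neighbourhood of the boundary, contained in the domain of the
action. -/
structure IsInvariantNhd (V : Set A.dom) : Prop where
  isOpen : IsOpen V
  boundary_mem : ∀ x : A.dom, (x : M) ∈ I.boundary M → x ∈ V
  smul_mem : ∀ (a : Circle), ∀ x ∈ V, a • x ∈ V

/-- Invariant boundary defining functions. -/
structure IsInvariantBDF (f : M → ℝ) : Prop where
  smooth : ContMDiff I 𝓘(ℝ) ∞ f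
  nonneg : ∀ x, 0 ≤ f x
  zero_iff : ∀ x, f x = 0 ↔ x ∈ I.boundary M
  deriv_ne_zero : ∀ x ∈ I.boundary M, mfderiv I 𝓘(ℝ) f x ≠ 0
  invariant : ∃ V : Set A.dom, IsInvariantNhd I A V ∧
    ∀ (a : Circle), ∀ x ∈ V, f (a • x : A.dom) = f x

/-! ### The cut space -/

/-- Distinct points are equivalent iff they are both in the boundary and in the same orbit. -/
def CutRel (x y : M) : Prop :=
  x = y ∨ (x ∈ I.boundary M ∧ y ∈ I.boundary M ∧
    ∃ (hx : x ∈ A.dom) (a : Circle), ((a • (⟨x, hx⟩ : A.dom) : A.dom) : M) = y)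

theorem cutRel_equivalence : Equivalence (CutRel I A) where
  refl x := Or.inl rfl
  symm := by
    rintro x y (rfl | ⟨hx, hy, hd, a, rfl⟩)
    · exact Or.inl rfl
    · exact Or.inr ⟨hy, hx, Subtype.prop _, a⁻¹, by simp⟩
  trans := by
    rintro x y z (rfl | ⟨hx, hy, hd, a, rfl⟩) (rfl | ⟨hy', hz, hd', b, rfl⟩)
    · exact Or.inl rfl
    · exact Or.inr ⟨hy', hz, hd', b, rfl⟩
    · exact Or.inr ⟨hx, hy, hd, a, rfl⟩
    · exact Or.inr ⟨hx, hz, hd, b * a, by simp [mul_smul]⟩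

def cutSetoid : Setoid M := ⟨CutRel I A, cutRel_equivalence I A⟩

/-- The cut space `M_cut`. -/
def CutSpace : Type _ := Quotient (cutSetoid I A)

/-- The quotient map `c : M → M_cut`. -/
def cutMk (x : M) : CutSpace I A := Quotient.mk (cutSetoid I A) x

/-- The quotient topology. -/
instance : TopologicalSpace (CutSpace I A) :=
  TopologicalSpace.coinduced (cutMk I A) inferInstance

/-- The set `ℱ_M` of real valued functions on `M_cut` (with respect to some invariant boundary
defining function `f`, on whose choice it does not depend). -/
def cutFunctions : Set (CutSpace I A → ℝ) :=
  {h | ∃ f : M → ℝ, IsInvariantBDF I A f ∧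
    ContMDiffOn I 𝓘(ℝ) ∞ (fun x => h (cutMk I A x)) (I.interior M) ∧
    ∃ V : Set A.dom, IsInvariantNhd I A V ∧ ∃ K : A.dom × ℂ → ℝ,
      ContMDiffOn (I.prod 𝓘(ℝ, ℂ)) 𝓘(ℝ) ∞ K (V ×ˢ (univ : Set ℂ)) ∧
      (∀ (a : Circle), ∀ x ∈ V, ∀ z : ℂ, K (a • x, z) = K (x, (a : ℂ) * z)) ∧
      ∀ x ∈ V, h (cutMk I A x) = K (x, ((Real.sqrt (f x) : ℝ) : ℂ))}

/-- The smooth cutting construction: a manifold structure on `M_cut`, of the dimension of `M`,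
whose real valued smooth functions are exactly those in `ℱ_M`. -/
abbrev CutManifold := ManifoldStructure E (CutSpace I A) (cutFunctions I A)

end Cut

/-! ### Equivariant transverse maps -/

section Transverse

variable {E H E' H' : Type*} [NormedAddCommGroup E] [NormedSpace ℝ E] [TopologicalSpace H]
  [NormedAddCommGroup E'] [NormedSpace ℝ E'] [TopologicalSpace H']
  (I : ModelWithCorners ℝ E H) (I' : ModelWithCorners ℝ E' H')
  {M N : Type*} [TopologicalSpace M] [ChartedSpace H M] [TopologicalSpace N] [ChartedSpace H' N]
  (A : LocalCircleAction M) (B : LocalCircleAction N)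

structure IsEquivariantTransverse (ψ : M → N) : Prop where
  smooth : ContMDiff I I' ∞ ψ
  transverse : ∃ f : N → ℝ, IsInvariantBDF I' B f ∧ IsInvariantBDF I A (f ∘ ψ)
  equivariant : ∃ V : Set A.dom, IsInvariantNhd I A V ∧ ∀ x ∈ V, ∃ hx : ψ x ∈ B.dom,
    ∀ a : Circle, ψ (a • x : A.dom) = (a • (⟨ψ x, hx⟩ : B.dom) : B.dom)

variable {I I' A B} {ψ : M → N}

theorem IsEquivariantTransverse.cutRel (hψ : IsEquivariantTransverse I I' A B ψ) {x y : M}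
    (h : CutRel I A x y) : CutRel I' B (ψ x) (ψ y) := by
  obtain ⟨f, hf, hfψ⟩ := hψ.transverse
  obtain ⟨V, hV, hVe⟩ := hψ.equivariant
  have key : ∀ z ∈ I.boundary M, ψ z ∈ I'.boundary N := fun z hz =>
    (hf.zero_iff _).1 ((hfψ.zero_iff z).2 hz)
  rcases h with rfl | ⟨hx, hy, hd, a, rfl⟩
  · exact Or.inl rfl
  · obtain ⟨hx', he⟩ := hVe ⟨x, hd⟩ (hV.boundary_mem _ hx)
    exact Or.inr ⟨key _ hx, key _ hy, hx', a, (he a).symm⟩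

/-- The map `ψ_cut : M_cut → N_cut` induced by an equivariant transverse map `ψ`, that is, the
unique map with `ψ_cut ∘ c_M = c_N ∘ ψ`. -/
def cutMap (hψ : IsEquivariantTransverse I I' A B ψ) : CutSpace I A → CutSpace I' B :=
  Quotient.map' (s₁ := cutSetoid I A) (s₂ := cutSetoid I' B) ψ fun _ _ h => hψ.cutRel h

theorem cutMap_cutMk (hψ : IsEquivariantTransverse I I' A B ψ) (x : M) :
    cutMap hψ (cutMk I A x) = cutMk I' B (ψ x) := rfl

end Transverse

/-! ### Restriction of a circle action near the boundary to a subset -/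

/-- `S ∩ V` as an open subset of `S`. -/
def restrictDom {N : Type*} [TopologicalSpace N] (B : LocalCircleAction N)
    (S : Set N) (V : Set B.dom) (hV : IsOpen V) : Opens S where
  carrier := {x | ∃ h : (x : N) ∈ B.dom, (⟨x, h⟩ : B.dom) ∈ V}
  is_open' := by
    have h1 : IsOpen (Subtype.val '' V) := B.dom.2.isOpenMap_subtype_val V hV
    have h2 : {x : S | ∃ h : (x : N) ∈ B.dom, (⟨x, h⟩ : B.dom) ∈ V} =
        Subtype.val ⁻¹' (Subtype.val '' V) := by
      ext x; simp
    rw [h2]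
    exact h1.preimage continuous_subtype_val

/-- If `V` and `S ∩ V` are invariant, the circle acts on `S ∩ V`, which is an open subset
of `S`. -/
def LocalCircleAction.restrict {N : Type*} [TopologicalSpace N] (B : LocalCircleAction N)
    (S : Set N) (V : Set B.dom) (hV : IsOpen V)
    (hVinv : ∀ (a : Circle), ∀ x ∈ V, a • x ∈ V)
    (hS : ∀ (a : Circle), ∀ x ∈ V, (x : N) ∈ S → ((a • x : B.dom) : N) ∈ S) :
    LocalCircleAction S where
  dom := restrictDom B S V hV
  act :=
    { smul := fun a x =>
        ⟨⟨(a • (⟨x.1.1, x.2.fst⟩ : B.dom) : B.dom), hS a _ x.2.snd x.1.2⟩,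
          (a • (⟨x.1.1, x.2.fst⟩ : B.dom) : B.dom).2, hVinv a _ x.2.snd⟩
      one_smul := by
        rintro ⟨⟨x, hx⟩, hd, hv⟩
        refine Subtype.ext (Subtype.ext ?_)
        exact congrArg (Subtype.val : B.dom → N) (one_smul Circle (⟨x, hd⟩ : B.dom))
      mul_smul := by
        rintro a b ⟨⟨x, hx⟩, hd, hv⟩
        refine Subtype.ext (Subtype.ext ?_)
        exact congrArg (Subtype.val : B.dom → N) (mul_smul a b (⟨x, hd⟩ : B.dom)) }

theorem LocalCircleAction.restrict_smul {N : Type*} [TopologicalSpace N] (B : LocalCircleAction N)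
    (S : Set N) (V : Set B.dom) (hV : IsOpen V)
    (hVinv : ∀ (a : Circle), ∀ x ∈ V, a • x ∈ V)
    (hS : ∀ (a : Circle), ∀ x ∈ V, (x : N) ∈ S → ((a • x : B.dom) : N) ∈ S)
    (a : Circle) (x : (B.restrict S V hV hVinv hS).dom) :
    (((a • x : (B.restrict S V hV hVinv hS).dom) : S) : N) =
      ((a • (⟨x.1.1, x.2.fst⟩ : B.dom) : B.dom) : N) := rfl

end

end Cutting

open Cutting

namespace Cutting

/-! ### An inverse function theorem on half-spaces -/

section HalfSpace

variable {E₁ E₂ : Type*} [NormedAddCommGroup E₁] [NormedSpace ℝ E₁]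
  [NormedAddCommGroup E₂] [NormedSpace ℝ E₂]

/-! Charts. Near a boundary orbit the circle acts freely and `f` can serve as a coordinate, so the
orbit has an invariant neighbourhood with equivariant coordinates `(θ, f, y)` in `S¹ × [0, ε) ×
ball` (`CutDatum.nonempty_tube`). Collapsing the circles over `f = 0` is what polar coordinates do
to a disc: with `w = √f θ`, the pair `(w, y)` is a chart of the cut space with values in an open
subset of `ℂ × F` (`Tube.exists_chart`). In the interior nothing is identified, and charts of `M`
are used. The tubes come from an inverse function theorem on half-spaces, used twice: first to make
`f` linear in a chart (`CutDatum.exists_adaptedChart`), then to straighten the action in that chart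
(`CutDatum.exists_local_product`). Freeness enters through the nonvanishing of the generator and,
with compactness of the circle, through the disjointness of the translates of a small slice
(`CutDatum.exists_slice`).

Functions. Let `h` be given by `K(x, √f')`, for some boundary defining function `f'`. At the slice
point `s(‖w‖², y)` Hadamard's lemma gives `f' = ‖w‖² u`, where `u` is smooth and positive at `w =
0`; equivariance moves the phase of `w` into the second argument, so `h = K(s(‖w‖², y), √u w)`,
which is smooth through `w = 0` (`Tube.contDiffOn_cutFunction`). Conversely a smooth `g(w, y)` is
realised near a point by `K(x, z) = b(x) g(z θ(x), y(x))` with an invariant bump `b`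
(`Tube.extend`). As `f'` is existentially quantified in `cutFunctions`, two classes are carried
along: `cutFunctionsWrt` for a fixed `f`, contained in `cutFunctions`. Chart functions extend into
the smaller class, members of the larger class are smooth in charts, and the smaller class is local
by an invariant partition of unity (`CutDatum.mem_cutFunctionsWrt_of_locally`). Hence both are the
smooth functions of one manifold (`nonempty_manifoldStructure`), and the choice of `f` is
immaterial.

Maps. If `K` witnesses `h`, then `K(ψ(x), z)` witnesses `h ∘ ψ_cut`, so `ψ_cut` is smooth. At a
boundary point, in tubes, it is `(w, y) ↦ (w α(‖w‖², y), η(‖w‖², y))` with `|α| = 1`; its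
differential at the origin is rotation by `α(0)` on `ℂ` and `v ↦ dη(0, v)` on `F`. The differential
of `ψ` in coordinates `(τ, f, y)` keeps the `f`-component, and its `y`-component ignores `τ`, so
injectivity and surjectivity pass from `dψ` to `v ↦ dη(0, v)` (`injective_surjective_transfer`).
Topological embeddings are handled by saturated open sets.

Part (B) is (A) applied to the inclusion: it is an embedding because smooth functions on `S` extend
locally to `N`, and the image of an embedding carries the subset differential structure because
smooth functions extend locally along embeddings (`IsSmoothEmbedding.exists_extension`). -/

theorem convex_setOf_nonneg (ℓ : E₁ →L[ℝ] ℝ) : Convex ℝ {v | 0 ≤ ℓ v} :=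
  convex_halfSpace_ge ℓ.toLinearMap.isLinear 0

theorem exists_apply_eq_one {ℓ : E₁ →L[ℝ] ℝ} (h : ℓ ≠ 0) : ∃ e, ℓ e = 1 := by
  obtain ⟨v, hv⟩ : ∃ v, ℓ v ≠ 0 := by
    by_contra! H
    exact h (ContinuousLinearMap.ext H)
  exact ⟨(ℓ v)⁻¹ • v, by simp [hv]⟩

theorem uniqueDiffOn_inter_halfSpace {ℓ : E₁ →L[ℝ] ℝ} (h : ℓ ≠ 0) {O : Set E₁} (hO : IsOpen O) :
    UniqueDiffOn ℝ (O ∩ {v | 0 ≤ ℓ v}) := by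
  rw [inter_comm]
  refine UniqueDiffOn.inter (uniqueDiffOn_convex (convex_setOf_nonneg ℓ) ?_) hO
  obtain ⟨e, he⟩ := exists_apply_eq_one h
  refine ⟨e, mem_interior.2 ⟨{v | 0 < ℓ v}, fun v (hv : 0 < ℓ v) => hv.le,
    isOpen_lt continuous_const ℓ.continuous, ?_⟩⟩
  simp [he]

theorem isInvertible_mem_nhds [CompleteSpace E₁] (L : E₁ ≃L[ℝ] E₂) :
    ∀ᶠ T : E₁ →L[ℝ] E₂ in 𝓝 (L : E₁ →L[ℝ] E₂), ∃ L' : E₁ ≃L[ℝ] E₂, (L' : E₁ →L[ℝ] E₂) = T :=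
  L.nhds

/-- A continuous inverse of a smooth map with invertible differentials is smooth. -/
theorem contDiffOn_of_inverse [CompleteSpace E₁] {G : E₁ → E₂} {R : E₂ → E₁} {S : Set E₁}
    {T : Set E₂} (hS : UniqueDiffOn ℝ S) (hT : UniqueDiffOn ℝ T) (hG : ContDiffOn ℝ ∞ G S)
    (hinv : ∀ x ∈ S, ∃ L : E₁ ≃L[ℝ] E₂, (L : E₁ →L[ℝ] E₂) = fderivWithin ℝ G S x)
    (hR : ContinuousOn R T) (hRS : MapsTo R T S) (hGR : ∀ y ∈ T, G (R y) = y) :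
    ContDiffOn ℝ ∞ R T := by
  have hder : ∀ y ∈ T, HasFDerivWithinAt R (fderivWithin ℝ G S (R y)).inverse T y := by
    intro y hy
    obtain ⟨L, hL⟩ := hinv _ (hRS hy)
    have h1 : HasFDerivWithinAt G (L : E₁ →L[ℝ] E₂) S (R y) := by
      rw [hL]
      exact ((hG.differentiableOn (by simp)) _ (hRS hy)).hasFDerivWithinAt
    have := HasFDerivWithinAt.of_local_left_inverse
      ((hR y hy).tendsto_nhdsWithin hRS) h1 hy
      (Filter.eventually_of_mem self_mem_nhdsWithin hGR)
    rwa [← hL, ContinuousLinearMap.inverse_equiv]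
  -- Bootstrapping: the derivative of `R` at `y` is the inverse of the derivative of `G` at `R y`,
  -- so it is as regular as `R`, and `R` gains one order at each step.
  have key : ∀ n : ℕ, ContDiffOn ℝ n R T := by
    intro n
    induction n with
    | zero => exact contDiffOn_zero.2 hR
    | succ n ih =>
      rw [Nat.cast_succ, contDiffOn_succ_iff_hasFDerivWithinAt_of_uniqueDiffOn hT]
      refine ⟨by simp, _, ?_, hder⟩
      intro y hy
      have h2 : ContDiffWithinAt ℝ n (fderivWithin ℝ G S) S (R y) :=
        (hG.fderivWithin hS (m := n) (by exact_mod_cast le_top)) _ (hRS hy)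
      have h3 := h2.comp y (ih y hy) hRS
      obtain ⟨L, hL⟩ := hinv _ (hRS hy)
      have h4 : ContDiffAt ℝ n ContinuousLinearMap.inverse (fderivWithin ℝ G S (R y)) := by
        rw [← hL]
        exact contDiffAt_map_inverse L
      exact h4.comp_contDiffWithinAt y h3
  exact contDiffOn_infty.2 key

/-- The mean value inequality on a convex set. It is applied to a half-ball, where differentiability
up to the boundary is enough. -/
theorem approximatesLinearOn_of_fderivWithin {G : E₁ → E₂} {s : Set E₁} (hs : Convex ℝ s)
    {G' : E₁ → E₁ →L[ℝ] E₂} {L : E₁ →L[ℝ] E₂} {c : NNReal}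
    (hG : ∀ x ∈ s, HasFDerivWithinAt G (G' x) s x) (hc : ∀ x ∈ s, ‖G' x - L‖ ≤ c) :
    ApproximatesLinearOn G L s c := fun _ hx _ hy =>
  hs.norm_image_sub_le_of_norm_hasFDerivWithin_le' hG hc hy hx

/-- The inverse function theorem at the boundary of a half-space. -/
theorem exists_smooth_inverse_halfSpace [FiniteDimensional ℝ E₁] [FiniteDimensional ℝ E₂]
    {ℓ₁ : E₁ →L[ℝ] ℝ} {ℓ₂ : E₂ →L[ℝ] ℝ} (h₁ : ℓ₁ ≠ 0) (h₂ : ℓ₂ ≠ 0) {O : Set E₁} (hO : IsOpen O)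
    {a : E₁} (ha : a ∈ O) (ha0 : ℓ₁ a = 0) {G : E₁ → E₂}
    (hG : ContDiffOn ℝ ∞ G (O ∩ {v | 0 ≤ ℓ₁ v}))
    (hG0 : ∀ x ∈ O, 0 ≤ ℓ₁ x → 0 ≤ ℓ₂ (G x) ∧ (ℓ₂ (G x) = 0 ↔ ℓ₁ x = 0))
    (L : E₁ ≃L[ℝ] E₂) (hL : HasFDerivWithinAt G (L : E₁ →L[ℝ] E₂) (O ∩ {v | 0 ≤ ℓ₁ v}) a) :
    ∃ (R : E₂ → E₁) (W : Set E₂) (O' : Set E₁), IsOpen W ∧ IsOpen O' ∧ a ∈ O' ∧ O' ⊆ O ∧ G a ∈ W ∧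
      ContDiffOn ℝ ∞ R (W ∩ {v | 0 ≤ ℓ₂ v}) ∧
      (∀ x ∈ O', 0 ≤ ℓ₁ x → G x ∈ W ∧ R (G x) = x) ∧
      (∀ v ∈ W, 0 ≤ ℓ₂ v → R v ∈ O' ∧ 0 ≤ ℓ₁ (R v) ∧ G (R v) = v) := by
  set S := O ∩ {v | 0 ≤ ℓ₁ v} with hSdef
  have hSu : UniqueDiffOn ℝ S := uniqueDiffOn_inter_halfSpace h₁ hO
  have haS : a ∈ S := ⟨ha, ha0.ge⟩
  have hLa : fderivWithin ℝ G S a = L := hL.fderivWithin (hSu a haS)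
  have hcont : ContinuousWithinAt (fderivWithin ℝ G S) S a :=
    (hG.continuousOn_fderivWithin hSu (by simp)) a haS
  -- The approximation constant must survive a Lipschitz extension from the half-ball to the whole
  -- space, hence the factor `lipschitzExtensionConstant`; halving makes the inequality strict.
  obtain ⟨c, hc0, hc⟩ : ∃ c : NNReal, 0 < c ∧
      (Subsingleton E₁ ∨ lipschitzExtensionConstant E₂ * c < ‖(L.symm : E₂ →L[ℝ] E₁)‖₊⁻¹) := by
    rcases subsingleton_or_nontrivial E₁ with h | h
    · exact ⟨1, one_pos, Or.inl h⟩
    · have hk := lipschitzExtensionConstant_pos E₂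
      have hp : 0 < ‖(L.symm : E₂ →L[ℝ] E₁)‖₊⁻¹ := inv_pos.2 L.nnnorm_symm_pos
      refine ⟨‖(L.symm : E₂ →L[ℝ] E₁)‖₊⁻¹ / 2 / lipschitzExtensionConstant E₂, by positivity,
        Or.inr ?_⟩
      rw [mul_div_cancel₀ _ hk.ne']
      exact NNReal.half_lt_self hp.ne'
  have hev : ∀ᶠ x in 𝓝[S] a, ‖fderivWithin ℝ G S x - L‖ ≤ c ∧
      ∃ L' : E₁ ≃L[ℝ] E₂, (L' : E₁ →L[ℝ] E₂) = fderivWithin ℝ G S x := by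
    have h1 : Filter.Tendsto (fderivWithin ℝ G S) (𝓝[S] a) (𝓝 (L : E₁ →L[ℝ] E₂)) := by
      have := hcont.tendsto
      rwa [hLa] at this
    refine Filter.Eventually.and ?_ (h1.eventually (isInvertible_mem_nhds L))
    have := h1.eventually (Metric.closedBall_mem_nhds (L : E₁ →L[ℝ] E₂) (ε := c) (by exact_mod_cast hc0))
    filter_upwards [this] with x hx
    simpa [dist_eq_norm] using hx
  obtain ⟨r, hr0, hr⟩ : ∃ r > 0, Metric.ball a r ⊆ O ∧ ∀ x ∈ Metric.ball a r ∩ S,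
      ‖fderivWithin ℝ G S x - L‖ ≤ c ∧
      ∃ L' : E₁ ≃L[ℝ] E₂, (L' : E₁ →L[ℝ] E₂) = fderivWithin ℝ G S x := by
    obtain ⟨r1, h1, h1'⟩ := Metric.mem_nhdsWithin_iff.1 hev
    obtain ⟨r2, h2, h2'⟩ := Metric.isOpen_iff.1 hO a ha
    exact ⟨min r1 r2, lt_min h1 h2,
      (Metric.ball_subset_ball (min_le_right _ _)).trans h2', fun x hx =>
        h1' ⟨Metric.ball_subset_ball (min_le_left _ _) hx.1, hx.2⟩⟩
  set s := Metric.ball a r ∩ {v | 0 ≤ ℓ₁ v} with hs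
  have hsS : s ⊆ S := fun x hx => ⟨hr.1 hx.1, hx.2⟩
  have hsu : UniqueDiffOn ℝ s := uniqueDiffOn_inter_halfSpace h₁ Metric.isOpen_ball
  have hGd : ∀ x ∈ s, HasFDerivWithinAt G (fderivWithin ℝ G S x) s x := fun x hx =>
    (((hG.differentiableOn (by simp)) x (hsS hx)).hasFDerivWithinAt).mono hsS
  have happ : ApproximatesLinearOn G (L : E₁ →L[ℝ] E₂) s c :=
    approximatesLinearOn_of_fderivWithin ((convex_ball a r).inter (convex_setOf_nonneg ℓ₁)) hGd
      fun x hx => (hr.2 x ⟨hx.1, hsS hx⟩).1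
  -- Extending `G` from the half-ball to a homeomorphism of the whole spaces makes open images and a
  -- continuous inverse available at the boundary. It remains to see that `g.symm` maps the
  -- half-space to the half-space.
  obtain ⟨g, hg⟩ := happ.exists_homeomorph_extension hc
  have has : a ∈ s := ⟨Metric.mem_ball_self hr0, ha0.ge⟩
  have hGa : G a = g a := hg has
  obtain ⟨ρ, hρ0, hρ⟩ : ∃ ρ > 0, Metric.ball (g a) ρ ⊆ g '' Metric.ball a r :=
    Metric.isOpen_iff.1 (g.isOpenMap _ Metric.isOpen_ball) (g a)
      ⟨a, Metric.mem_ball_self hr0, rfl⟩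
  set W := Metric.ball (g a) ρ with hW
  have hWball : ∀ v ∈ W, g.symm v ∈ Metric.ball a r := by
    intro v hv
    obtain ⟨x, hx, rfl⟩ := hρ hv
    simpa using hx
  -- Connectedness: `ℓ₁ ∘ g.symm` is positive at one point of the convex set `W ∩ {0 < ℓ₂}`. A
  -- nonpositive value would force a zero, and there `ℓ₂` would vanish as well, since `G` matches
  -- the two boundaries.
  have hpos : ∀ v ∈ W, 0 < ℓ₂ v → 0 < ℓ₁ (g.symm v) := by
    set C := W ∩ {v | 0 < ℓ₂ v} with hC
    have hCc : IsPreconnected C :=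
      ((convex_ball (g a) ρ).inter (convex_halfSpace_gt ℓ₂.toLinearMap.isLinear 0)).isPreconnected
    have hD : IsPreconnected ((fun v => ℓ₁ (g.symm v)) '' C) :=
      hCc.image _ (ℓ₁.continuous.comp g.symm.continuous).continuousOn
    obtain ⟨e, he⟩ := exists_apply_eq_one h₁
    have htend : Filter.Tendsto (fun t : ℝ => a + t • e) (𝓝[>] 0) (𝓝 a) := by
      have : Continuous (fun t : ℝ => a + t • e) := by fun_prop
      have h := (this.tendsto 0).mono_left (nhdsWithin_le_nhds (s := Ioi 0))
      simpa using h
    obtain ⟨t, ⟨ht1, ht2⟩, ht0⟩ := (((htend.eventually (Metric.ball_mem_nhds a hr0)).and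
      (htend.eventually ((g.continuous.tendsto a).eventually (Metric.ball_mem_nhds (g a) hρ0)))).and
      self_mem_nhdsWithin).exists
    have ht0 : 0 < t := ht0
    have hlt : ℓ₁ (a + t • e) = t := by simp [ha0, he]
    have hmem : a + t • e ∈ s := ⟨ht1, by simp only [mem_ofPred_eq, hlt]; exact ht0.le⟩
    have hxC : g (a + t • e) ∈ C := by
      refine ⟨ht2, ?_⟩
      have := hG0 _ (hsS hmem).1 hmem.2
      rw [← hg hmem]
      refine lt_of_le_of_ne this.1 fun h => ?_
      rw [this.2.1 h.symm] at hlt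
      exact ht0.ne hlt
    intro v hv hv2
    by_contra! hneg
    have h0 : (0 : ℝ) ∈ (fun v => ℓ₁ (g.symm v)) '' C :=
      hD.ordConnected.out ⟨v, ⟨hv, hv2⟩, rfl⟩ ⟨_, hxC, rfl⟩ ⟨hneg, by
        simp only [Homeomorph.symm_apply_apply, hlt]; exact ht0.le⟩
    obtain ⟨w, ⟨hw, hw2⟩, hw0⟩ := h0
    have hws : g.symm w ∈ s := ⟨hWball w hw, hw0.ge⟩
    have h5 := (hG0 _ (hsS hws).1 hws.2).2.2 hw0
    rw [hg hws, Homeomorph.apply_symm_apply] at h5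
    exact (ne_of_gt hw2) h5
  have hnonneg : ∀ v ∈ W, 0 ≤ ℓ₂ v → 0 ≤ ℓ₁ (g.symm v) := by
    intro v hv hv2
    obtain ⟨e, he⟩ := exists_apply_eq_one h₂
    have htend : Filter.Tendsto (fun t : ℝ => v + t • e) (𝓝[>] 0) (𝓝 v) := by
      have : Continuous (fun t : ℝ => v + t • e) := by fun_prop
      have h := (this.tendsto 0).mono_left (nhdsWithin_le_nhds (s := Ioi 0))
      simpa using h
    have h1 : Filter.Tendsto (fun t : ℝ => ℓ₁ (g.symm (v + t • e))) (𝓝[>] 0) (𝓝 (ℓ₁ (g.symm v))) :=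
      ((ℓ₁.continuous.comp g.symm.continuous).tendsto v).comp htend
    refine ge_of_tendsto h1 ?_
    filter_upwards [htend.eventually (Metric.isOpen_ball.mem_nhds hv), self_mem_nhdsWithin]
      with t ht ht0
    have ht0 : 0 < t := ht0
    refine (hpos _ ht ?_).le
    simp only [map_add, map_smul, he, smul_eq_mul, mul_one]
    linarith
  have hback : ∀ v ∈ W, 0 ≤ ℓ₂ v → g.symm v ∈ s ∧ G (g.symm v) = v := by
    intro v hv hv2
    have : g.symm v ∈ s := ⟨hWball v hv, hnonneg v hv hv2⟩
    exact ⟨this, by rw [hg this, g.apply_symm_apply]⟩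
  refine ⟨g.symm, W, Metric.ball a r ∩ g ⁻¹' W, Metric.isOpen_ball,
    Metric.isOpen_ball.inter (Metric.isOpen_ball.preimage g.continuous),
    ⟨Metric.mem_ball_self hr0, Metric.mem_ball_self hρ0⟩, inter_subset_left.trans hr.1,
    by rw [hGa]; exact Metric.mem_ball_self hρ0, ?_, ?_, ?_⟩
  · refine contDiffOn_of_inverse hsu (uniqueDiffOn_inter_halfSpace h₂ Metric.isOpen_ball)
      (hG.mono hsS) ?_ g.symm.continuous.continuousOn
      (fun v hv => (hback v hv.1 hv.2).1) (fun v hv => (hback v hv.1 hv.2).2)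
    intro x hx
    obtain ⟨L', hL'⟩ := (hr.2 x ⟨hx.1, hsS hx⟩).2
    exact ⟨L', by rw [hL', (hGd x hx).fderivWithin (hsu x hx)]⟩
  · intro x hx hx0
    have hxs : x ∈ s := ⟨hx.1, hx0⟩
    rw [hg hxs]
    exact ⟨hx.2, g.symm_apply_apply x⟩
  · intro v hv hv2
    obtain ⟨h3, h4⟩ := hback v hv hv2
    exact ⟨⟨h3.1, by simpa using hv⟩, h3.2, h4⟩

end HalfSpace

/-! ### Integrals with parameters and Hadamard's lemma -/

section Hadamard

variable {X : Type*} [NormedAddCommGroup X] [NormedSpace ℝ X] [FiniteDimensional ℝ X]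

/-- Differentiation under the integral sign, dominated by a constant: the derivative is bounded on a
compact ball times `[0, 1]`. -/
theorem hasFDerivAt_integral_param {O : Set X} (hO : IsOpen O) {φ : X × ℝ → ℝ}
    (hφ : ContDiffOn ℝ ∞ φ (O ×ˢ univ)) {x : X} (hx : x ∈ O) :
    HasFDerivAt (fun x => ∫ t in (0 : ℝ)..1, φ (x, t))
      (∫ t in (0 : ℝ)..1, (fderiv ℝ φ (x, t)).comp (ContinuousLinearMap.inl ℝ X ℝ)) x := by
  have hOo : IsOpen (O ×ˢ (univ : Set ℝ)) := hO.prod isOpen_univ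
  have hc1 : ContinuousOn φ (O ×ˢ univ) := hφ.continuousOn
  have hc2 : ContinuousOn (fun p => (fderiv ℝ φ p).comp (ContinuousLinearMap.inl ℝ X ℝ))
      (O ×ˢ univ) :=
    (hφ.continuousOn_fderiv_of_isOpen hOo (by simp)).clm_comp continuousOn_const
  obtain ⟨r, hr, hrO⟩ := Metric.nhds_basis_closedBall.mem_iff.1 (hO.mem_nhds hx)
  obtain ⟨C, hC⟩ := ((isCompact_closedBall x r).prod (isCompact_Icc (a := (0 : ℝ)) (b := 1))
    ).exists_bound_of_continuousOn (hc2.mono (prod_mono hrO (subset_univ _)))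
  have hcurve : ∀ y ∈ O, Continuous (fun t : ℝ => (y, t)) := fun y _ => by fun_prop
  have hcφ : ∀ y ∈ O, Continuous fun t => φ (y, t) := fun y hy =>
    hc1.comp_continuous (hcurve y hy) fun t => ⟨hy, mem_univ _⟩
  refine intervalIntegral.hasFDerivAt_integral_of_dominated_of_fderiv_le
    (F := fun x t => φ (x, t)) (bound := fun _ => C)
    (F' := fun x t => (fderiv ℝ φ (x, t)).comp (ContinuousLinearMap.inl ℝ X ℝ))
    (Metric.closedBall_mem_nhds x hr) ?_ ?_ ?_ ?_ ?_ ?_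
  · filter_upwards [hO.mem_nhds hx] with y hy
    exact (hcφ y hy).aestronglyMeasurable
  · exact (hcφ x hx).intervalIntegrable _ _
  · exact (hc2.comp_continuous (hcurve x hx) fun t => ⟨hx, mem_univ _⟩).aestronglyMeasurable
  · refine Filter.Eventually.of_forall fun t ht y hy => hC (y, t) ⟨hy, ?_⟩
    rw [uIoc_of_le zero_le_one] at ht
    exact Ioc_subset_Icc_self ht
  · simp
  · refine Filter.Eventually.of_forall fun t _ y hy => ?_
    have h1 : HasFDerivAt φ (fderiv ℝ φ (y, t)) (y, t) :=
      ((hφ.contDiffAt (hOo.mem_nhds ⟨hrO hy, mem_univ _⟩)).differentiableAt (by simp)).hasFDerivAt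
    exact h1.comp y (hasFDerivAt_prodMk_left y t)

/-- Every directional derivative is again a parameter integral of a smooth integrand, so the order
of differentiability goes up by induction over all integrands at once. -/
theorem contDiffOn_integral_param {O : Set X} (hO : IsOpen O) {φ : X × ℝ → ℝ}
    (hφ : ContDiffOn ℝ ∞ φ (O ×ˢ univ)) :
    ContDiffOn ℝ ∞ (fun x => ∫ t in (0 : ℝ)..1, φ (x, t)) O := by
  rw [contDiffOn_infty]
  intro n
  have hOo : IsOpen (O ×ˢ (univ : Set ℝ)) := hO.prod isOpen_univ
  induction n generalizing φ with
  | zero =>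
    exact contDiffOn_zero.2 fun x hx =>
      (hasFDerivAt_integral_param hO hφ hx).continuousAt.continuousWithinAt
  | succ n ih =>
    rw [Nat.cast_succ, contDiffOn_succ_iff_fderiv_of_isOpen hO]
    refine ⟨fun x hx =>
      (hasFDerivAt_integral_param hO hφ hx).differentiableAt.differentiableWithinAt, by simp, ?_⟩
    rw [contDiffOn_clm_apply]
    intro v
    have hφv : ContDiffOn ℝ ∞ (fun p => fderiv ℝ φ p (v, 0)) (O ×ˢ univ) :=
      (hφ.fderiv_of_isOpen hOo (by simp)).clm_apply contDiffOn_const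
    refine (ih hφv).congr fun x hx => ?_
    rw [(hasFDerivAt_integral_param hO hφ hx).fderiv, ContinuousLinearMap.intervalIntegral_apply]
    · simp
    · refine Continuous.intervalIntegrable ?_ _ _
      have hc2 : ContinuousOn (fun p => (fderiv ℝ φ p).comp (ContinuousLinearMap.inl ℝ X ℝ))
          (O ×ˢ univ) :=
        (hφ.continuousOn_fderiv_of_isOpen hOo (by simp)).clm_comp continuousOn_const
      exact hc2.comp_continuous (by fun_prop : Continuous fun t : ℝ => (x, t))
        fun t => ⟨hx, mem_univ _⟩

variable {F : Type*} [NormedAddCommGroup F]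

/-- The half-open box `[0, ε) × B(0, ε)`. -/
def halfBox (F : Type*) [NormedAddCommGroup F] (ε : ℝ) : Set (ℝ × F) :=
  Ico 0 ε ×ˢ Metric.ball 0 ε

/-- The preimage of `halfBox F ε` under `(w, y) ↦ (‖w‖ ^ 2, y)`. -/
def diskBox (F : Type*) [NormedAddCommGroup F] (ε : ℝ) : Set (ℂ × F) :=
  {p | ‖p.1‖ ^ 2 < ε ∧ ‖p.2‖ < ε}

theorem mem_halfBox {ε : ℝ} {q : ℝ × F} : q ∈ halfBox F ε ↔ (0 ≤ q.1 ∧ q.1 < ε) ∧ ‖q.2‖ < ε := by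
  simp [halfBox]

theorem mem_diskBox {ε : ℝ} {p : ℂ × F} : p ∈ diskBox F ε ↔ ‖p.1‖ ^ 2 < ε ∧ ‖p.2‖ < ε := Iff.rfl

theorem isOpen_diskBox (ε : ℝ) : IsOpen (diskBox F ε) :=
  IsOpen.and (isOpen_lt (by fun_prop : Continuous fun p : ℂ × F => ‖p.1‖ ^ 2) continuous_const)
    (isOpen_lt (by fun_prop : Continuous fun p : ℂ × F => ‖p.2‖) continuous_const)

/-- The map `(w, y) ↦ (‖w‖ ^ 2, y)`. -/
noncomputable def sqNormFst (p : ℂ × F) : ℝ × F := (‖p.1‖ ^ 2, p.2)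

theorem sqNormFst_mem {ε : ℝ} {p : ℂ × F} : sqNormFst p ∈ halfBox F ε ↔ p ∈ diskBox F ε := by
  simp only [mem_halfBox, mem_diskBox, sqNormFst]
  exact ⟨fun h => ⟨h.1.2, h.2⟩, fun h => ⟨⟨by positivity, h.1⟩, h.2⟩⟩

variable [NormedSpace ℝ F]

theorem uniqueDiffOn_halfBox (ε : ℝ) : UniqueDiffOn ℝ (halfBox F ε) :=
  (uniqueDiffOn_Ico 0 ε).prod Metric.isOpen_ball.uniqueDiffOn

theorem contDiff_sqNormFst : ContDiff ℝ ∞ (sqNormFst : ℂ × F → ℝ × F) :=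
  ((contDiff_norm_sq ℝ).comp contDiff_fst).prodMk contDiff_snd

/-- Hadamard's lemma, for functions of `(‖w‖ ^ 2, y)`. -/
theorem exists_hadamard_quotient [FiniteDimensional ℝ F] {ε : ℝ} {g : ℝ × F → ℝ}
    (hg : ContDiffOn ℝ ∞ g (halfBox F ε)) (hg0 : ∀ y, ‖y‖ < ε → g (0, y) = 0) :
    ∃ u : ℂ × F → ℝ, ContDiffOn ℝ ∞ u (diskBox F ε) ∧
      (∀ p ∈ diskBox F ε, g (sqNormFst p) = ‖p.1‖ ^ 2 * u p) ∧
      ∀ y, u (0, y) = fderivWithin ℝ g (halfBox F ε) (0, y) (1, 0) := by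
  set k : ℝ × F → ℝ := fun q => fderivWithin ℝ g (halfBox F ε) q (1, 0) with hk
  have hkc : ContDiffOn ℝ ∞ k (halfBox F ε) :=
    (hg.fderivWithin (uniqueDiffOn_halfBox ε) (by simp)).clm_apply contDiffOn_const
  -- The usual Hadamard integral runs along `t ‖w‖²`. Here `t` is reparametrised by a smooth
  -- function with values in `[0, 1]`, equal to `0` at `0` and `1` at `1`, so that the integrand is
  -- defined and smooth for all real `t` although `g` lives on a half-open box.
  set s : ℝ → ℝ := fun t => Real.sin (Real.pi / 2 * t) ^ 2 with hs
  set s' : ℝ → ℝ := fun t =>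
    2 * Real.sin (Real.pi / 2 * t) * (Real.cos (Real.pi / 2 * t) * (Real.pi / 2)) with hs'
  have hss' : ∀ t, HasDerivAt s (s' t) t := fun t => by
    have h1 : HasDerivAt (fun t : ℝ => Real.pi / 2 * t) (Real.pi / 2) t := by
      simpa using (hasDerivAt_id t).const_mul (Real.pi / 2)
    have := (h1.sin).fun_pow 2
    simpa [hs, hs'] using this
  have hs0 : s 0 = 0 := by simp [hs]
  have hs1 : s 1 = 1 := by simp [hs]
  have hsnn : ∀ t, 0 ≤ s t := fun t => sq_nonneg _
  have hsle : ∀ t, s t ≤ 1 := fun t => Real.sin_sq_le_one _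
  have hsmooth : ContDiff ℝ ∞ s := (Real.contDiff_sin.comp (contDiff_const.mul contDiff_id)).pow 2
  have hsmooth' : ContDiff ℝ ∞ s' :=
    (contDiff_const.mul (Real.contDiff_sin.comp (contDiff_const.mul contDiff_id))).mul
      ((Real.contDiff_cos.comp (contDiff_const.mul contDiff_id)).mul contDiff_const)
  have hmem : ∀ p ∈ diskBox F ε, ∀ t, (s t * ‖p.1‖ ^ 2, p.2) ∈ halfBox F ε := by
    intro p hp t
    refine mem_halfBox.2 ⟨⟨mul_nonneg (hsnn t) (by positivity), ?_⟩, hp.2⟩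
    exact (mul_le_of_le_one_left (by positivity) (hsle t)).trans_lt hp.1
  have hφ : ContDiffOn ℝ ∞ (fun z : (ℂ × F) × ℝ => k (s z.2 * ‖z.1.1‖ ^ 2, z.1.2) * s' z.2)
      (diskBox F ε ×ˢ univ) := by
    have h1 : ContDiff ℝ ∞ fun z : (ℂ × F) × ℝ => s z.2 * ‖z.1.1‖ ^ 2 :=
      (hsmooth.comp contDiff_snd).mul
        ((contDiff_norm_sq ℝ).comp (contDiff_fst.comp contDiff_fst))
    have h2 : ContDiff ℝ ∞ fun z : (ℂ × F) × ℝ => (s z.2 * ‖z.1.1‖ ^ 2, z.1.2) :=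
      h1.prodMk (contDiff_snd.comp contDiff_fst)
    have h3 : ContDiffOn ℝ ∞ (fun z : (ℂ × F) × ℝ => k (s z.2 * ‖z.1.1‖ ^ 2, z.1.2))
        (diskBox F ε ×ˢ univ) :=
      ContDiffOn.comp (t := halfBox F ε) (g := k) hkc h2.contDiffOn
        fun z hz => hmem z.1 hz.1 z.2
    exact h3.mul (hsmooth'.comp contDiff_snd).contDiffOn
  have hint : ∀ p ∈ diskBox F ε, Continuous fun t => k (s t * ‖p.1‖ ^ 2, p.2) * s' t := by
    intro p hp
    have h1 : Continuous fun t => (s t * ‖p.1‖ ^ 2, p.2) :=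
      (hsmooth.continuous.mul continuous_const).prodMk continuous_const
    exact (hkc.continuousOn.comp_continuous h1 (hmem p hp)).mul hsmooth'.continuous
  refine ⟨_, contDiffOn_integral_param (isOpen_diskBox ε) hφ, ?_, ?_⟩
  · intro p hp
    have hder : ∀ t, HasDerivAt (fun t => g (s t * ‖p.1‖ ^ 2, p.2))
        (k (s t * ‖p.1‖ ^ 2, p.2) * s' t * ‖p.1‖ ^ 2) t := by
      intro t
      have h1 : HasDerivAt (fun t => (s t * ‖p.1‖ ^ 2, p.2)) (s' t * ‖p.1‖ ^ 2, (0 : F)) t :=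
        ((hss' t).mul_const _).prodMk (hasDerivAt_const t p.2)
      have h2 := ((hg.differentiableOn (by simp)) _ (hmem p hp t)).hasFDerivWithinAt
      have h3 := h2.comp_hasDerivWithinAt t (h1.hasDerivWithinAt (s := univ))
        fun t _ => hmem p hp t
      rw [hasDerivWithinAt_univ] at h3
      refine h3.congr_deriv ?_
      have : (s' t * ‖p.1‖ ^ 2, (0 : F)) = (s' t * ‖p.1‖ ^ 2) • ((1 : ℝ), (0 : F)) := by simp
      rw [this, map_smul, smul_eq_mul, hk]
      ring
    have h4 := intervalIntegral.integral_eq_sub_of_hasDerivAt (a := 0) (b := 1)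
      (fun t _ => hder t) (((hint p hp).mul continuous_const).intervalIntegrable _ _)
    rw [intervalIntegral.integral_mul_const, hs0, hs1, zero_mul, one_mul, hg0 _ hp.2,
      sub_zero] at h4
    rw [mul_comm]
    exact h4.symm
  · intro y
    have h1 : ∫ t in (0 : ℝ)..1, s' t = 1 := by
      rw [intervalIntegral.integral_eq_sub_of_hasDerivAt (fun t _ => hss' t)
        (hsmooth'.continuous.intervalIntegrable _ _), hs0, hs1, sub_zero]
    simp [intervalIntegral.integral_const_mul, h1, hk]

end Hadamard

/-! ### Smooth maps and smooth functions -/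

section Globalize

variable {E H : Type*} [NormedAddCommGroup E] [NormedSpace ℝ E] [TopologicalSpace H]
  [FiniteDimensional ℝ E] (I : ModelWithCorners ℝ E H)
  {Y : Type*} [TopologicalSpace Y] [ChartedSpace H Y] [IsManifold I ∞ Y] [T2Space Y]
  {V : Type*} [NormedAddCommGroup V] [NormedSpace ℝ V]

/-- A smooth bump function supported in a given neighbourhood. -/
theorem exists_bump {U : Set Y} {p : Y} (hU : U ∈ 𝓝 p) :
    ∃ b : Y → ℝ, ContMDiff I 𝓘(ℝ) ∞ b ∧ tsupport b ⊆ U ∧ b =ᶠ[𝓝 p] 1 := by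
  obtain ⟨f, -, hf⟩ := (SmoothBumpFunction.nhds_basis_tsupport (I := I) p).mem_iff.1 hU
  exact ⟨f, f.contMDiff, hf, f.eventuallyEq_one⟩

/-- A smooth function on an open set agrees near a given point with a global one. -/
theorem exists_contMDiff_eventuallyEq {U : Set Y} (hU : IsOpen U) {p : Y} (hp : p ∈ U) {g : Y → V}
    (hg : ContMDiffOn I 𝓘(ℝ, V) ∞ g U) : ∃ g' : Y → V, ContMDiff I 𝓘(ℝ, V) ∞ g' ∧ g' =ᶠ[𝓝 p] g := by
  obtain ⟨b, hb, hbU, hb1⟩ := exists_bump I (hU.mem_nhds hp)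
  refine ⟨fun y => b y • g y, ?_, ?_⟩
  · refine contMDiff_of_tsupport fun y hy => ?_
    have hyU : y ∈ U := hbU (tsupport_smul_subset_left b g hy)
    exact (hb y).smul ((hg y hyU).contMDiffAt (hU.mem_nhds hyU))
  · filter_upwards [hb1] with y hy
    simp [hy]

variable {I} {E' H' : Type*} [NormedAddCommGroup E'] [NormedSpace ℝ E'] [TopologicalSpace H']
  {I' : ModelWithCorners ℝ E' H'} {X : Type*} [TopologicalSpace X] [ChartedSpace H' X]

omit [T2Space Y] [FiniteDimensional ℝ E] [IsManifold I ∞ Y] in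
theorem contMDiffAt_of_coordinates {ι : Type*} [Fintype ι] (L : V ≃L[ℝ] (ι → ℝ)) {φ : X → V} {x : X}
    (h : ∀ i, ContMDiffAt I' 𝓘(ℝ) ∞ (fun x => L (φ x) i) x) : ContMDiffAt I' 𝓘(ℝ, V) ∞ φ x := by
  have h1 : ContMDiffAt I' 𝓘(ℝ, ι → ℝ) ∞ (fun x => L (φ x)) x := contMDiffAt_pi_space.2 h
  have h2 : ContMDiffAt I' 𝓘(ℝ, V) ∞ (fun x => L.symm (L (φ x))) x :=
    ContMDiffAt.comp x (g := L.symm) L.symm.contDiff.contMDiff.contMDiffAt h1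
  simpa using h2

/-- A continuous map that pulls back smooth functions to smooth functions is smooth. -/
theorem contMDiffAt_of_forall_comp {φ : X → Y} {x : X} (hc : ContinuousAt φ x)
    (h : ∀ g : Y → ℝ, ContMDiff I 𝓘(ℝ) ∞ g → ContMDiffAt I' 𝓘(ℝ) ∞ (g ∘ φ) x) :
    ContMDiffAt I' I ∞ φ x := by
  refine contMDiffAt_iff_target.2 ⟨hc, ?_⟩
  -- The chart is cut off to a globally defined smooth map, so that the hypothesis applies to each
  -- of its coordinates.
  obtain ⟨g, hg, hge⟩ := exists_contMDiff_eventuallyEq I (chartAt H (φ x)).open_source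
    (mem_chart_source H (φ x)) (contMDiffOn_extChartAt (I := I) (n := ∞) (x := φ x))
  have h1 : ContMDiffAt I' 𝓘(ℝ, E) ∞ (g ∘ φ) x := by
    refine contMDiffAt_of_coordinates (Module.finBasis ℝ E).equivFunL fun i => ?_
    refine h (fun y => (Module.finBasis ℝ E).equivFunL (g y) i) ?_
    exact contMDiff_pi_space.1
      ((Module.finBasis ℝ E).equivFunL.contDiff.contMDiff.comp hg) i
  refine h1.congr_of_eventuallyEq ?_
  filter_upwards [hc.eventually hge] with z hz
  simp only [Function.comp_apply, hz]

theorem contMDiff_of_forall_comp {φ : X → Y} (hc : Continuous φ)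
    (h : ∀ g : Y → ℝ, ContMDiff I 𝓘(ℝ) ∞ g → ContMDiff I' 𝓘(ℝ) ∞ (g ∘ φ)) :
    ContMDiff I' I ∞ φ := fun _ =>
  contMDiffAt_of_forall_comp hc.continuousAt fun g hg => (h g hg).contMDiffAt

end Globalize

/-! ### Charts adapted to a set of functions -/

section FunctionChart

variable {E : Type*} [NormedAddCommGroup E] [NormedSpace ℝ E]
  {X : Type*} [TopologicalSpace X]

/-- `e` is compatible with a set `F` of functions: near each point of its source,
smooth functions of `e` extend to members of `F₀`, and members of `F` are smooth in `e`. -/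
structure IsFunctionChart (F₀ F : Set (X → ℝ)) (e : OpenPartialHomeomorph X E) : Prop where
  extend : ∀ q ∈ e.source, ∀ g : E → ℝ, ContDiff ℝ ∞ g → ∃ h ∈ F₀, h =ᶠ[𝓝 q] g ∘ e
  smooth : ∀ h ∈ F, ContDiffOn ℝ ∞ (h ∘ e.symm) e.target

variable {F₀ F : Set (X → ℝ)} [FiniteDimensional ℝ E]

/-- Near each point the coordinates of `e'` are members of `F₀`, hence of `F`, and these are smooth
in `e`. -/
theorem IsFunctionChart.contDiffOn_trans {e e' : OpenPartialHomeomorph X E} (hF : F₀ ⊆ F)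
    (he : IsFunctionChart F₀ F e) (he' : IsFunctionChart F₀ F e') :
    ContDiffOn ℝ ∞ (e.symm ≫ₕ e') (e.symm ≫ₕ e').source := by
  intro v hv
  rw [OpenPartialHomeomorph.trans_source] at hv
  refine ContDiffAt.contDiffWithinAt ?_
  rw [← contMDiffAt_iff_contDiffAt]
  have hvt : v ∈ e.target := hv.1
  refine contMDiffAt_of_coordinates (Module.finBasis ℝ E).equivFunL fun i => ?_
  obtain ⟨h, hh, hhe⟩ := he'.extend (e.symm v) hv.2
    (fun y => (Module.finBasis ℝ E).equivFunL y i)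
    (contDiff_pi.1 (Module.finBasis ℝ E).equivFunL.contDiff i)
  have h1 : ContDiffAt ℝ ∞ (h ∘ e.symm) v :=
    (he.smooth h (hF hh)).contDiffAt (e.open_target.mem_nhds hvt)
  refine (contMDiffAt_iff_contDiffAt.2 h1).congr_of_eventuallyEq ?_
  filter_upwards [(e.continuousAt_symm hvt).eventually hhe] with w hw
  exact hw.symm

/-- Construction of a manifold with prescribed smooth functions. -/
theorem nonempty_manifoldStructure [T2Space X] [SecondCountableTopology X] (hF : F₀ ⊆ F)
    (hcover : ∀ p : X, ∃ e : OpenPartialHomeomorph X E, IsFunctionChart F₀ F e ∧ p ∈ e.source)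
    (hloc : ∀ h : X → ℝ, (∀ p, ∃ g ∈ F₀, h =ᶠ[𝓝 p] g) → h ∈ F₀) :
    F ⊆ F₀ ∧ Nonempty (ManifoldStructure E X F) := by
  choose e he hmem using hcover
  let cs : ChartedSpace E X :=
    { atlas := range e
      chartAt := e
      mem_chart_source := hmem
      chart_mem_atlas := fun x => ⟨x, rfl⟩ }
  have hman : IsManifold 𝓘(ℝ, E) ∞ X := by
    refine isManifold_of_contDiffOn _ _ _ ?_
    rintro _ _ ⟨p, rfl⟩ ⟨q, rfl⟩
    simpa using (he p).contDiffOn_trans hF (he q)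
  have h1 : ∀ h ∈ F, ContMDiff 𝓘(ℝ, E) 𝓘(ℝ) ∞ h := by
    intro h hh p
    have h2 : ContMDiffAt 𝓘(ℝ, E) 𝓘(ℝ) ∞ (h ∘ (e p).symm) (e p p) :=
      contMDiffAt_iff_contDiffAt.2 (((he p).smooth h hh).contDiffAt
        ((e p).open_target.mem_nhds ((e p).map_source (hmem p))))
    have h3 : ContMDiffAt 𝓘(ℝ, E) 𝓘(ℝ, E) ∞ (e p) p :=
      (contMDiffOn_chart (H := E) (I := 𝓘(ℝ, E)) (n := ∞) (x := p)).contMDiffAt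
        ((e p).open_source.mem_nhds (hmem p))
    refine (h2.comp p h3).congr_of_eventuallyEq ?_
    filter_upwards [(e p).open_source.mem_nhds (hmem p)] with q hq
    simp [(e p).left_inv hq]
  have h2 : ∀ h : X → ℝ, ContMDiff 𝓘(ℝ, E) 𝓘(ℝ) ∞ h → h ∈ F₀ := by
    intro h hh
    refine hloc h fun p => ?_
    have h3 : ContMDiffOn 𝓘(ℝ, E) 𝓘(ℝ) ∞ (h ∘ (e p).symm) (e p).target :=
      hh.comp_contMDiffOn (contMDiffOn_chart_symm (H := E) (I := 𝓘(ℝ, E)) (n := ∞) (x := p))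
    obtain ⟨g, hg, hge⟩ := exists_contMDiff_eventuallyEq 𝓘(ℝ, E) (e p).open_target
      ((e p).map_source (hmem p)) h3
    obtain ⟨k, hk, hke⟩ := (he p).extend p (hmem p) g hg.contDiff
    refine ⟨k, hk, ?_⟩
    filter_upwards [hke, ((e p).continuousAt (hmem p)).eventually hge,
      (e p).open_source.mem_nhds (hmem p)] with q hq1 hq2 hq3
    rw [hq1, Function.comp_apply, hq2, Function.comp_apply, (e p).left_inv hq3]
  -- Members of `F` are smooth, smooth functions lie in `F₀`, and `F₀ ⊆ F`: the three classes
  -- coincide.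
  exact ⟨fun h hh => h2 h (h1 h hh), ⟨⟨inferInstance, inferInstance, cs, hman,
    fun h => ⟨fun hh => hF (h2 h hh), h1 h⟩⟩⟩⟩

section Charted

variable [ChartedSpace E X] [IsManifold 𝓘(ℝ, E) ∞ X] [T2Space X]

theorem isFunctionChart_chartAt (hF : ∀ h : X → ℝ, ContMDiff 𝓘(ℝ, E) 𝓘(ℝ) ∞ h ↔ h ∈ F) (p : X) :
    IsFunctionChart F F (chartAt E p) where
  extend q hq g hg := by
    have h1 : ContMDiffOn 𝓘(ℝ, E) 𝓘(ℝ) ∞ (g ∘ chartAt E p) (chartAt E p).source :=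
      hg.contMDiff.comp_contMDiffOn contMDiffOn_chart
    obtain ⟨h, hh, hhe⟩ := exists_contMDiff_eventuallyEq 𝓘(ℝ, E) (chartAt E p).open_source hq h1
    exact ⟨h, (hF h).1 hh, hhe⟩
  smooth h hh := (((hF h).2 hh).comp_contMDiffOn contMDiffOn_chart_symm).contDiffOn

/-- Only the set of smooth functions enters. A function chart is therefore differentiable in both
directions for every manifold structure with these smooth functions, which is what permits
statements about arbitrary such structures. -/
theorem IsFunctionChart.mdifferentiable {e : OpenPartialHomeomorph X E}
    (hF : ∀ h : X → ℝ, ContMDiff 𝓘(ℝ, E) 𝓘(ℝ) ∞ h ↔ h ∈ F) (hF₀ : F₀ ⊆ F)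
    (he : IsFunctionChart F₀ F e) :
    OpenPartialHomeomorph.MDifferentiable 𝓘(ℝ, E) 𝓘(ℝ, E) e := by
  constructor
  · intro q hq
    have : ContMDiffAt 𝓘(ℝ, E) 𝓘(ℝ, E) ∞ e q := by
      refine contMDiffAt_of_coordinates (Module.finBasis ℝ E).equivFunL fun i => ?_
      obtain ⟨h, hh, hhe⟩ := he.extend q hq (fun y => (Module.finBasis ℝ E).equivFunL y i)
        (contDiff_pi.1 (Module.finBasis ℝ E).equivFunL.contDiff i)
      exact ((hF h).2 (hF₀ hh)).contMDiffAt.congr_of_eventuallyEq hhe.symm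
    exact (this.mdifferentiableAt (by simp)).mdifferentiableWithinAt
  · intro v hv
    have : ContMDiffAt 𝓘(ℝ, E) 𝓘(ℝ, E) ∞ e.symm v :=
      contMDiffAt_of_forall_comp (e.continuousAt_symm hv) fun g hg =>
        contMDiffAt_iff_contDiffAt.2 ((he.smooth g ((hF g).1 hg)).contDiffAt
          (e.open_target.mem_nhds hv))
    exact (this.mdifferentiableAt (by simp)).mdifferentiableWithinAt

variable {E' : Type*} [NormedAddCommGroup E'] [NormedSpace ℝ E'] [FiniteDimensional ℝ E']
  {Y : Type*} [TopologicalSpace Y] [ChartedSpace E' Y] [IsManifold 𝓘(ℝ, E') ∞ Y] [T2Space Y]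
  {G₀ G : Set (Y → ℝ)}

/-- The differential in function charts. -/
theorem mfderiv_comp_functionChart {e : OpenPartialHomeomorph X E}
    {e' : OpenPartialHomeomorph Y E'}
    (hF : ∀ h : X → ℝ, ContMDiff 𝓘(ℝ, E) 𝓘(ℝ) ∞ h ↔ h ∈ F) (hF₀ : F₀ ⊆ F)
    (hG : ∀ h : Y → ℝ, ContMDiff 𝓘(ℝ, E') 𝓘(ℝ) ∞ h ↔ h ∈ G) (hG₀ : G₀ ⊆ G)
    (he : IsFunctionChart F₀ F e) (he' : IsFunctionChart G₀ G e') {φ : X → Y} {p : X}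
    (hφ : MDifferentiableAt 𝓘(ℝ, E) 𝓘(ℝ, E') φ p) (hp : p ∈ e.source) (hp' : φ p ∈ e'.source)
    {T : E → E'} {T' : E →L[ℝ] E'} (hT : HasFDerivAt T T' (e p))
    (hTe : ∀ᶠ q in 𝓝 p, e' (φ q) = T (e q)) :
    (Function.Injective T' → Function.Injective (mfderiv 𝓘(ℝ, E) 𝓘(ℝ, E') φ p)) ∧
    (Function.Surjective T' → Function.Surjective (mfderiv 𝓘(ℝ, E) 𝓘(ℝ, E') φ p)) := by
  have hm := he.mdifferentiable hF hF₀
  have hm' := he'.mdifferentiable hG hG₀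
  have h1 : HasMFDerivAt 𝓘(ℝ, E) 𝓘(ℝ, E') (e' ∘ φ) p
      ((mfderiv 𝓘(ℝ, E') 𝓘(ℝ, E') e' (φ p)).comp (mfderiv 𝓘(ℝ, E) 𝓘(ℝ, E') φ p)) :=
    (hm'.mdifferentiableAt hp').hasMFDerivAt.comp p hφ.hasMFDerivAt
  have h2 : HasMFDerivAt 𝓘(ℝ, E) 𝓘(ℝ, E') (T ∘ e) p
      (ContinuousLinearMap.comp T' (mfderiv 𝓘(ℝ, E) 𝓘(ℝ, E) e p)) :=
    hT.hasMFDerivAt.comp p (hm.mdifferentiableAt hp).hasMFDerivAt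
  have h3 := hasMFDerivAt_unique h1 (h2.congr_of_eventuallyEq hTe)
  have h4 : ∀ v, mfderiv 𝓘(ℝ, E') 𝓘(ℝ, E') e' (φ p) (mfderiv 𝓘(ℝ, E) 𝓘(ℝ, E') φ p v) =
      T' (mfderiv 𝓘(ℝ, E) 𝓘(ℝ, E) e p v) := fun v => DFunLike.congr_fun h3 v
  have hb := hm.mfderiv_bijective hp
  have hb' := hm'.mfderiv_bijective hp'
  constructor
  · intro hi v w hvw
    apply hb.1
    apply hi
    rw [← h4, ← h4, hvw]
  · intro hs w
    obtain ⟨a, ha⟩ := hs (mfderiv 𝓘(ℝ, E') 𝓘(ℝ, E') e' (φ p) w)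
    obtain ⟨v, rfl⟩ := hb.2 a
    exact ⟨v, hb'.1 (by rw [h4, ha])⟩

end Charted

/-- Manifold structures can be transported along homeomorphisms. -/
theorem ManifoldStructure.nonempty_of_homeomorph {Y : Type*} [TopologicalSpace Y]
    {G : Set (Y → ℝ)} (s : ManifoldStructure E X F) (Φ : X ≃ₜ Y)
    (hG : ∀ h : Y → ℝ, h ∈ G ↔ h ∘ Φ ∈ F) : Nonempty (ManifoldStructure E Y G) := by
  let := s.charted
  have := s.isManifold
  have := s.t2
  have := s.secondCountable
  have : T2Space Y := Φ.t2Space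
  have : SecondCountableTopology Y := Φ.symm.isInducing.secondCountableTopology
  refine (nonempty_manifoldStructure (F₀ := G) (F := G) subset_rfl (fun p => ?_) fun h hh => ?_).2
  · have hc := isFunctionChart_chartAt s.smooth_iff (Φ.symm p)
    refine ⟨Φ.symm.toOpenPartialHomeomorph ≫ₕ chartAt E (Φ.symm p), ⟨?_, ?_⟩, by simp⟩
    · intro q hq g hg
      have hq' : Φ.symm q ∈ (chartAt E (Φ.symm p)).source := by simpa using hq
      obtain ⟨h, hh, hhe⟩ := hc.extend (Φ.symm q) hq' g hg
      refine ⟨h ∘ Φ.symm, (hG _).2 (by simpa [Function.comp_assoc] using hh), ?_⟩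
      filter_upwards [Φ.symm.continuous.continuousAt.eventually hhe] with z hz
      simpa using hz
    · intro h hh
      have := hc.smooth _ ((hG h).1 hh)
      simpa [Function.comp_assoc] using this
  · rw [hG, ← s.smooth_iff]
    intro x
    obtain ⟨g, hg, hge⟩ := hh (Φ x)
    have h1 : ContMDiffAt 𝓘(ℝ, E) 𝓘(ℝ) ∞ (g ∘ Φ) x := ((s.smooth_iff _).2 ((hG g).1 hg)) x
    exact h1.congr_of_eventuallyEq (Φ.continuous.continuousAt.eventually hge)

end FunctionChart

/-! ### Immersions -/

section Immersion

variable {E : Type*} [NormedAddCommGroup E] [NormedSpace ℝ E] [FiniteDimensional ℝ E]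
  {E' : Type*} [NormedAddCommGroup E'] [NormedSpace ℝ E'] [FiniteDimensional ℝ E']

omit [FiniteDimensional ℝ E'] in
/-- A smooth local inverse of a smooth map with invertible differential at a point. -/
theorem exists_smooth_local_inverse {O : Set E} (hO : IsOpen O) {a : E} (ha : a ∈ O) {G : E → E'}
    (hG : ContDiffOn ℝ ∞ G O) (L : E ≃L[ℝ] E') (hL : HasFDerivAt G (L : E →L[ℝ] E') a) :
    ∃ (R : E' → E) (W : Set E'), IsOpen W ∧ G a ∈ W ∧ ContDiffOn ℝ ∞ R W ∧ MapsTo R W O ∧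
      ∀ᶠ x in 𝓝 a, G x ∈ W ∧ R (G x) = x := by
  have hGa : ContDiffAt ℝ ∞ G a := hG.contDiffAt (hO.mem_nhds ha)
  set e := hGa.toOpenPartialHomeomorph G hL (by simp) with he
  have hea : a ∈ e.source := hGa.mem_toOpenPartialHomeomorph_source hL (by simp)
  have hcoe : ∀ x, e x = G x := fun x => rfl
  have hc : ContinuousAt (fderiv ℝ G) a :=
    (hG.continuousOn_fderiv_of_isOpen hO (by simp)).continuousAt (hO.mem_nhds ha)
  have hinv : ∀ᶠ x in 𝓝 a, ∃ L' : E ≃L[ℝ] E', (L' : E →L[ℝ] E') = fderiv ℝ G x := by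
    have h1 := hc.tendsto
    rw [hL.fderiv] at h1
    exact h1.eventually (isInvertible_mem_nhds L)
  obtain ⟨S, hS, hSo, haS⟩ := eventually_nhds_iff.1
    (hinv.and ((hO.eventually_mem ha).and (e.open_source.eventually_mem hea)))
  have hW : IsOpen (e '' S) := e.isOpen_image_of_subset_source hSo fun x hx => (hS x hx).2.2
  have hleft : ∀ x ∈ S, e.symm (e x) = x := fun x hx => e.left_inv (hS x hx).2.2
  refine ⟨e.symm, e '' S, hW, ⟨a, haS, rfl⟩, ?_, ?_, ?_⟩
  · refine contDiffOn_of_inverse (G := G) (S := S) hSo.uniqueDiffOn hW.uniqueDiffOn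
      (hG.mono fun x hx => (hS x hx).2.1) ?_ ?_ ?_ ?_
    · intro x hx
      rw [fderivWithin_of_isOpen hSo hx]
      exact (hS x hx).1
    · refine e.continuousOn_symm.mono ?_
      rintro _ ⟨x, hx, rfl⟩
      exact e.map_source (hS x hx).2.2
    · rintro _ ⟨x, hx, rfl⟩
      rwa [hleft x hx]
    · rintro _ ⟨x, hx, rfl⟩
      rw [hleft x hx, hcoe]
  · rintro _ ⟨x, hx, rfl⟩
    rw [hleft x hx]
    exact (hS x hx).2.1
  · filter_upwards [hSo.mem_nhds haS] with x hx
    exact ⟨⟨x, hx, rfl⟩, hleft x hx⟩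

variable {X : Type*} [TopologicalSpace X] [ChartedSpace E X] [IsManifold 𝓘(ℝ, E) ∞ X]
  {Y : Type*} [TopologicalSpace Y] [ChartedSpace E' Y] [IsManifold 𝓘(ℝ, E') ∞ Y] [T2Space Y]

/-- Smooth functions extend locally along embeddings. -/
theorem IsSmoothEmbedding.exists_extension {φ : X → Y}
    (hφ : IsSmoothEmbedding 𝓘(ℝ, E) 𝓘(ℝ, E') φ) {h : X → ℝ} (hh : ContMDiff 𝓘(ℝ, E) 𝓘(ℝ) ∞ h)
    (p : X) : ∃ (O : Set Y) (g : Y → ℝ), IsOpen O ∧ φ p ∈ O ∧ ContMDiff 𝓘(ℝ, E') 𝓘(ℝ) ∞ g ∧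
      ∀ x, φ x ∈ O → h x = g (φ x) := by
  obtain ⟨⟨hφs, hφi⟩, hφe⟩ := hφ
  set c := chartAt E p with hc
  set c' := chartAt E' (φ p) with hc'
  set O := c.target ∩ c.symm ⁻¹' (φ ⁻¹' c'.source) with hOdef
  have hO : IsOpen O := c.isOpen_inter_preimage_symm (c'.open_source.preimage hφs.continuous)
  have hpO : c p ∈ O := by
    refine ⟨c.map_source (mem_chart_source E p), ?_⟩
    simp only [mem_preimage, c.left_inv (mem_chart_source E p)]
    exact mem_chart_source E' (φ p)
  have hT : ContDiffOn ℝ ∞ (c' ∘ φ ∘ c.symm) O := by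
    rw [← contMDiffOn_iff_contDiffOn]
    exact (contMDiffOn_chart (H := E') (I := 𝓘(ℝ, E')) (n := ∞) (x := φ p)).comp
      (hφs.comp_contMDiffOn ((contMDiffOn_chart_symm (H := E) (I := 𝓘(ℝ, E)) (n := ∞)
        (x := p)).mono inter_subset_left)) fun v hv => hv.2
  obtain ⟨T', hTd, hTi⟩ : ∃ T' : E →L[ℝ] E',
      HasFDerivAt (c' ∘ φ ∘ c.symm) T' (c p) ∧ Function.Injective T' := by
    have h1 := ((hφs p).mdifferentiableAt (by simp)).hasMFDerivAt.2
    exact ⟨mfderiv 𝓘(ℝ, E) 𝓘(ℝ, E') φ p, hasFDerivWithinAt_univ.1 (by simpa using! h1), hφi p⟩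
  have hker : LinearMap.ker (T' : E →ₗ[ℝ] E') = ⊥ := LinearMap.ker_eq_bot.2 hTi
  obtain ⟨π, hπ⟩ := LinearMap.exists_leftInverse_of_injective _ hker
  set π' : E' →L[ℝ] E := LinearMap.toContinuousLinearMap π with hπ'
  -- Followed by a linear left inverse of the differential, `φ` becomes a local diffeomorphism in
  -- charts. Its inverse `R` gives a local retraction `c.symm ∘ R ∘ π' ∘ c'` of `Y` onto the image,
  -- and `h` is extended by composing with it.
  have hL : HasFDerivAt (fun v => π' ((c' ∘ φ ∘ c.symm) v))
      (ContinuousLinearEquiv.refl ℝ E : E →L[ℝ] E) (c p) := by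
    have h1 := π'.hasFDerivAt.comp (c p) hTd
    refine h1.congr_fderiv ?_
    ext v
    exact DFunLike.congr_fun hπ v
  obtain ⟨R, W, hW, haW, hR, hRO, hRe⟩ := exists_smooth_local_inverse hO hpO
    (π'.contDiff.comp_contDiffOn hT) _ hL
  set U : Set Y := c'.source ∩ c' ⁻¹' (π' ⁻¹' W) with hU
  have hUo : IsOpen U := c'.isOpen_inter_preimage (hW.preimage π'.continuous)
  have hpU : φ p ∈ U := by
    refine ⟨mem_chart_source E' (φ p), ?_⟩
    simpa [c.left_inv (mem_chart_source E p), hc] using haW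
  have hg0 : ContMDiffOn 𝓘(ℝ, E') 𝓘(ℝ) ∞ (fun y => h (c.symm (R (π' (c' y))))) U := by
    have h1 : ContMDiffOn 𝓘(ℝ, E') 𝓘(ℝ, E) ∞ (fun y => R (π' (c' y))) U :=
      (contMDiffOn_iff_contDiffOn.2 hR).comp (π'.contDiff.contMDiff.comp_contMDiffOn
        ((contMDiffOn_chart (H := E') (I := 𝓘(ℝ, E')) (n := ∞) (x := φ p)).mono inter_subset_left))
        fun y hy => hy.2
    exact hh.comp_contMDiffOn ((contMDiffOn_chart_symm (H := E) (I := 𝓘(ℝ, E)) (n := ∞)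
        (x := p)).comp h1 fun y hy => (hRO hy.2).1)
  obtain ⟨g, hg, hge⟩ := exists_contMDiff_eventuallyEq 𝓘(ℝ, E') hUo hpU hg0
  have hev : ∀ᶠ x in 𝓝 p, h x = g (φ x) := by
    have hcp : ContinuousAt c p := c.continuousAt (mem_chart_source E p)
    filter_upwards [hφs.continuous.continuousAt.eventually hge, hcp.eventually hRe,
      c.open_source.mem_nhds (mem_chart_source E p)] with x hx1 hx2 hx3
    rw [hx1]
    have h2 := hx2.2
    simp only [Function.comp_apply, c.left_inv hx3] at h2
    simp only [h2, c.left_inv hx3]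
  rw [hφe.isInducing.nhds_eq_comap, Filter.eventually_comap] at hev
  obtain ⟨O', hO', hO'o, hpO'⟩ := eventually_nhds_iff.1 hev
  exact ⟨O', g, hO'o, hpO', hg, fun x hx => hO' (φ x) hx x rfl⟩

end Immersion

/-! ### The total action -/

section TotalAction

variable {M : Type*} [TopologicalSpace M] (A : LocalCircleAction M)

open Classical in
/-- The action, extended by the identity outside its domain. -/
noncomputable def LocalCircleAction.sm (a : Circle) (x : M) : M :=
  if h : x ∈ A.dom then ((a • (⟨x, h⟩ : A.dom) : A.dom) : M) else x

theorem LocalCircleAction.sm_of_mem (a : Circle) {x : M} (h : x ∈ A.dom) :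
    A.sm a x = ((a • (⟨x, h⟩ : A.dom) : A.dom) : M) := dif_pos h

theorem LocalCircleAction.sm_coe (a : Circle) (x : A.dom) : A.sm a x = ((a • x : A.dom) : M) :=
  A.sm_of_mem a x.2

theorem LocalCircleAction.sm_of_notMem (a : Circle) {x : M} (h : x ∉ A.dom) : A.sm a x = x :=
  dif_neg h

theorem LocalCircleAction.sm_one (x : M) : A.sm 1 x = x := by
  by_cases h : x ∈ A.dom
  · rw [A.sm_of_mem 1 h, one_smul]
  · exact A.sm_of_notMem 1 h

theorem LocalCircleAction.sm_mul (a b : Circle) (x : M) : A.sm (a * b) x = A.sm a (A.sm b x) := by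
  by_cases h : x ∈ A.dom
  · rw [A.sm_of_mem _ h, A.sm_of_mem b h, A.sm_coe, mul_smul]
  · rw [A.sm_of_notMem _ h, A.sm_of_notMem _ h, A.sm_of_notMem _ h]

end TotalAction

/-! ### Passing from an open subset to the whole space -/

section Retraction

variable {E H : Type*} [NormedAddCommGroup E] [NormedSpace ℝ E] [TopologicalSpace H]
  (I : ModelWithCorners ℝ E H) {M : Type*} [TopologicalSpace M] [ChartedSpace H M]

/-- Points outside `U` go to an arbitrary point of it. Composition with `r` turns functions on the
subtype into functions on `M` that are smooth on `U`. -/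
theorem exists_contMDiffOn_retraction (U : Opens M) (hU : (U : Set M).Nonempty) :
    ∃ r : M → U, ContMDiffOn I I ∞ r U ∧ ∀ x : U, r x = x := by
  classical
  obtain ⟨x₀, hx₀⟩ := hU
  let r : M → U := fun x => if h : x ∈ U then ⟨x, h⟩ else ⟨x₀, hx₀⟩
  have hr : ∀ x : U, r x = x := fun x => dif_pos x.2
  refine ⟨r, fun x hx => ?_, hr⟩
  have h1 : ContMDiffAt I I ∞ (fun y : U => r y) ⟨x, hx⟩ := by
    simp only [hr]
    exact contMDiffAt_id
  exact (contMDiffAt_subtype_iff.1 h1).contMDiffWithinAt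

end Retraction

/-! ### The local data near the boundary -/

section Datum

variable {E H : Type*} [NormedAddCommGroup E] [NormedSpace ℝ E] [TopologicalSpace H]
  (I : ModelWithCorners ℝ E H) {M : Type*} [TopologicalSpace M] [ChartedSpace H M]

/-- A circle action `σ` that is smooth and free on an invariant open neighbourhood `D` of the
boundary, and a boundary defining function that is invariant on `D`. -/
structure CutDatum (σ : Circle → M → M) (f : M → ℝ) (D : Set M) : Prop where
  one : ∀ x, σ 1 x = x
  mul : ∀ a b x, σ (a * b) x = σ a (σ b x)
  isOpen : IsOpen D
  bdry : I.boundary M ⊆ D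
  maps : ∀ a, ∀ x ∈ D, σ a x ∈ D
  smoothOn : ContMDiffOn ((𝓡 1).prod I) I ∞ (fun p : Circle × M => σ p.1 p.2) (univ ×ˢ D)
  free : ∀ a, ∀ x ∈ D, σ a x = x → a = 1
  f_smooth : ContMDiff I 𝓘(ℝ) ∞ f
  f_nonneg : ∀ x, 0 ≤ f x
  f_zero : ∀ x, f x = 0 ↔ x ∈ I.boundary M
  f_deriv : ∀ x ∈ I.boundary M, mfderiv I 𝓘(ℝ) f x ≠ 0
  f_inv : ∀ a, ∀ x ∈ D, f (σ a x) = f x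

variable {I}

theorem IsFreeNearBoundary.contMDiffOn_sm {A : LocalCircleAction M} (hA : IsFreeNearBoundary I A) :
    ContMDiffOn ((𝓡 1).prod I) I ∞ (fun p : Circle × M => A.sm p.1 p.2)
      (univ ×ˢ (A.dom : Set M)) := by
  rintro ⟨a, x⟩ ⟨-, hx⟩
  obtain ⟨r, hr, hrx⟩ := exists_contMDiffOn_retraction I A.dom ⟨x, hx⟩
  have h1 : ContMDiffWithinAt ((𝓡 1).prod I) ((𝓡 1).prod I) ∞
      (fun p : Circle × M => (p.1, r p.2)) (univ ×ˢ (A.dom : Set M)) (a, x) :=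
    contMDiffWithinAt_fst.prodMk
      ((hr x hx).comp (a, x) contMDiffWithinAt_snd fun p hp => hp.2)
  have h2 : ContMDiff ((𝓡 1).prod I) I ∞ (fun p : Circle × A.dom => ((p.1 • p.2 : A.dom) : M)) :=
    contMDiff_subtype_val.comp hA.smooth
  refine ((h2.contMDiffAt (x := (a, r x))).comp_contMDiffWithinAt (a, x) h1).congr_of_mem
    (fun p hp => ?_) ⟨mem_univ _, hx⟩
  have h3 : r p.2 = ⟨p.2, hp.2⟩ := hrx ⟨p.2, hp.2⟩
  simp only [Function.comp_apply, h3]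
  exact A.sm_of_mem _ hp.2

theorem IsInvariantNhd.image {A : LocalCircleAction M} {V : Set A.dom}
    (hA : ∀ x ∈ I.boundary M, x ∈ A.dom) (hV : IsInvariantNhd I A V) :
    IsOpen (Subtype.val '' V) ∧ I.boundary M ⊆ Subtype.val '' V ∧
      (∀ a, ∀ x ∈ Subtype.val '' V, A.sm a x ∈ Subtype.val '' V) := by
  refine ⟨A.dom.2.isOpenMap_subtype_val V hV.isOpen,
    fun x hx => ⟨⟨x, hA x hx⟩, hV.boundary_mem _ hx, rfl⟩, ?_⟩
  rintro a _ ⟨x, hx, rfl⟩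
  exact ⟨a • x, hV.smul_mem a x hx, (A.sm_coe a x).symm⟩

theorem IsInvariantBDF.exists_cutDatum {A : LocalCircleAction M} (hA : IsFreeNearBoundary I A)
    {f : M → ℝ} (hf : IsInvariantBDF I A f) : ∃ D ⊆ (A.dom : Set M), CutDatum I A.sm f D := by
  obtain ⟨V, hV, hVf⟩ := hf.invariant
  obtain ⟨h1, h2, h3⟩ := hV.image hA.boundary_subset
  have hsub : Subtype.val '' V ⊆ (A.dom : Set M) := by rintro _ ⟨x, -, rfl⟩; exact x.2
  refine ⟨Subtype.val '' V, hsub, A.sm_one, A.sm_mul, h1, h2, h3,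
    hA.contMDiffOn_sm.mono (prod_mono subset_rfl hsub), ?_, hf.smooth, hf.nonneg, hf.zero_iff,
    hf.deriv_ne_zero, ?_⟩
  · rintro a _ ⟨x, hx, rfl⟩ h
    rw [A.sm_coe] at h
    exact hA.free a x (Subtype.ext h)
  · rintro a _ ⟨x, hx, rfl⟩
    rw [A.sm_coe]
    exact hVf a x hx

variable {σ : Circle → M → M} {f : M → ℝ} {D : Set M}

namespace CutDatum

variable (C : CutDatum I σ f D)
include C

theorem inv_smul (a : Circle) (x : M) : σ a⁻¹ (σ a x) = x := by
  rw [← C.mul, inv_mul_cancel, C.one]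

theorem smul_inv (a : Circle) (x : M) : σ a (σ a⁻¹ x) = x := by
  rw [← C.mul, mul_inv_cancel, C.one]

theorem smul_contMDiffWithinAt {E' H' : Type*} [NormedAddCommGroup E'] [NormedSpace ℝ E']
    [TopologicalSpace H'] {J : ModelWithCorners ℝ E' H'} {X : Type*} [TopologicalSpace X]
    [ChartedSpace H' X] {θ : X → Circle} {g : X → M} {s : Set X} {x : X}
    (hθ : ContMDiffWithinAt J (𝓡 1) ∞ θ s x) (hg : ContMDiffWithinAt J I ∞ g s x) (hx : g x ∈ D) :
    ContMDiffWithinAt J I ∞ (fun x => σ (θ x) (g x)) s x := by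
  have h1 : ContMDiffAt ((𝓡 1).prod I) I ∞ (fun p : Circle × M => σ p.1 p.2) (θ x, g x) :=
    C.smoothOn.contMDiffAt ((isOpen_univ.prod C.isOpen).mem_nhds ⟨mem_univ _, hx⟩)
  exact h1.comp_contMDiffWithinAt x (hθ.prodMk hg)

theorem contMDiffOn_smul (a : Circle) : ContMDiffOn I I ∞ (σ a) D := fun _ hx =>
  C.smul_contMDiffWithinAt contMDiffWithinAt_const contMDiffWithinAt_id hx

theorem continuousOn : ContinuousOn (fun p : Circle × M => σ p.1 p.2) (univ ×ˢ D) :=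
  C.smoothOn.continuousOn

theorem smul_mem_iff {a : Circle} {x : M} : σ a x ∈ D ↔ x ∈ D :=
  ⟨fun h => by simpa [C.inv_smul] using C.maps a⁻¹ _ h, C.maps a x⟩

theorem boundary_smul {a : Circle} {x : M} (hx : x ∈ D) :
    σ a x ∈ I.boundary M ↔ x ∈ I.boundary M := by
  rw [← C.f_zero, C.f_inv a x hx, C.f_zero]

theorem interior_iff {x : M} : x ∈ I.interior M ↔ 0 < f x := by
  rw [← I.compl_boundary, mem_compl_iff, ← C.f_zero]
  exact ⟨fun h => lt_of_le_of_ne (C.f_nonneg x) (Ne.symm h), fun h => h.ne'⟩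

theorem isOpen_interior : IsOpen (I.interior M) := by
  have : I.interior M = f ⁻¹' Ioi 0 := by ext x; exact C.interior_iff
  rw [this]
  exact isOpen_Ioi.preimage C.f_smooth.continuous

theorem isClosed_boundary : IsClosed (I.boundary M) := by
  rw [← I.compl_interior]
  exact C.isOpen_interior.isClosed_compl

end CutDatum

end Datum

/-! ### Charts in which the boundary defining function is linear -/

section AdaptedChart

theorem frontier_setOf_nonneg {E : Type*} [NormedAddCommGroup E] [NormedSpace ℝ E] {ℓ : E →L[ℝ] ℝ}
    (hℓ : ℓ ≠ 0) : frontier {v | 0 ≤ ℓ v} = {v | ℓ v = 0} := by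
  have h1 : IsOpenMap ℓ := ℓ.isOpenMap_of_ne_zero hℓ
  have h2 := h1.preimage_frontier_eq_frontier_preimage ℓ.continuous (Ici 0)
  rw [frontier_Ici] at h2
  ext v
  have h3 : v ∈ ℓ ⁻¹' {0} ↔ v ∈ frontier (ℓ ⁻¹' Ici 0) := by rw [h2]
  exact h3.symm

/-- The map fixes the kernel of `ℓ` and stretches `e` by `c`; stretching by `c⁻¹` undoes it. -/
theorem exists_shear {E : Type*} [NormedAddCommGroup E] [NormedSpace ℝ E] {ℓ : E →L[ℝ] ℝ} {e : E}
    (he : ℓ e = 1) {c : ℝ} (hc : c ≠ 0) :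
    ∃ L : E ≃L[ℝ] E, ∀ v, L v = v + ((c - 1) * ℓ v) • e := by
  let sh : ℝ → E →L[ℝ] E := fun c => ContinuousLinearMap.id ℝ E + ((c - 1) • ℓ).smulRight e
  have hsh : ∀ c v, sh c v = v + ((c - 1) * ℓ v) • e := fun c v => by simp [sh]
  have hinv : ∀ c : ℝ, c ≠ 0 → ∀ v, sh c⁻¹ (sh c v) = v := by
    intro c hc v
    simp only [hsh, map_add, map_smul, he, smul_eq_mul, mul_one, add_assoc, ← add_smul]
    have : (c - 1) * ℓ v + (c⁻¹ - 1) * (ℓ v + (c - 1) * ℓ v) = 0 := by field_simp; ring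
    rw [this, zero_smul, add_zero]
  exact ⟨ContinuousLinearEquiv.equivOfInverse (sh c) (sh c⁻¹) (hinv c hc)
    (fun v => by simpa using hinv c⁻¹ (inv_ne_zero hc) v), fun v => hsh c v⟩

variable {E H : Type*} [NormedAddCommGroup E] [NormedSpace ℝ E] [TopologicalSpace H]
  {I : ModelWithCorners ℝ E H} {M : Type*} [TopologicalSpace M] [ChartedSpace H M]
  [IsManifold I ∞ M] {σ : Circle → M → M} {f : M → ℝ} {D : Set M}

/-- Charts of `M` near a boundary point in which `f` is a linear form. -/
structure AdaptedChart (I : ModelWithCorners ℝ E H) (f : M → ℝ) (D : Set M) (x₀ : M)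
    (ℓ : E →L[ℝ] ℝ) (κ : M → E) (κi : E → M) (U : Set M) (W : Set E) : Prop where
  ne_zero : ℓ ≠ 0
  isOpen_U : IsOpen U
  isOpen_W : IsOpen W
  mem : x₀ ∈ U
  apply_center : κ x₀ = 0
  subset : U ⊆ D
  smooth : ContMDiffOn I 𝓘(ℝ, E) ∞ κ U
  smooth_inv : ContMDiffOn 𝓘(ℝ, E) I ∞ κi (W ∩ {v | 0 ≤ ℓ v})
  f_eq : ∀ x ∈ U, f x = ℓ (κ x)
  maps : ∀ x ∈ U, κ x ∈ W
  left_inv : ∀ x ∈ U, κi (κ x) = x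
  maps_inv : ∀ v ∈ W, 0 ≤ ℓ v → κi v ∈ U
  right_inv : ∀ v ∈ W, 0 ≤ ℓ v → κ (κi v) = v

/-- In a boundary chart the coordinate `ℓ` is replaced by `f` along a vector `e` with `ℓ e = 1`. At
a boundary point `df` is a nonzero multiple of `ℓ`, so the change of coordinates has a shear as its
differential and the inverse function theorem on the half-space applies. -/
theorem CutDatum.exists_adaptedChart (hI : IsHalfSpaceModel I) (C : CutDatum I σ f D) {x₀ : M}
    (hx₀ : x₀ ∈ I.boundary M) : ∃ ℓ κ κi U W, AdaptedChart I f D x₀ ℓ κ κi U W := by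
  obtain ⟨hfin, ℓ, hℓ⟩ := hI
  set φ := extChartAt I x₀ with hφ
  set c := chartAt H x₀ with hc
  have hb : ∀ x ∈ c.source, (x ∈ I.boundary M ↔ I (c x) ∈ frontier (range I)) := by
    intro x hx
    have h1 := I.isInteriorPoint_iff_of_mem_atlas (n := ∞) (by simp) (chart_mem_atlas H x₀) hx
    have h2 : I (c x) ∈ range I := mem_range_self _
    rw [← not_iff_not, ← mem_interior_iff_notMem_frontier h2]
    refine (I.isInteriorPoint_iff_not_isBoundaryPoint x).symm.trans (h1.trans ?_)
    exact ⟨fun h => OpenPartialHomeomorph.interior_extend_target_subset_interior_range _ h,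
      fun h => c.mem_interior_extend_target (c.map_source hx) h⟩
  have hℓ0 : ℓ ≠ 0 := by
    rintro rfl
    have h1 := (hb x₀ (mem_chart_source H x₀)).1 hx₀
    rw [hℓ] at h1
    simp at h1
  have hb' : ∀ x ∈ c.source, (x ∈ I.boundary M ↔ ℓ (φ x) = 0) := fun x hx => by
    rw [hb x hx, hℓ, frontier_setOf_nonneg hℓ0]
    rfl
  have hx₀s : x₀ ∈ c.source := mem_chart_source H x₀
  have hsrc : φ.source = c.source := extChartAt_source I x₀
  set O : Set E := I.symm ⁻¹' (c.target ∩ c.symm ⁻¹' D) with hO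
  have hOo : IsOpen O := (c.isOpen_inter_preimage_symm C.isOpen).preimage I.continuous_symm
  have hOt : ∀ v, v ∈ O → 0 ≤ ℓ v → v ∈ φ.target ∧ φ.symm v ∈ D := by
    intro v hv hv0
    have hvr : v ∈ range I := by rw [hℓ]; exact hv0
    refine ⟨?_, hv.2⟩
    rw [hφ, extChartAt_target]
    exact ⟨hv.1, hvr⟩
  have htO : ∀ x ∈ c.source, x ∈ D → φ x ∈ O ∧ 0 ≤ ℓ (φ x) := by
    intro x hx hxD
    refine ⟨?_, ?_⟩
    · have h1 : I.symm (φ x) = c x := by simp [hφ, hc]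
      simp only [hO, mem_preimage, mem_inter_iff, h1, c.map_source hx, c.left_inv hx, hxD, and_self]
    · have : φ x ∈ range I := ⟨c x, by simp [hφ, hc]⟩
      rw [hℓ] at this
      exact this
  have hx₀D : x₀ ∈ D := C.bdry hx₀
  set v₀ := φ x₀ with hv₀
  have hv₀0 : ℓ v₀ = 0 := (hb' x₀ hx₀s).1 hx₀
  obtain ⟨e, he⟩ := exists_apply_eq_one hℓ0
  set S := O ∩ {v | 0 ≤ ℓ v} with hS
  have hv₀S : v₀ ∈ S := htO x₀ hx₀s hx₀D
  set fh : E → ℝ := fun v => f (φ.symm v) with hfh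
  have hfhs : ContDiffOn ℝ ∞ fh S := by
    rw [← contMDiffOn_iff_contDiffOn]
    exact C.f_smooth.comp_contMDiffOn
      ((contMDiffOn_extChartAt_symm x₀).mono fun v hv => (hOt v hv.1 hv.2).1)
  have hf0 : ∀ v ∈ S, (fh v = 0 ↔ ℓ v = 0) := by
    intro v hv
    have h1 := (hOt v hv.1 hv.2).1
    have h2 : φ.symm v ∈ c.source := hsrc ▸ φ.map_target h1
    rw [hfh, C.f_zero, hb' _ h2, φ.right_inv h1]
  obtain ⟨A, hA, hA0⟩ : ∃ A : E →L[ℝ] ℝ, HasFDerivWithinAt fh A S v₀ ∧ A ≠ 0 := by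
    have h1 := ((C.f_smooth x₀).mdifferentiableAt (by simp)).hasMFDerivAt.2
    refine ⟨mfderiv I 𝓘(ℝ) f x₀, ?_, C.f_deriv x₀ hx₀⟩
    have h2 : S ⊆ range I := fun v hv => by rw [hℓ]; exact hv.2
    exact HasFDerivWithinAt.mono (by simpa using! h1) h2
  -- For such `v` the line through `v₀` in direction `v` stays in the boundary, where `f` vanishes.
  have hAker : ∀ v, ℓ v = 0 → A v = 0 := by
    intro v hv
    have hline : HasDerivAt (fun t : ℝ => v₀ + t • v) v 0 := by
      simpa using ((hasDerivAt_id (0 : ℝ)).smul_const v).const_add v₀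
    have hev : ∀ᶠ t : ℝ in 𝓝 0, v₀ + t • v ∈ S := by
      have h1 : Filter.Tendsto (fun t : ℝ => v₀ + t • v) (𝓝 0) (𝓝 v₀) := by
        have := hline.continuousAt.tendsto
        simpa using this
      filter_upwards [h1.eventually (hOo.eventually_mem hv₀S.1)] with t ht
      exact ⟨ht, by simp [hv, hv₀0]⟩
    have h2 : HasDerivAt (fun t : ℝ => fh (v₀ + t • v)) (A v) 0 := by
      have hA' : HasFDerivWithinAt fh A S (v₀ + (0 : ℝ) • v) := by simpa using hA
      exact hA'.comp_hasDerivAt (0 : ℝ) hline hev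
    have h3 : HasDerivAt (fun t : ℝ => fh (v₀ + t • v)) 0 0 := by
      refine (hasDerivAt_const (0 : ℝ) (0 : ℝ)).congr_of_eventuallyEq ?_
      filter_upwards [hev] with t ht
      exact (hf0 _ ht).2 (by simp [hv, hv₀0])
    exact h2.unique h3
  have hAe : ∀ v, A v = A e * ℓ v := by
    intro v
    have h1 := hAker (v - ℓ v • e) (by simp [he])
    simp only [map_sub, map_smul, smul_eq_mul] at h1
    linarith
  have hAe0 : A e ≠ 0 := fun h => hA0 (ContinuousLinearMap.ext fun v => by simp [hAe v, h])
  obtain ⟨L, hL⟩ := exists_shear he hAe0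
  set Φ : E → E := fun v => (v - v₀) + (fh v - ℓ v) • e with hΦ
  have hℓΦ : ∀ v, ℓ (Φ v) = fh v := fun v => by simp [hΦ, he, hv₀0]
  have hΦv₀ : Φ v₀ = 0 := by
    have : fh v₀ = 0 := (hf0 v₀ hv₀S).2 hv₀0
    simp [hΦ, this, hv₀0]
  have hΦs : ContDiffOn ℝ ∞ Φ S :=
    (contDiffOn_id.sub contDiffOn_const).add
      ((hfhs.sub ℓ.contDiff.contDiffOn).smul contDiffOn_const)
  have hΦd : HasFDerivWithinAt Φ (L : E →L[ℝ] E) S v₀ := by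
    have h1 : HasFDerivWithinAt Φ (ContinuousLinearMap.id ℝ E + (A - ℓ).smulRight e) S v₀ :=
      ((hasFDerivWithinAt_id v₀ S).sub_const v₀).add
        ((hA.sub ℓ.hasFDerivWithinAt).smul_const e)
    refine h1.congr_fderiv ?_
    ext v
    simp only [add_apply, ContinuousLinearMap.id_apply,
      ContinuousLinearMap.smulRight_apply, sub_apply, hAe v,
      ContinuousLinearEquiv.coe_coe, hL v]
    ring_nf
  obtain ⟨R, W, O', hWo, hO'o, hv₀O', hO'O, hW0, hR, hO'W, hWO'⟩ :=
    exists_smooth_inverse_halfSpace hℓ0 hℓ0 hOo hv₀S.1 hv₀0 hΦs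
      (fun v hv hv0 => by rw [hℓΦ]; exact ⟨C.f_nonneg _, hf0 v ⟨hv, hv0⟩⟩) L hΦd
  have hκ : ContMDiffOn I 𝓘(ℝ, E) ∞ φ c.source := contMDiffOn_extChartAt
  have hU : IsOpen (c.source ∩ φ ⁻¹' O') :=
    hκ.continuousOn.isOpen_inter_preimage c.open_source hO'o
  refine ⟨ℓ, Φ ∘ φ, φ.symm ∘ R, (c.source ∩ φ ⁻¹' O') ∩ D, W, hℓ0, hU.inter C.isOpen, hWo,
    ⟨⟨hx₀s, hv₀O'⟩, hx₀D⟩, hΦv₀, inter_subset_right, ?_, ?_, ?_, ?_, ?_, ?_, ?_⟩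
  · exact (contMDiffOn_iff_contDiffOn.2 hΦs).comp (hκ.mono fun x hx => hx.1.1)
      fun x hx => htO x hx.1.1 hx.2
  · refine (contMDiffOn_extChartAt_symm x₀).comp (contMDiffOn_iff_contDiffOn.2 hR) fun v hv => ?_
    obtain ⟨h1, h2, -⟩ := hWO' v hv.1 hv.2
    exact (hOt _ (hO'O h1) h2).1
  · rintro x ⟨⟨hx, -⟩, hxD⟩
    rw [Function.comp_apply, hℓΦ]
    exact congrArg f (φ.left_inv (hsrc ▸ hx)).symm
  · rintro x ⟨⟨hx, hxO⟩, hxD⟩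
    exact (hO'W _ hxO (htO x hx hxD).2).1
  · rintro x ⟨⟨hx, hxO⟩, hxD⟩
    simp only [Function.comp_apply]
    rw [(hO'W _ hxO (htO x hx hxD).2).2]
    exact φ.left_inv (hsrc ▸ hx)
  · intro v hv hv0
    obtain ⟨h1, h2, -⟩ := hWO' v hv hv0
    obtain ⟨h3, h4⟩ := hOt _ (hO'O h1) h2
    refine ⟨⟨hsrc ▸ φ.map_target h3, ?_⟩, h4⟩
    simpa only [Function.comp_apply, mem_preimage, φ.right_inv h3] using h1
  · intro v hv hv0
    obtain ⟨h1, h2, h5⟩ := hWO' v hv hv0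
    obtain ⟨h3, h4⟩ := hOt _ (hO'O h1) h2
    simp only [Function.comp_apply, φ.right_inv h3, h5]

end AdaptedChart

/-! ### Product coordinates near a boundary point -/

section LocalProduct

/-- Linear coordinates made of the orbit direction `ξ`, a direction `e` transverse to the boundary,
and a complement `F` tangent to the boundary. -/
theorem exists_splitting {E : Type*} [NormedAddCommGroup E] [NormedSpace ℝ E]
    {ℓ : E →L[ℝ] ℝ} (hℓ : ℓ ≠ 0) {ξ : E} (hξ : ξ ≠ 0) (hℓξ : ℓ ξ = 0) :
    ∃ (F : Submodule ℝ E) (L : (ℝ × (ℝ × F)) ≃L[ℝ] E) (e : E),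
      (∀ p, L p = p.1 • ξ + (p.2.1 • e + (p.2.2 : E))) ∧ ℓ e = 1 ∧ ∀ y : F, ℓ y = 0 := by
  obtain ⟨e, he⟩ := exists_apply_eq_one hℓ
  obtain ⟨l₀, hl₀⟩ := SeparatingDual.exists_eq_one (R := ℝ) hξ
  -- The correction makes `l` vanish on `e` and leaves `l ξ = 1` untouched, because `ℓ ξ = 0`.
  set l : E →L[ℝ] ℝ := l₀ - l₀ e • ℓ with hl
  have hle : l e = 0 := by simp [hl, he]
  have hlξ : l ξ = 1 := by simp [hl, hl₀, hℓξ]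
  set F : Submodule ℝ E := LinearMap.ker (ℓ : E →ₗ[ℝ] ℝ) ⊓ LinearMap.ker (l : E →ₗ[ℝ] ℝ) with hF
  have hyℓ : ∀ y : F, ℓ y = 0 := fun y => y.2.1
  have hyl : ∀ y : F, l y = 0 := fun y => y.2.2
  let L₁ : (ℝ × (ℝ × F)) →L[ℝ] E :=
    (ContinuousLinearMap.fst ℝ ℝ (ℝ × F)).smulRight ξ +
      (((ContinuousLinearMap.fst ℝ ℝ F).comp (ContinuousLinearMap.snd ℝ ℝ (ℝ × F))).smulRight e +
        F.subtypeL.comp ((ContinuousLinearMap.snd ℝ ℝ F).comp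
          (ContinuousLinearMap.snd ℝ ℝ (ℝ × F))))
  have hL₁ : ∀ p, L₁ p = p.1 • ξ + (p.2.1 • e + (p.2.2 : E)) := fun p => by simp [L₁]
  let pr : E →L[ℝ] E := ContinuousLinearMap.id ℝ E - l.smulRight ξ - ℓ.smulRight e
  have hpr : ∀ v, pr v = v - l v • ξ - ℓ v • e := fun v => by simp [pr]
  have hprF : ∀ v, pr v ∈ F := fun v =>
    ⟨by simp [hpr, hℓξ, he], by simp [hpr, hlξ, hle]⟩
  let L₂ : E →L[ℝ] (ℝ × (ℝ × F)) := l.prod (ℓ.prod (pr.codRestrict F hprF))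
  have h1 : ∀ p, L₂ (L₁ p) = p := by
    rintro ⟨τ, t, y⟩
    have h2 : pr (L₁ (τ, t, y)) = y := by
      simp [hpr, hL₁, hlξ, hle, hyl, hℓξ, he, hyℓ]
    refine Prod.ext ?_ (Prod.ext ?_ (Subtype.ext h2))
    · simp [L₂, hL₁, hlξ, hle, hyl]
    · simp [L₂, hL₁, hℓξ, he, hyℓ]
  have h2 : ∀ v, L₁ (L₂ v) = v := by
    intro v
    rw [hL₁]
    simp [L₂, hpr]
  exact ⟨F, ContinuousLinearEquiv.equivOfInverse L₁ L₂ h1 h2, e, fun p => hL₁ p, he, hyℓ⟩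

variable {E H : Type*} [NormedAddCommGroup E] [NormedSpace ℝ E] [TopologicalSpace H]
  {I : ModelWithCorners ℝ E H} {M : Type*} [TopologicalSpace M] [ChartedSpace H M]
  [IsManifold I ∞ M] {σ : Circle → M → M} {f : M → ℝ} {D : Set M}
  {x₀ : M} {ℓ : E →L[ℝ] ℝ} {κ : M → E} {κi : E → M} {U : Set M} {W : Set E}

/-- The action in an adapted chart. -/
noncomputable def chartFlow (σ : Circle → M → M) (κ : M → E) (κi : E → M) (p : ℝ × E) : E :=
  κ (σ (Circle.exp p.1) (κi p.2))

-- For points near the centre and small times the action stays in the chart. As `f` is `ℓ` there,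
-- invariance of `f` says that the flow preserves `ℓ`.
omit [IsManifold I ∞ M] in
theorem CutDatum.exists_chartFlow (C : CutDatum I σ f D) (K : AdaptedChart I f D x₀ ℓ κ κi U W) :
    ∃ O : Set (ℝ × E), IsOpen O ∧ (0, 0) ∈ O ∧
      (∀ p ∈ O, p.2 ∈ W ∧ (0 ≤ ℓ p.2 → σ (Circle.exp p.1) (κi p.2) ∈ U)) ∧
      ContDiffOn ℝ ∞ (chartFlow σ κ κi) (O ∩ {p | 0 ≤ ℓ p.2}) ∧
      (∀ p ∈ O, 0 ≤ ℓ p.2 → ℓ (chartFlow σ κ κi p) = ℓ p.2) := by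
  set S : Set (ℝ × E) := {p | p.2 ∈ W ∩ {v | 0 ≤ ℓ v}} with hS
  set q : ℝ × E → M := fun p => σ (Circle.exp p.1) (κi p.2) with hq
  have hqs : ContMDiffOn 𝓘(ℝ, ℝ × E) I ∞ q S := by
    intro p hp
    refine C.smul_contMDiffWithinAt ?_ ?_ (K.subset (K.maps_inv _ hp.1 hp.2))
    · exact (contMDiff_circleExp.comp contDiff_fst.contMDiff).contMDiffAt.contMDiffWithinAt
    · exact (K.smooth_inv p.2 hp).comp p contDiff_snd.contMDiff.contMDiffAt.contMDiffWithinAt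
        fun p hp => hp
  obtain ⟨u, hu, hue⟩ := continuousOn_iff'.1 hqs.continuousOn U K.isOpen_U
  have hκ0 : κi 0 = x₀ := by rw [← K.apply_center, K.left_inv _ K.mem]
  have h0W : (0 : E) ∈ W := K.apply_center ▸ K.maps _ K.mem
  have hqU : ∀ p ∈ u, p ∈ S → q p ∈ U := fun p hp hpS =>
    ((Set.ext_iff.1 hue p).2 ⟨hp, hpS⟩).1
  refine ⟨u ∩ Prod.snd ⁻¹' W, hu.inter (K.isOpen_W.preimage continuous_snd), ⟨?_, h0W⟩, ?_, ?_, ?_⟩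
  · refine ((Set.ext_iff.1 hue (0, 0)).1 ⟨?_, h0W, by simp⟩).1
    simpa [hq, C.one, hκ0] using K.mem
  · exact fun p hp => ⟨hp.2, fun h => hqU p hp.1 ⟨hp.2, h⟩⟩
  · rw [← contMDiffOn_iff_contDiffOn]
    exact K.smooth.comp (hqs.mono fun p hp => ⟨hp.1.2, hp.2⟩)
      fun p hp => hqU p hp.1.1 ⟨hp.1.2, hp.2⟩
  · intro p hp hp0
    have h1 := K.maps_inv _ hp.2 hp0
    rw [chartFlow, ← K.f_eq _ (hqU p hp.1 ⟨hp.2, hp0⟩), C.f_inv _ _ (K.subset h1), K.f_eq _ h1,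
      K.right_inv _ hp.2 hp0]

omit [IsManifold I ∞ M] in
/-- The generator of a free action does not vanish. -/
theorem CutDatum.generator_ne_zero (C : CutDatum I σ f D) (K : AdaptedChart I f D x₀ ℓ κ κi U W)
    {ξ : E} (hξ : HasDerivAt (fun t : ℝ => chartFlow σ κ κi (t, 0)) ξ 0) : ξ ≠ 0 := by
  obtain ⟨O, hO, h0O, hOU, hP, hℓP⟩ := C.exists_chartFlow K
  rintro rfl
  set γ : ℝ → E := fun t => chartFlow σ κ κi (t, 0) with hγ
  have hκ0 : κi 0 = x₀ := by rw [← K.apply_center, K.left_inv _ K.mem]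
  have hγ' : ∀ t, γ t = κ (σ (Circle.exp t) x₀) := fun t => by simp [hγ, chartFlow, hκ0]
  have hγ0 : γ 0 = 0 := by simp [hγ', C.one, K.apply_center]
  have hcurve : ContinuousAt (fun t : ℝ => ((t, 0) : ℝ × E)) 0 := by fun_prop
  have hev : ∀ᶠ t : ℝ in 𝓝 0, ((t, 0) : ℝ × E) ∈ O := hcurve.eventually (hO.eventually_mem h0O)
  obtain ⟨δ, hδ, hδO⟩ := Metric.eventually_nhds_iff_ball.1 hev
  have hUmem : ∀ t, ((t, 0) : ℝ × E) ∈ O → σ (Circle.exp t) x₀ ∈ U := fun t ht => by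
    have := (hOU _ ht).2 (by simp)
    rwa [hκ0] at this
  -- By the group law `γ (t + h)` is the flow for time `t` applied to `γ h`, so a vanishing velocity
  -- at time `0` vanishes at all nearby times. Then the orbit is locally constant, against freeness.
  have hder : ∀ t ∈ Metric.ball (0 : ℝ) δ, HasDerivAt γ 0 t := by
    intro t ht
    have htO := hδO t ht
    have h1 : HasFDerivWithinAt (chartFlow σ κ κi)
        (fderivWithin ℝ (chartFlow σ κ κi) (O ∩ {p | 0 ≤ ℓ p.2}) (t, γ 0))
        (O ∩ {p | 0 ≤ ℓ p.2}) (t, γ 0) := by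
      rw [hγ0]
      exact (hP.differentiableOn (by simp) _ ⟨htO, by simp⟩).hasFDerivWithinAt
    have h2 : HasDerivAt (fun h => (t, γ h)) ((0 : ℝ), (0 : E)) 0 :=
      (hasDerivAt_const (0 : ℝ) t).prodMk hξ
    have h3 : ∀ᶠ h in 𝓝 (0 : ℝ), (t, γ h) ∈ O ∩ {p | 0 ≤ ℓ p.2} := by
      have h4 : Filter.Tendsto (fun h => (t, γ h)) (𝓝 (0 : ℝ)) (𝓝 (t, 0)) := by
        have := h2.continuousAt.tendsto
        rwa [hγ0] at this
      filter_upwards [h4.eventually (hO.eventually_mem htO), hev] with h hh1 hh2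
      refine ⟨hh1, ?_⟩
      have := hℓP _ hh2 (by simp)
      simp only [map_zero] at this
      exact this.ge
    have h5 := h1.comp_hasDerivAt (0 : ℝ) h2 h3
    have h6 : HasDerivAt (fun h => γ (t + h)) 0 0 := by
      refine (h5.congr_deriv (by
        rw [show ((0 : ℝ), (0 : E)) = 0 from rfl, map_zero])).congr_of_eventuallyEq ?_
      filter_upwards [hev] with h hh
      simp only [Function.comp_apply, chartFlow, hγ']
      rw [K.left_inv _ (hUmem h hh), ← C.mul, ← Circle.exp_add]
    have h7 := HasDerivAt.comp_sub_const (f := fun h => γ (t + h)) (f' := 0) t t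
      (by simpa using h6)
    simpa using h7
  have hconst : ∀ t ∈ Metric.ball (0 : ℝ) δ, γ t = γ 0 := fun t ht =>
    Metric.isOpen_ball.is_const_of_deriv_eq_zero (convex_ball (0 : ℝ) δ).isPreconnected
      (fun t ht => (hder t ht).differentiableAt.differentiableWithinAt)
      (fun t ht => (hder t ht).deriv) ht (Metric.mem_ball_self hδ)
  -- This time is positive and smaller than `π`, so `arg` recovers it from its exponential, which
  -- therefore is not `1`.
  have hm : min (δ / 2) 1 ∈ Metric.ball (0 : ℝ) δ := by
    have : 0 < min (δ / 2) 1 := by positivity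
    rw [Metric.mem_ball, dist_zero_right, Real.norm_of_nonneg this.le]
    exact (min_le_left _ _).trans_lt (by linarith)
  have h8 : γ (min (δ / 2) 1) = 0 := by
    rw [← hγ0]
    exact hconst _ hm
  have h9 : σ (Circle.exp (min (δ / 2) 1)) x₀ = x₀ := by
    rw [← K.left_inv _ (hUmem _ (hδO _ hm)), ← hγ', h8, hκ0]
  have h10 := C.free _ _ (K.subset K.mem) h9
  have h11 := Circle.arg_exp (x := min (δ / 2) 1)
    (by have : 0 < min (δ / 2) 1 := by positivity
        linarith [Real.pi_pos])
    ((min_le_right _ _).trans (by linarith [Real.pi_gt_three]))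
  rw [h10] at h11
  have : 0 < min (δ / 2) 1 := by positivity
  simp only [Circle.coe_one, Complex.arg_one] at h11
  linarith

/-- A linear slice `s` transverse to the orbit is moved by the action: `(τ, t, y) ↦ exp(τ) · s(t,
y)`. In the adapted chart its differential at the origin is the splitting along the generator, the
transversal `e` and `F`, hence invertible, and it preserves the boundary coordinate. -/
theorem CutDatum.exists_local_product (hI : IsHalfSpaceModel I) (C : CutDatum I σ f D)
    (hx₀ : x₀ ∈ I.boundary M) :
    ∃ (F : Submodule ℝ E) (_ : (ℝ × (ℝ × F)) ≃L[ℝ] E) (s : ℝ × F → M) (ρ : M → ℝ × (ℝ × F))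
      (U : Set M) (O : Set (ℝ × (ℝ × F))),
      IsOpen U ∧ IsOpen O ∧ x₀ ∈ U ∧ 0 ∈ O ∧ U ⊆ D ∧ s 0 = x₀ ∧
      ContMDiffOn I 𝓘(ℝ, ℝ × (ℝ × F)) ∞ ρ U ∧
      ContMDiffOn 𝓘(ℝ, ℝ × F) I ∞ s {q | (0, q) ∈ O ∧ 0 ≤ q.1} ∧
      (∀ x ∈ U, ρ x ∈ O ∧ 0 ≤ (ρ x).2.1 ∧ σ (Circle.exp (ρ x).1) (s (ρ x).2) = x ∧
        f x = (ρ x).2.1) ∧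
      ∀ p ∈ O, 0 ≤ p.2.1 → σ (Circle.exp p.1) (s p.2) ∈ U ∧ ρ (σ (Circle.exp p.1) (s p.2)) = p := by
  obtain ⟨ℓ, κ, κi, U, W, K⟩ := C.exists_adaptedChart hI hx₀
  obtain ⟨O, hO, h0O, hOU, hP, hℓP⟩ := C.exists_chartFlow K
  obtain ⟨hfin, -⟩ := hI
  set P := chartFlow σ κ κi with hPdef
  set S := O ∩ {p | 0 ≤ ℓ p.2} with hS
  have h0S : ((0 : ℝ), (0 : E)) ∈ S := ⟨h0O, by simp⟩
  have hDP := (hP.differentiableOn (by simp) _ h0S).hasFDerivWithinAt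
  set DP := fderivWithin ℝ P S (0, 0) with hDPdef
  set ξ := DP (1, 0) with hξdef
  have hcurve : HasDerivAt (fun t : ℝ => ((t, 0) : ℝ × E)) (1, 0) 0 :=
    (hasDerivAt_id (0 : ℝ)).prodMk (hasDerivAt_const (0 : ℝ) (0 : E))
  have hev : ∀ᶠ t : ℝ in 𝓝 0, ((t, 0) : ℝ × E) ∈ S := by
    filter_upwards [hcurve.continuousAt.eventually (hO.eventually_mem h0O)] with t ht
    exact ⟨ht, by simp⟩
  have hξ : HasDerivAt (fun t : ℝ => P (t, 0)) ξ 0 :=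
    HasFDerivWithinAt.comp_hasDerivAt (l := P) (l' := DP) (f := fun t : ℝ => ((t, 0) : ℝ × E))
      (0 : ℝ) hDP hcurve hev
  have hξ0 : ξ ≠ 0 := C.generator_ne_zero K hξ
  have hℓξ : ℓ ξ = 0 := by
    have h1 : HasDerivAt (fun t : ℝ => ℓ (P (t, 0))) (ℓ ξ) 0 := ℓ.hasFDerivAt.comp_hasDerivAt 0 hξ
    refine h1.unique ((hasDerivAt_const (0 : ℝ) (0 : ℝ)).congr_of_eventuallyEq ?_)
    filter_upwards [hev] with t ht
    rw [hℓP _ ht.1 ht.2]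
    simp
  obtain ⟨F, L, e, hL, he, hF⟩ := exists_splitting K.ne_zero hξ0 hℓξ
  let j : ℝ × F →L[ℝ] E := (ContinuousLinearMap.fst ℝ ℝ F).smulRight e +
    F.subtypeL.comp (ContinuousLinearMap.snd ℝ ℝ F)
  have hj : ∀ q, j q = q.1 • e + (q.2 : E) := fun q => by simp [j]
  have hℓj : ∀ q, ℓ (j q) = q.1 := fun q => by simp [hj, he, hF]
  let J : ℝ × (ℝ × F) →L[ℝ] ℝ × E := (ContinuousLinearMap.id ℝ ℝ).prodMap j
  have hJ : ∀ p, J p = (p.1, j p.2) := fun p => rfl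
  set ℓ₁ : ℝ × (ℝ × F) →L[ℝ] ℝ :=
    (ContinuousLinearMap.fst ℝ ℝ F).comp (ContinuousLinearMap.snd ℝ ℝ (ℝ × F)) with hℓ₁
  have hℓ₁a : ∀ p, ℓ₁ p = p.2.1 := fun p => rfl
  have hℓ₁0 : ℓ₁ ≠ 0 := fun h => by
    have := DFunLike.congr_fun h ((0 : ℝ), ((1 : ℝ), (0 : F)))
    simp [hℓ₁a] at this
  set O₁ := J ⁻¹' O with hO₁
  have hO₁o : IsOpen O₁ := hO.preimage J.continuous
  have hmaps : MapsTo J (O₁ ∩ {p | 0 ≤ ℓ₁ p}) S := fun p hp => by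
    refine ⟨hp.1, ?_⟩
    have h1 : 0 ≤ ℓ₁ p := hp.2
    rw [hℓ₁a] at h1
    simpa [hJ, hℓj] using h1
  have h0O₁ : (0 : ℝ × (ℝ × F)) ∈ O₁ := by
    simp only [hO₁, mem_preimage, map_zero]
    exact h0O
  have hG : ContDiffOn ℝ ∞ (P ∘ J) (O₁ ∩ {p | 0 ≤ ℓ₁ p}) := hP.comp J.contDiff.contDiffOn hmaps
  have hℓG : ∀ p ∈ O₁, 0 ≤ ℓ₁ p → ℓ (P (J p)) = ℓ₁ p := fun p hp hp0 => by
    have := hmaps ⟨hp, hp0⟩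
    rw [hℓP _ this.1 this.2, hJ, hℓj, hℓ₁a]
  have hP0 : ∀ v, (0, v) ∈ S → P (0, v) = v := by
    intro v hv
    rw [hPdef, chartFlow]
    simp only [Circle.exp_zero, C.one]
    exact K.right_inv _ (hOU _ hv.1).1 hv.2
  -- The flow at time `0` is the identity, but only on the half-space, so the derivative is computed
  -- along the ray `t ↦ t v` with `t ≥ 0`. The vectors `e` and those of `F` satisfy the sign
  -- condition and suffice.
  have hDPv : ∀ v, 0 ≤ ℓ v → DP (0, v) = v := by
    intro v hv
    have hline : HasDerivWithinAt (fun t : ℝ => ((0 : ℝ), t • v)) (0, v) (Ici 0) 0 := by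
      have : HasDerivAt (fun t : ℝ => t • v) v 0 := by
        simpa using (hasDerivAt_id (0 : ℝ)).smul_const v
      exact ((hasDerivAt_const (0 : ℝ) (0 : ℝ)).prodMk this).hasDerivWithinAt
    have hev' : ∀ᶠ t : ℝ in 𝓝[Ici 0] 0, ((0 : ℝ), t • v) ∈ S := by
      have h1 : Filter.Tendsto (fun t : ℝ => ((0 : ℝ), t • v)) (𝓝[Ici 0] 0) (𝓝 (0, 0)) := by
        have h := hline.continuousWithinAt.tendsto
        rwa [zero_smul] at h
      filter_upwards [h1.eventually (hO.eventually_mem h0O), self_mem_nhdsWithin] with t ht ht0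
      refine ⟨ht, ?_⟩
      have : 0 ≤ t := ht0
      simp only [mem_ofPred_eq, map_smul, smul_eq_mul]
      positivity
    have h2 : HasDerivWithinAt (fun t : ℝ => P ((0 : ℝ), t • v)) (DP (0, v)) (Ici 0) 0 := by
      have h3 := HasFDerivWithinAt.comp_hasDerivWithinAt_of_eq (0 : ℝ)
        (t := S) hDP (hline.mono (inter_subset_left (t := {t : ℝ | ((0 : ℝ), t • v) ∈ S})))
        (fun t ht => ht.2) (by simp)
      exact h3.mono_of_mem_nhdsWithin (Filter.inter_mem self_mem_nhdsWithin hev')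
    have h4 : HasDerivWithinAt (fun t : ℝ => P ((0 : ℝ), t • v)) v (Ici 0) 0 := by
      have h5 : HasDerivWithinAt (fun t : ℝ => t • v) v (Ici 0) 0 := by
        simpa using ((hasDerivAt_id (0 : ℝ)).smul_const v).hasDerivWithinAt
      refine h5.congr_of_eventuallyEq ?_ (hP0 _ (by simpa using h0S))
      filter_upwards [hev'] with t ht
      exact hP0 _ ht
    exact (uniqueDiffOn_Ici (0 : ℝ) 0 self_mem_Ici).eq_deriv _ h2 h4
  have hDL : ∀ p, DP (J p) = L p := by
    intro p
    have h1 : J p = p.1 • ((1 : ℝ), (0 : E)) + (p.2.1 • ((0 : ℝ), e) + ((0 : ℝ), (p.2.2 : E))) := by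
      simp [hJ, hj]
    rw [h1, map_add, map_add, map_smul, map_smul, hDPv e (by simp [he]), hDPv _ (hF p.2.2).ge, hL]
  have hLd : HasFDerivWithinAt (P ∘ J) (L : ℝ × (ℝ × F) →L[ℝ] E) (O₁ ∩ {p | 0 ≤ ℓ₁ p}) 0 := by
    have h1 : HasFDerivWithinAt P DP S (J 0) := by
      rw [map_zero]
      exact hDP
    refine (h1.comp 0 J.hasFDerivWithinAt hmaps).congr_fderiv ?_
    ext p <;> simp [← hDL]
  obtain ⟨R, W', O', hW'o, hO'o, h0O', hO'O, hGW', hR, hO'W, hWO'⟩ :=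
    exists_smooth_inverse_halfSpace hℓ₁0 K.ne_zero hO₁o h0O₁ (by simp) hG
      (fun p hp hp0 => by rw [Function.comp_apply, hℓG p hp hp0]; exact ⟨hp0, Iff.rfl⟩) L hLd
  have hκ0 : κi 0 = x₀ := by rw [← K.apply_center, K.left_inv _ K.mem]
  have hΓ : ∀ p ∈ O', 0 ≤ p.2.1 → σ (Circle.exp p.1) (κi (j p.2)) ∈ U := fun p hp hp0 =>
    (hOU _ (hO'O hp)).2 (by simpa [hJ, hℓj] using hp0)
  have hPΓ : ∀ p, (P ∘ J) p = κ (σ (Circle.exp p.1) (κi (j p.2))) := fun p => rfl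
  have hnn : ∀ x ∈ U, 0 ≤ ℓ (κ x) := fun x hx => K.f_eq x hx ▸ C.f_nonneg x
  have h0W' : (0 : E) ∈ W' := by
    have h1 : (P ∘ J) 0 = 0 := by
      simp only [Function.comp_apply, map_zero]
      exact hP0 0 h0S
    rwa [h1] at hGW'
  refine ⟨F, L, κi ∘ j, R ∘ κ, U ∩ κ ⁻¹' W', O',
    K.smooth.continuousOn.isOpen_inter_preimage K.isOpen_U hW'o, hO'o, ⟨K.mem, ?_⟩, h0O',
    inter_subset_left.trans K.subset, by simp [hκ0], ?_, ?_, ?_, ?_⟩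
  · rw [mem_preimage, K.apply_center]
    exact h0W'
  · exact (contMDiffOn_iff_contDiffOn.2 hR).comp (K.smooth.mono inter_subset_left)
      fun x hx => ⟨hx.2, hnn x hx.1⟩
  · refine K.smooth_inv.comp j.contDiff.contMDiff.contMDiffOn fun q hq => ?_
    refine ⟨(hOU _ (hO'O hq.1)).1, ?_⟩
    simpa [hℓj] using hq.2
  · rintro x ⟨hxU, hxW⟩
    obtain ⟨h1, h2, h3⟩ := hWO' _ hxW (hnn x hxU)
    rw [hPΓ] at h3
    have h4 := hΓ _ h1 h2
    have h5 : σ (Circle.exp (R (κ x)).1) (κi (j (R (κ x)).2)) = x := by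
      rw [← K.left_inv _ h4, h3, K.left_inv _ hxU]
    refine ⟨h1, h2, h5, ?_⟩
    have h6 := hℓG _ (hO'O h1) h2
    rw [← hℓ₁a, Function.comp_apply, ← h6, K.f_eq x hxU]
    exact congrArg ℓ h3.symm
  · intro p hp hp0
    have h1 := hO'W p hp hp0
    rw [hPΓ] at h1
    exact ⟨⟨hΓ p hp hp0, h1.1⟩, h1.2⟩

end LocalProduct

/-! ### Tubes around boundary orbits -/

section Tube

variable {E H : Type*} [NormedAddCommGroup E] [NormedSpace ℝ E] [TopologicalSpace H]
  {I : ModelWithCorners ℝ E H} {M : Type*} [TopologicalSpace M] [ChartedSpace H M]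
  {σ : Circle → M → M} {f : M → ℝ} {D : Set M}

/-- Equivariant coordinates `(θ, f, y)` on an invariant neighbourhood of the orbit of `x₀`, with
an angle function `τ` such that `(τ, f, y)` has invertible differential at `x₀`. -/
structure Tube (I : ModelWithCorners ℝ E H) (σ : Circle → M → M) (f : M → ℝ) (D : Set M)
    (x₀ : M) where
  F : Submodule ℝ E
  L : (ℂ × F) ≃L[ℝ] E
  ε : ℝ
  U : Set M
  θ : M → Circle
  y : M → F
  s : ℝ × F → M
  τ : M → ℝ
  T : E ≃L[ℝ] ℝ × (ℝ × F)
  ε_pos : 0 < ε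
  isOpen_U : IsOpen U
  U_subset : U ⊆ D
  s_zero : s 0 = x₀
  θ_smooth : ContMDiffOn I (𝓡 1) ∞ θ U
  y_smooth : ContMDiffOn I 𝓘(ℝ, F) ∞ y U
  s_smooth : ContMDiffOn 𝓘(ℝ, ℝ × F) I ∞ s (halfBox F ε)
  s_mem : ∀ q ∈ halfBox F ε, s q ∈ U
  θ_s : ∀ q ∈ halfBox F ε, θ (s q) = 1
  f_s : ∀ q ∈ halfBox F ε, f (s q) = q.1
  y_s : ∀ q ∈ halfBox F ε, y (s q) = q.2
  mem_box : ∀ x ∈ U, (f x, y x) ∈ halfBox F ε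
  smul_s : ∀ x ∈ U, σ (θ x) (s (f x, y x)) = x
  U_inv : ∀ a, ∀ x ∈ U, σ a x ∈ U
  θ_smul : ∀ a, ∀ x ∈ U, θ (σ a x) = a * θ x
  y_smul : ∀ a, ∀ x ∈ U, y (σ a x) = y x
  hasMFDerivAt : HasMFDerivAt I 𝓘(ℝ, ℝ × (ℝ × F)) (fun x => (τ x, (f x, y x))) x₀
    (T : E →L[ℝ] ℝ × (ℝ × F))

theorem isOpen_prod_lt {F : Type*} [NormedAddCommGroup F] (ε : ℝ) :
    IsOpen {q : ℝ × F | q.1 < ε ∧ ‖q.2‖ < ε} :=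
  IsOpen.and (isOpen_lt continuous_fst continuous_const)
    (isOpen_lt (by fun_prop : Continuous fun q : ℝ × F => ‖q.2‖) continuous_const)

theorem zero_mem_halfBox {F : Type*} [NormedAddCommGroup F] {ε : ℝ} (hε : 0 < ε) :
    (0 : ℝ × F) ∈ halfBox F ε := mem_halfBox.2 (by simp [hε])

variable [T2Space M] {x₀ : M}

/-- A free action moves small slices off themselves. -/
theorem CutDatum.exists_slice (C : CutDatum I σ f D) (hx₀ : x₀ ∈ D) {F : Type*}
    [NormedAddCommGroup F] [NormedSpace ℝ F] {s : ℝ × F → M} {ρ : M → ℝ × (ℝ × F)}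
    {O : Set (ℝ × (ℝ × F))} (hO : IsOpen O) (h0O : 0 ∈ O) (hs0 : s 0 = x₀)
    (hs : ContinuousOn s {q | (0, q) ∈ O ∧ 0 ≤ q.1})
    (hρ : ∀ p ∈ O, 0 ≤ p.2.1 → ρ (σ (Circle.exp p.1) (s p.2)) = p) :
    ∃ ε > 0, (∀ q ∈ halfBox F ε, (0, q) ∈ O) ∧
      ∀ q ∈ halfBox F ε, ∀ q' ∈ halfBox F ε, ∀ a, σ a (s q) = s q' → a = 1 ∧ q = q' := by
  obtain ⟨δ, hδ, hδO⟩ := Metric.isOpen_iff.1 hO 0 h0O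
  have hδO' : ∀ (t : ℝ) (q : ℝ × F), |t| < δ → ‖q‖ < δ → (t, q) ∈ O := fun t q ht hq =>
    hδO (by rw [mem_ball_zero_iff, Prod.norm_def, max_lt_iff]; exact ⟨ht, hq⟩)
  -- Truncating the first coordinate makes the slice continuous on a full neighbourhood of the
  -- origin.
  set sb : ℝ × F → M := fun q => s (max q.1 0, q.2) with hsb
  have hmax : Continuous fun q : ℝ × F => ((max q.1 0, q.2) : ℝ × F) := by fun_prop
  have hsbe : ∀ q : ℝ × F, 0 ≤ q.1 → sb q = s q := fun q hq => by
    simp only [hsb, max_eq_left hq]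
  have hsbc : ContinuousAt sb 0 := by
    have h1 : ContinuousOn sb {q : ℝ × F | ((0 : ℝ), ((max q.1 0, q.2) : ℝ × F)) ∈ O} :=
      hs.comp hmax.continuousOn fun q hq => ⟨hq, le_max_right _ _⟩
    have hopen : IsOpen {q : ℝ × F | ((0 : ℝ), ((max q.1 0, q.2) : ℝ × F)) ∈ O} :=
      hO.preimage (continuous_const.prodMk hmax)
    refine h1.continuousAt (hopen.mem_nhds ?_)
    have h0 : ((0 : ℝ), ((max (0 : ℝ × F).1 0, (0 : ℝ × F).2) : ℝ × F)) = 0 := by simp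
    rw [mem_ofPred_eq, h0]
    exact h0O
  have hsb0 : sb 0 = x₀ := by rw [hsbe 0 le_rfl, hs0]
  set N : Set Circle := {a | |Complex.arg a| < δ} with hN
  have hNn : N ∈ 𝓝 (1 : Circle) := by
    have h1 : ContinuousAt (fun a : Circle => |Complex.arg a|) 1 := by
      refine ContinuousAt.abs ?_
      refine ContinuousAt.comp (g := Complex.arg) ?_ continuous_subtype_val.continuousAt
      exact Complex.continuousAt_arg (by simp)
    exact h1.eventually (gt_mem_nhds (by simpa using hδ))
  have hKc : IsCompact (interior N)ᶜ := (_root_.isOpen_interior (s := N)).isClosed_compl.isCompact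
  -- Circle elements away from `1` form a compact set and move `x₀`, hence move small slice points
  -- off the slice uniformly. Elements near `1` have small argument and are handled by injectivity
  -- of the local product.
  have hfar : ∀ᶠ z in 𝓝 (0 : (ℝ × F) × (ℝ × F)), ∀ a ∈ (interior N)ᶜ, σ a (sb z.1) ≠ sb z.2 := by
    refine hKc.eventually_forall_of_forall_eventually fun a ha => ?_
    have hne : σ a x₀ ≠ x₀ := fun h => ha (by
      rw [C.free a x₀ hx₀ h]
      exact mem_interior_iff_mem_nhds.2 hNn)
    have hc1 : ContinuousAt (fun z : ((ℝ × F) × (ℝ × F)) × Circle => σ z.2 (sb z.1.1)) (0, a) := by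
      have h1 : ContinuousAt (fun p : Circle × M => σ p.1 p.2) (a, sb 0) :=
        C.continuousOn.continuousAt ((isOpen_univ.prod C.isOpen).mem_nhds
          ⟨mem_univ _, hsb0.symm ▸ hx₀⟩)
      have h2 : ContinuousAt (fun z : ((ℝ × F) × (ℝ × F)) × Circle => (z.2, sb z.1.1)) (0, a) :=
        continuousAt_snd.prodMk (ContinuousAt.comp (g := sb)
          (f := fun z : ((ℝ × F) × (ℝ × F)) × Circle => z.1.1) hsbc (by fun_prop))
      exact ContinuousAt.comp (g := fun p : Circle × M => σ p.1 p.2)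
        (f := fun z : ((ℝ × F) × (ℝ × F)) × Circle => (z.2, sb z.1.1)) h1 h2
    have hc2 : ContinuousAt (fun z : ((ℝ × F) × (ℝ × F)) × Circle => sb z.1.2) (0, a) :=
      ContinuousAt.comp (g := sb) (f := fun z : ((ℝ × F) × (ℝ × F)) × Circle => z.1.2)
        hsbc (by fun_prop)
    have := hc1.ne_iff_eventually_ne hc2
    refine this.1 ?_
    simpa [hsb0] using hne
  obtain ⟨r, hr, hrz⟩ := Metric.eventually_nhds_iff_ball.1 hfar
  have hnorm : ∀ q : ℝ × F, q ∈ halfBox F (min δ r) → ‖q‖ < δ ∧ ‖q‖ < r := by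
    intro q hq
    obtain ⟨⟨h1, h2⟩, h3⟩ := mem_halfBox.1 hq
    rw [Prod.norm_def, max_lt_iff, max_lt_iff, Real.norm_of_nonneg h1]
    rw [lt_min_iff] at h2 h3
    exact ⟨⟨h2.1, h3.1⟩, ⟨h2.2, h3.2⟩⟩
  refine ⟨min δ r, lt_min hδ hr, fun q hq => hδO' 0 q (by simpa using hδ) (hnorm q hq).1, ?_⟩
  intro q hq q' hq' a ha
  have hq0 := (mem_halfBox.1 hq).1.1
  have hq'0 := (mem_halfBox.1 hq').1.1
  have haN : a ∈ N := by
    by_contra hcon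
    refine hrz (q, q') ?_ a (fun h => hcon (interior_subset h)) ?_
    · rw [mem_ball_zero_iff, Prod.norm_def, max_lt_iff]
      exact ⟨(hnorm q hq).2, (hnorm q' hq').2⟩
    · simp only [hsbe q hq0, hsbe q' hq'0, ha]
  have h1 := hρ (Complex.arg a, q) (hδO' _ _ haN (hnorm q hq).1) hq0
  have h2 := hρ (0, q') (hδO' _ _ (by simpa using hδ) (hnorm q' hq').1) hq'0
  simp only [Circle.exp_arg, ha] at h1
  simp only [Circle.exp_zero, C.one] at h2
  rw [h1] at h2
  obtain ⟨h3, h4⟩ := Prod.ext_iff.1 h2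
  refine ⟨?_, h4⟩
  rw [← Circle.exp_arg a]
  simp only at h3
  rw [h3, Circle.exp_zero]

/-- The tube is the saturation of a small slice. By `CutDatum.exists_slice` a point of it is `a ·
s(p)` for unique `a` and `p`, which become its coordinates; equivariance is then automatic, and
smoothness is read off from the local product after translation. -/
theorem CutDatum.nonempty_tube [IsManifold I ∞ M] (hI : IsHalfSpaceModel I)
    (C : CutDatum I σ f D) (hx₀ : x₀ ∈ I.boundary M) : Nonempty (Tube I σ f D x₀) := by
  classical
  obtain ⟨F, L, s, ρ, U, O, hU, hO, hx₀U, h0O, hUD, hs0, hρs, hss, hUp, hOp⟩ :=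
    C.exists_local_product hI hx₀
  obtain ⟨hfin, -⟩ := hI
  have hx₀D : x₀ ∈ D := hUD hx₀U
  obtain ⟨ε, hε, hεO, hinj⟩ := C.exists_slice hx₀D hO h0O hs0 hss.continuousOn
    fun p hp hp0 => (hOp p hp hp0).2
  have hbox0 : ∀ q ∈ halfBox F ε, (0 : ℝ) ≤ q.1 := fun q hq => (mem_halfBox.1 hq).1.1
  have hsU : ∀ q ∈ halfBox F ε, s q ∈ U ∧ ρ (s q) = (0, q) := by
    intro q hq
    have := hOp (0, q) (hεO q hq) (hbox0 q hq)
    simpa only [Circle.exp_zero, C.one] using this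
  have hfs : ∀ q ∈ halfBox F ε, f (s q) = q.1 := fun q hq => by
    rw [(hUp _ (hsU q hq).1).2.2.2, (hsU q hq).2]
  set UU : Set M := {x | ∃ a q, q ∈ halfBox F ε ∧ σ a (s q) = x} with hUU
  choose! θ q hq hθq using fun (x : M) (hx : x ∈ UU) => hx
  have huniq : ∀ a, ∀ p ∈ halfBox F ε, ∀ a', ∀ p' ∈ halfBox F ε, σ a (s p) = σ a' (s p') →
      a = a' ∧ p = p' := by
    intro a p hp a' p' hp' h
    have h1 : σ (a'⁻¹ * a) (s p) = s p' := by rw [C.mul, h, C.inv_smul]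
    obtain ⟨h2, h3⟩ := hinj p hp p' hp' _ h1
    exact ⟨(inv_mul_eq_one.1 h2).symm, h3⟩
  have hmem : ∀ a, ∀ p ∈ halfBox F ε, σ a (s p) ∈ UU := fun a p hp => ⟨a, p, hp, rfl⟩
  have hθeq : ∀ a, ∀ p ∈ halfBox F ε, θ (σ a (s p)) = a ∧ q (σ a (s p)) = p := fun a p hp =>
    huniq _ _ (hq _ (hmem a p hp)) _ _ hp (hθq _ (hmem a p hp))
  have hUUD : UU ⊆ D := by
    rintro _ ⟨a, p, hp, rfl⟩
    exact C.maps a _ (hUD (hsU p hp).1)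
  have hfq : ∀ x ∈ UU, f x = (q x).1 := by
    rintro _ ⟨a, p, hp, rfl⟩
    rw [(hθeq a p hp).2, C.f_inv _ _ (hUD (hsU p hp).1), hfs p hp]
  have hUsub : ∀ x ∈ U, (ρ x).2 ∈ halfBox F ε →
      x ∈ UU ∧ θ x = Circle.exp (ρ x).1 ∧ q x = (ρ x).2 := by
    intro x hx hb
    have h1 := (hUp x hx).2.2.1
    have h2 := hθeq (Circle.exp (ρ x).1) _ hb
    have h3 := hmem (Circle.exp (ρ x).1) _ hb
    rw [h1] at h2 h3
    exact ⟨h3, h2⟩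
  -- Translating by `a⁻¹` brings a neighbourhood of `x` to the slice, where `ρ` computes the
  -- coordinates. This gives openness of `UU` and smoothness of `θ` and `y` along the whole orbit.
  have hlocal : ∀ x ∈ UU, ∃ a, σ a⁻¹ x ∈ U ∧ x ∈ D ∧
      ∀ᶠ z in 𝓝 x, σ a⁻¹ z ∈ U ∧ z ∈ UU ∧ θ z = a * Circle.exp (ρ (σ a⁻¹ z)).1 ∧
        q z = (ρ (σ a⁻¹ z)).2 := by
    rintro _ ⟨a, p, hp, rfl⟩
    have hpD := hUD (hsU p hp).1
    have hxD := C.maps a _ hpD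
    have hc : ContinuousAt (σ a⁻¹) (σ a (s p)) :=
      (C.contMDiffOn_smul a⁻¹).continuousOn.continuousAt (C.isOpen.mem_nhds hxD)
    have he := C.inv_smul a (s p)
    have hm : σ a⁻¹ (σ a (s p)) ∈ U := by rw [he]; exact (hsU p hp).1
    refine ⟨a, hm, hxD, ?_⟩
    have hρc : ContinuousAt ρ (σ a⁻¹ (σ a (s p))) :=
      hρs.continuousOn.continuousAt (hU.mem_nhds hm)
    have h2 : ∀ᶠ w in 𝓝 (σ a⁻¹ (σ a (s p))), (ρ w).2 ∈ {q : ℝ × F | q.1 < ε ∧ ‖q.2‖ < ε} := by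
      have h3 : ContinuousAt (fun w => (ρ w).2) (σ a⁻¹ (σ a (s p))) :=
        continuousAt_snd.comp hρc
      refine h3.eventually ((isOpen_prod_lt ε).eventually_mem ?_)
      simp only [he, (hsU p hp).2]
      exact ⟨(mem_halfBox.1 hp).1.2, (mem_halfBox.1 hp).2⟩
    filter_upwards [hc.eventually (hU.eventually_mem hm), hc.eventually h2] with z hz1 hz2
    have hb : (ρ (σ a⁻¹ z)).2 ∈ halfBox F ε :=
      mem_halfBox.2 ⟨⟨(hUp _ hz1).2.1, hz2.1⟩, hz2.2⟩
    obtain ⟨h4, h5, h6⟩ := hUsub _ hz1 hb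
    have h7 : z = σ (a * Circle.exp (ρ (σ a⁻¹ z)).1) (s (ρ (σ a⁻¹ z)).2) := by
      rw [C.mul, (hUp _ hz1).2.2.1, C.smul_inv]
    have h8 := hθeq (a * Circle.exp (ρ (σ a⁻¹ z)).1) _ hb
    have h9 := hmem (a * Circle.exp (ρ (σ a⁻¹ z)).1) _ hb
    rw [← h7] at h8 h9
    exact ⟨hz1, h9, h8⟩
  have hρσ : ∀ x ∈ UU, ∀ a, σ a⁻¹ x ∈ U →
      ContMDiffAt I 𝓘(ℝ, ℝ × (ℝ × F)) ∞ (fun z => ρ (σ a⁻¹ z)) x := fun x hx a ha =>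
    (hρs.contMDiffAt (hU.mem_nhds ha)).comp x
      ((C.contMDiffOn_smul a⁻¹).contMDiffAt (C.isOpen.mem_nhds (hUUD hx)))
  have hs0' : s 0 ∈ UU := by simpa [C.one] using hmem 1 0 (zero_mem_halfBox hε)
  -- the differential of the coordinates at the centre
  have hρx₀ : ρ x₀ = 0 := by rw [← hs0, (hsU 0 (zero_mem_halfBox hε)).2]; rfl
  have hρd : MDifferentiableAt I 𝓘(ℝ, ℝ × (ℝ × F)) ρ x₀ :=
    (hρs.contMDiffAt (hU.mem_nhds hx₀U)).mdifferentiableAt (by simp)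
  -- `Γ`, differentiable within a half-space region, is a left inverse of `ρ`. The chain rule gives
  -- injectivity, and equality of dimensions then gives an isomorphism.
  have hTinj : Function.Injective (mfderiv I 𝓘(ℝ, ℝ × (ℝ × F)) ρ x₀) := by
    set Γ : ℝ × (ℝ × F) → M := fun p => σ (Circle.exp p.1) (s p.2) with hΓ
    set S : Set (ℝ × (ℝ × F)) := {p | p.2 ∈ halfBox F ε} with hS
    have hΓs : ContMDiffWithinAt 𝓘(ℝ, ℝ × (ℝ × F)) I ∞ Γ S (ρ x₀) := by
      have h0S : ρ x₀ ∈ S := by rw [hρx₀]; exact zero_mem_halfBox hε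
      refine C.smul_contMDiffWithinAt ?_ ?_ (hUD (hsU _ h0S).1)
      · exact (contMDiff_circleExp.comp contDiff_fst.contMDiff).contMDiffAt.contMDiffWithinAt
      · exact (hss _ ⟨hεO _ h0S, hbox0 _ h0S⟩).comp (ρ x₀)
          contDiff_snd.contMDiff.contMDiffAt.contMDiffWithinAt
          fun p hp => ⟨hεO _ hp, hbox0 _ hp⟩
    have hev : ∀ᶠ x in 𝓝 x₀, ρ x ∈ S ∧ Γ (ρ x) = x := by
      have h1 : ∀ᶠ x in 𝓝 x₀, (ρ x).2 ∈ {q : ℝ × F | q.1 < ε ∧ ‖q.2‖ < ε} := by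
        have h3 : ContinuousAt (fun w => (ρ w).2) x₀ := continuousAt_snd.comp hρd.continuousAt
        refine h3.eventually ((isOpen_prod_lt ε).eventually_mem ?_)
        simp [hρx₀, hε]
      filter_upwards [h1, hU.eventually_mem hx₀U] with x hx1 hx2
      exact ⟨mem_halfBox.2 ⟨⟨(hUp x hx2).2.1, hx1.1⟩, hx1.2⟩, (hUp x hx2).2.2.1⟩
    have hcomp : HasMFDerivWithinAt I I (Γ ∘ ρ) (ρ ⁻¹' S) x₀
        ((mfderivWithin 𝓘(ℝ, ℝ × (ℝ × F)) I Γ S (ρ x₀)).comp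
          (mfderiv I 𝓘(ℝ, ℝ × (ℝ × F)) ρ x₀)) :=
      HasMFDerivWithinAt.comp x₀ (hΓs.mdifferentiableWithinAt (by simp)).hasMFDerivWithinAt
        hρd.hasMFDerivAt.hasMFDerivWithinAt subset_rfl
    have h2 := hcomp.hasMFDerivAt (hev.mono fun x hx => hx.1)
    have h3 : HasMFDerivAt I I (Γ ∘ ρ) x₀ (ContinuousLinearMap.id ℝ (TangentSpace I x₀)) := by
      refine (hasMFDerivAt_id x₀).congr_of_eventuallyEq ?_
      filter_upwards [hev] with x hx
      exact hx.2
    have h4 := hasMFDerivAt_unique h2 h3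
    intro v w hvw
    have h5 := DFunLike.congr_fun h4 v
    have h6 := DFunLike.congr_fun h4 w
    rw [ContinuousLinearMap.comp_apply] at h5 h6
    rw [hvw] at h5
    exact h5.symm.trans h6
  obtain ⟨T, hT⟩ : ∃ T : E ≃L[ℝ] ℝ × (ℝ × F), HasMFDerivAt I 𝓘(ℝ, ℝ × (ℝ × F)) ρ x₀
      (T : E →L[ℝ] ℝ × (ℝ × F)) := by
    obtain ⟨T₀, hT₀, hT₀i⟩ : ∃ T₀ : E →L[ℝ] ℝ × (ℝ × F),
        HasMFDerivAt I 𝓘(ℝ, ℝ × (ℝ × F)) ρ x₀ T₀ ∧ Function.Injective T₀ :=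
      ⟨mfderiv I 𝓘(ℝ, ℝ × (ℝ × F)) ρ x₀, hρd.hasMFDerivAt, hTinj⟩
    let T₁ : E ≃ₗ[ℝ] ℝ × (ℝ × F) :=
      LinearEquiv.ofInjectiveOfFinrankEq (T₀ : E →ₗ[ℝ] ℝ × (ℝ × F)) hT₀i
        L.toLinearEquiv.finrank_eq.symm
    refine ⟨T₁.toContinuousLinearEquiv, ?_⟩
    convert! hT₀ using 1
  have hΔ : ∀ᶠ x in 𝓝 x₀, f x = (ρ x).2.1 ∧ (q x).2 = (ρ x).2.2 := by
    have h1 : ∀ᶠ x in 𝓝 x₀, (ρ x).2 ∈ {q : ℝ × F | q.1 < ε ∧ ‖q.2‖ < ε} := by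
      have h3 : ContinuousAt (fun w => (ρ w).2) x₀ := continuousAt_snd.comp hρd.continuousAt
      refine h3.eventually ((isOpen_prod_lt ε).eventually_mem ?_)
      simp [hρx₀, hε]
    filter_upwards [h1, hU.eventually_mem hx₀U] with x hx1 hx2
    obtain ⟨-, -, h6⟩ := hUsub x hx2 (mem_halfBox.2 ⟨⟨(hUp x hx2).2.1, hx1.1⟩, hx1.2⟩)
    exact ⟨(hUp x hx2).2.2.2, by rw [h6]⟩
  refine ⟨{
    F := F
    -- `ℂ × F` has the dimension of `ℝ × (ℝ × F)`, hence of `E`; any isomorphism serves to give the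
    -- charts values in `E`.
    L := ContinuousLinearEquiv.ofFinrankEq ?_
    ε := ε
    U := UU
    θ := θ
    y := fun x => (q x).2
    s := s
    τ := fun x => (ρ x).1
    T := T
    ε_pos := hε
    isOpen_U := ?_
    U_subset := hUUD
    s_zero := hs0
    θ_smooth := ?_
    y_smooth := ?_
    s_smooth := hss.mono fun p hp => ⟨hεO p hp, hbox0 p hp⟩
    s_mem := fun p hp => by simpa [C.one] using hmem 1 p hp
    θ_s := fun p hp => by simpa [C.one] using (hθeq 1 p hp).1
    f_s := hfs
    y_s := fun p hp => by simpa [C.one] using congrArg Prod.snd (hθeq 1 p hp).2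
    mem_box := fun x hx => by rw [hfq x hx]; exact hq x hx
    smul_s := fun x hx => by rw [hfq x hx]; exact hθq x hx
    U_inv := ?_
    θ_smul := ?_
    y_smul := ?_
    hasMFDerivAt := ?_ }⟩
  · have h1 := L.toLinearEquiv.finrank_eq
    simp only [Module.finrank_prod, Module.finrank_self, Complex.finrank_real_complex] at h1 ⊢
    omega
  · rw [isOpen_iff_mem_nhds]
    intro x hx
    obtain ⟨a, -, -, h⟩ := hlocal x hx
    exact h.mono fun z hz => hz.2.1
  · intro x hx
    obtain ⟨a, ha, hxD, h⟩ := hlocal x hx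
    have h1 : ContMDiffAt I (𝓡 1) ∞ (fun z => a * Circle.exp (ρ (σ a⁻¹ z)).1) x :=
      contMDiffAt_const.mul (contMDiff_circleExp.contMDiffAt.comp x
        (contDiff_fst.contMDiff.contMDiffAt.comp x (hρσ x hx a ha)))
    exact (h1.congr_of_eventuallyEq (h.mono fun z hz => hz.2.2.1)).contMDiffWithinAt
  · intro x hx
    obtain ⟨a, ha, hxD, h⟩ := hlocal x hx
    have h1 : ContMDiffAt I 𝓘(ℝ, F) ∞ (fun z => (ρ (σ a⁻¹ z)).2.2) x :=
      (contDiff_snd.comp contDiff_snd).contMDiff.contMDiffAt.comp x (hρσ x hx a ha)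
    refine (h1.congr_of_eventuallyEq (h.mono fun z hz => ?_)).contMDiffWithinAt
    exact congrArg Prod.snd hz.2.2.2
  · rintro a _ ⟨b, p, hp, rfl⟩
    exact ⟨a * b, p, hp, C.mul a b _⟩
  · rintro a _ ⟨b, p, hp, rfl⟩
    rw [← C.mul, (hθeq _ p hp).1, (hθeq _ p hp).1]
  · rintro a _ ⟨b, p, hp, rfl⟩
    simp only [← C.mul, (hθeq _ p hp).2]
  · refine hT.congr_of_eventuallyEq (hΔ.mono fun x hx => ?_)
    exact Prod.ext rfl (Prod.ext hx.1 hx.2)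

end Tube

/-! ### The unit part of a complex number -/

section UnitPart

/-- `w / ‖w‖` as an element of the circle (and `1` for `w = 0`). -/
noncomputable def unitPart (w : ℂ) : Circle := Circle.exp w.arg

theorem norm_mul_unitPart (w : ℂ) : (‖w‖ : ℂ) * unitPart w = w := by
  rw [unitPart, Circle.coe_exp, Complex.norm_mul_exp_arg_mul_I]

theorem unitPart_mul {r : ℝ} (hr : 0 < r) (a : Circle) : unitPart (r * (a : ℂ)) = a := by
  have h1 := norm_mul_unitPart (r * (a : ℂ))
  have h2 : ‖(r : ℂ) * (a : ℂ)‖ = r := by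
    rw [norm_mul, Circle.norm_coe, mul_one, Complex.norm_real, Real.norm_of_nonneg hr.le]
  rw [h2] at h1
  exact Circle.ext (mul_left_cancel₀ (by exact_mod_cast hr.ne') h1)

attribute [local instance] finrank_real_complex_fact'

theorem contMDiffOn_unitPart : ContMDiffOn 𝓘(ℝ, ℂ) (𝓡 1) ∞ unitPart {w | w ≠ 0} := by
  let U : Opens ℂ := ⟨{w | w ≠ 0}, isOpen_ne⟩
  intro w hw
  have h1 : ContMDiff 𝓘(ℝ, ℂ) 𝓘(ℝ, ℂ) ∞ (fun x : U => (‖(x : ℂ)‖⁻¹ : ℝ) • (x : ℂ)) := by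
    intro x
    have h2 : ContDiffAt ℝ ∞ (fun w : ℂ => (‖w‖⁻¹ : ℝ) • w) x :=
      ((contDiffAt_norm ℝ x.2).inv (norm_ne_zero_iff.2 x.2)).smul contDiffAt_id
    exact h2.contMDiffAt.comp x contMDiff_subtype_val.contMDiffAt
  have h3 : ∀ x : U, (‖(x : ℂ)‖⁻¹ : ℝ) • (x : ℂ) ∈ Metric.sphere (0 : ℂ) 1 := by
    intro x
    have hx : (x : ℂ) ≠ 0 := x.2
    simp [hx]
  have h4 := ContMDiff.codRestrict_sphere (n := 1) h1 h3
  have h5 : ContMDiffAt 𝓘(ℝ, ℂ) (𝓡 1) ∞ (fun x : U => unitPart x) ⟨w, hw⟩ := by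
    refine (h4 ⟨w, hw⟩).congr_of_eventuallyEq (Filter.Eventually.of_forall fun x => ?_)
    have hx : (x : ℂ) ≠ 0 := x.2
    apply Subtype.ext
    change (unitPart x : ℂ) = (‖(x : ℂ)‖⁻¹ : ℝ) • (x : ℂ)
    have hn : ((‖(x : ℂ)‖ : ℝ) : ℂ) ≠ 0 := by simpa using hx
    rw [Complex.real_smul, Complex.ofReal_inv]
    nth_rewrite 3 [← norm_mul_unitPart (x : ℂ)]
    rw [inv_mul_cancel_left₀ hn]
  exact (contMDiffAt_subtype_iff.1 h5).contMDiffWithinAt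

theorem contMDiff_circle_coe : ContMDiff (𝓡 1) 𝓘(ℝ, ℂ) ∞ (fun a : Circle => (a : ℂ)) :=
  contMDiff_coe_sphere (E := ℂ) (n := 1)

end UnitPart

/-! ### The topology of the cut space -/

section Topology

variable {E H : Type*} [NormedAddCommGroup E] [NormedSpace ℝ E] [TopologicalSpace H]
  {I : ModelWithCorners ℝ E H} {M : Type*} [TopologicalSpace M] [ChartedSpace H M]
  {A : LocalCircleAction M} {f : M → ℝ} {D : Set M}

theorem continuous_cutMk : Continuous (cutMk I A) := continuous_coinduced_rng

theorem isOpen_cut_iff {O : Set (CutSpace I A)} : IsOpen O ↔ IsOpen (cutMk I A ⁻¹' O) :=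
  isOpen_coinduced

theorem surjective_cutMk : Function.Surjective (cutMk I A) := Quotient.mk_surjective

theorem cutMk_eq_iff' {x y : M} : cutMk I A x = cutMk I A y ↔ CutRel I A x y :=
  Quotient.eq (r := cutSetoid I A)

/-- The largest saturated subset of `O`. -/
def saturatedPart (I : ModelWithCorners ℝ E H) (A : LocalCircleAction M) (O : Set M) : Set M :=
  {x | x ∈ O ∧ (x ∈ I.boundary M → ∀ a, A.sm a x ∈ O)}

namespace CutDatum

variable (C : CutDatum I A.sm f D) (hD : D ⊆ (A.dom : Set M))
include C hD

theorem cutMk_eq_iff {x y : M} :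
    cutMk I A x = cutMk I A y ↔ x = y ∨ (x ∈ I.boundary M ∧ ∃ a, A.sm a x = y) := by
  rw [cutMk_eq_iff', CutRel]
  refine or_congr_right ⟨?_, ?_⟩
  · rintro ⟨hx, -, h, a, ha⟩
    exact ⟨hx, a, (A.sm_of_mem a h).trans ha⟩
  · rintro ⟨hx, a, rfl⟩
    exact ⟨hx, (C.boundary_smul (C.bdry hx)).2 hx, hD (C.bdry hx), a, (A.sm_of_mem a _).symm⟩

theorem cutMk_smul (a : Circle) {x : M} (hx : x ∈ I.boundary M) :
    cutMk I A (A.sm a x) = cutMk I A x :=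
  ((C.cutMk_eq_iff hD).2 (Or.inr ⟨hx, a, rfl⟩)).symm

/-- Saturated sets are preimages of their images. -/
theorem preimage_image_cutMk {O : Set M}
    (hO : ∀ x ∈ O, x ∈ I.boundary M → ∀ a, A.sm a x ∈ O) : cutMk I A ⁻¹' (cutMk I A '' O) = O := by
  refine Subset.antisymm ?_ (subset_preimage_image _ _)
  rintro x ⟨y, hy, hyx⟩
  rcases (C.cutMk_eq_iff hD).1 hyx with rfl | ⟨h, a, rfl⟩
  · exact hy
  · exact hO y hy h a

theorem isOpen_image_cutMk {O : Set M} (hOo : IsOpen O)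
    (hO : ∀ x ∈ O, x ∈ I.boundary M → ∀ a, A.sm a x ∈ O) : IsOpen (cutMk I A '' O) := by
  rwa [isOpen_cut_iff, C.preimage_image_cutMk hD hO]

-- The tube lemma for the compact circle: an open condition that holds along a whole orbit holds
-- along all nearby orbits.
omit hD in
theorem eventually_forall_smul_mem {O : Set M} (hO : IsOpen O) {x : M} (hxD : x ∈ D)
    (hx : ∀ a, A.sm a x ∈ O) : ∀ᶠ z in 𝓝 x, ∀ a, A.sm a z ∈ O := by
  have h1 : ∀ᶠ z in 𝓝 x, ∀ a ∈ (univ : Set Circle), A.sm a z ∈ O := by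
    refine isCompact_univ.eventually_forall_of_forall_eventually fun a _ => ?_
    have h2 : ContinuousAt (fun p : Circle × M => A.sm p.1 p.2) (a, x) :=
      C.continuousOn.continuousAt ((isOpen_univ.prod C.isOpen).mem_nhds ⟨mem_univ _, hxD⟩)
    have h3 : ContinuousAt (fun z : M × Circle => A.sm z.2 z.1) (x, a) :=
      ContinuousAt.comp (g := fun p : Circle × M => A.sm p.1 p.2)
        (f := fun z : M × Circle => (z.2, z.1)) h2 (by fun_prop)
    exact h3.eventually (hO.eventually_mem (hx a))
  exact h1.mono fun z hz a => hz a (mem_univ a)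

omit hD in
theorem isOpen_saturatedPart {O : Set M} (hO : IsOpen O) : IsOpen (saturatedPart I A O) := by
  rw [isOpen_iff_mem_nhds]
  rintro x ⟨hx, hxa⟩
  by_cases hb : x ∈ I.boundary M
  · filter_upwards [hO.mem_nhds hx, C.eventually_forall_smul_mem hO (C.bdry hb) (hxa hb)]
      with z hz1 hz2
    exact ⟨hz1, fun _ => hz2⟩
  · filter_upwards [hO.mem_nhds hx, C.isClosed_boundary.isOpen_compl.mem_nhds hb] with z hz1 hz2
    exact ⟨hz1, fun h => absurd h hz2⟩

omit hD in
theorem saturatedPart_smul {O : Set M} : ∀ x ∈ saturatedPart I A O, x ∈ I.boundary M →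
    ∀ a, A.sm a x ∈ saturatedPart I A O := by
  rintro x ⟨hx, hxa⟩ hb a
  exact ⟨hxa hb a, fun _ b => by rw [← C.mul]; exact hxa hb _⟩

theorem isOpen_image_saturatedPart {O : Set M} (hO : IsOpen O) :
    IsOpen (cutMk I A '' saturatedPart I A O) :=
  C.isOpen_image_cutMk hD (C.isOpen_saturatedPart hO) C.saturatedPart_smul

theorem isCompact_fiber (x : M) : IsCompact {z | cutMk I A x = cutMk I A z} := by
  by_cases hb : x ∈ I.boundary M
  · have h1 : {z | cutMk I A x = cutMk I A z} = range fun a => A.sm a x := by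
      ext z
      rw [mem_ofPred_eq, C.cutMk_eq_iff hD]
      constructor
      · rintro (rfl | ⟨-, h⟩)
        · exact ⟨1, C.one x⟩
        · exact h
      · exact fun h => Or.inr ⟨hb, h⟩
    rw [h1]
    refine isCompact_range ?_
    exact C.continuousOn.comp_continuous (by fun_prop : Continuous fun a : Circle => (a, x))
      fun a => ⟨mem_univ _, C.bdry hb⟩
  · have h1 : {z | cutMk I A x = cutMk I A z} = {x} := by
      ext z
      rw [mem_ofPred_eq, C.cutMk_eq_iff hD, mem_singleton_iff]
      exact ⟨fun h => by rcases h with h | h; exacts [h.symm, absurd h.1 hb], fun h => Or.inl h.symm⟩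
    rw [h1]
    exact isCompact_singleton

/-- Fibres of the quotient map are points or circle orbits, so compact, and disjoint ones have
disjoint neighbourhoods in `M`. The saturated parts of these are still open and contain the fibres.
-/
theorem t2Space [T2Space M] : T2Space (CutSpace I A) := by
  refine ⟨fun p q hpq => ?_⟩
  obtain ⟨x, rfl⟩ := surjective_cutMk p
  obtain ⟨y, rfl⟩ := surjective_cutMk q
  obtain ⟨U, V, hU, hV, hxU, hyV, hUV⟩ := SeparatedNhds.of_isCompact_isCompact
    (C.isCompact_fiber hD x) (C.isCompact_fiber hD y) (by
      rw [Set.disjoint_left]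
      intro z hz1 hz2
      rw [mem_ofPred_eq] at hz1 hz2
      exact hpq (hz1.trans hz2.symm))
  have key : ∀ {z : M} {O : Set M}, {w | cutMk I A z = cutMk I A w} ⊆ O →
      cutMk I A z ∈ cutMk I A '' saturatedPart I A O := fun {z O} h =>
    ⟨z, ⟨h rfl, fun hb a => h (C.cutMk_smul hD a hb).symm⟩, rfl⟩
  refine ⟨_, _, C.isOpen_image_saturatedPart hD hU, C.isOpen_image_saturatedPart hD hV,
    key hxU, key hyV, ?_⟩
  rw [Set.disjoint_left]
  rintro _ ⟨z, hz, rfl⟩ hz'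
  have h1 : z ∈ cutMk I A ⁻¹' (cutMk I A '' saturatedPart I A V) := hz'
  rw [C.preimage_image_cutMk hD C.saturatedPart_smul] at h1
  exact Set.disjoint_left.1 hUV hz.1 h1.1

/-- Nothing is identified in the interior, so its open subsets are saturated and have open images.
-/
theorem map_nhds_interior {x : M} (hx : x ∈ I.interior M) :
    Filter.map (cutMk I A) (𝓝 x) = 𝓝 (cutMk I A x) := by
  refine le_antisymm continuous_cutMk.continuousAt ?_
  intro S hS
  rw [Filter.mem_map] at hS
  obtain ⟨O, hO, hOo, hxO⟩ := mem_nhds_iff.1 hS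
  have h1 : IsOpen (cutMk I A '' (O ∩ I.interior M)) :=
    C.isOpen_image_cutMk hD (hOo.inter C.isOpen_interior) fun z hz hb =>
      absurd hb (I.compl_boundary (M := M) ▸ hz.2 : z ∈ (I.boundary M)ᶜ)
  refine Filter.mem_of_superset (h1.mem_nhds ⟨x, ⟨hxO, hx⟩, rfl⟩) ?_
  rintro _ ⟨z, hz, rfl⟩
  exact hO hz.1

end CutDatum

/-- σ-compactness passes to quotients; together with the charts it yields second countability of the
cut space. -/
theorem sigmaCompactSpace_cutSpace [SigmaCompactSpace M] : SigmaCompactSpace (CutSpace I A) := by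
  rw [← isSigmaCompact_univ_iff, ← surjective_cutMk.range_eq, ← image_univ]
  exact isSigmaCompact_univ.image continuous_cutMk

theorem secondCountable_of_charts {X : Type*} [TopologicalSpace X] [SigmaCompactSpace X]
    [FiniteDimensional ℝ E] (h : ∀ p : X, ∃ e : OpenPartialHomeomorph X E, p ∈ e.source) :
    SecondCountableTopology X := by
  choose e he using h
  let cs : ChartedSpace E X :=
    { atlas := range e
      chartAt := e
      mem_chart_source := he
      chart_mem_atlas := fun x => ⟨x, rfl⟩ }
  exact ChartedSpace.secondCountable_of_sigmaCompact E X

/-- Smooth functions on the cut space, with respect to a given boundary defining function. -/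
def cutFunctionsWrt (I : ModelWithCorners ℝ E H) (A : LocalCircleAction M) (f : M → ℝ) :
    Set (CutSpace I A → ℝ) :=
  {h | ContMDiffOn I 𝓘(ℝ) ∞ (fun x => h (cutMk I A x)) (I.interior M) ∧
    ∃ V ⊆ (A.dom : Set M), IsOpen V ∧ I.boundary M ⊆ V ∧ (∀ a, ∀ x ∈ V, A.sm a x ∈ V) ∧
      ∃ K : M × ℂ → ℝ, ContMDiffOn (I.prod 𝓘(ℝ, ℂ)) 𝓘(ℝ) ∞ K (V ×ˢ (univ : Set ℂ)) ∧
        (∀ (a : Circle), ∀ x ∈ V, ∀ z : ℂ, K (A.sm a x, z) = K (x, (a : ℂ) * z)) ∧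
        ∀ x ∈ V, h (cutMk I A x) = K (x, ((Real.sqrt (f x) : ℝ) : ℂ))}

/-- The passage from data on the domain of the action to data on `M`, through the retraction. An
empty domain has no retraction, but then the boundary is empty and `V = ∅` will do. -/
theorem mem_cutFunctions_iff (hA : ∀ x ∈ I.boundary M, x ∈ A.dom) {h : CutSpace I A → ℝ} :
    h ∈ cutFunctions I A ↔ ∃ f, IsInvariantBDF I A f ∧ h ∈ cutFunctionsWrt I A f := by
  constructor
  · rintro ⟨f, hf, hint, V, hV, K, hK, hKe, hKh⟩
    refine ⟨f, hf, hint, ?_⟩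
    obtain ⟨h1, h2, h3⟩ := hV.image hA
    have hsub : Subtype.val '' V ⊆ (A.dom : Set M) := by rintro _ ⟨x, -, rfl⟩; exact x.2
    by_cases hne : (A.dom : Set M).Nonempty
    · obtain ⟨r, hr, hrx⟩ := exists_contMDiffOn_retraction I A.dom hne
      refine ⟨Subtype.val '' V, hsub, h1, h2, h3, fun p => K (r p.1, p.2), ?_, ?_, ?_⟩
      · refine hK.comp (t := V ×ˢ univ)
          (ContMDiffOn.prodMk (hr.comp contMDiffOn_fst ?_) contMDiffOn_snd) ?_
        · rintro ⟨_, z⟩ ⟨⟨x, hx, rfl⟩, -⟩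
          exact x.2
        · rintro ⟨_, z⟩ ⟨⟨x, hx, rfl⟩, -⟩
          simpa [hrx] using hx
      · rintro a _ ⟨x, hx, rfl⟩ z
        simp only [A.sm_coe, hrx, hKe a x hx z]
      · rintro _ ⟨x, hx, rfl⟩
        simp only [hrx, hKh x hx]
    · rw [Set.not_nonempty_iff_eq_empty] at hne
      rw [hne, subset_empty_iff] at hsub
      refine ⟨∅, empty_subset _, isOpen_empty, hsub ▸ h2, by simp, fun _ => 0, ?_, by simp, by simp⟩
      exact contMDiffOn_const
  · rintro ⟨f, hf, hint, V, hVd, hVo, hVb, hVi, K, hK, hKe, hKh⟩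
    refine ⟨f, hf, hint, Subtype.val ⁻¹' V,
      ⟨hVo.preimage continuous_subtype_val, fun x hx => hVb hx, fun a x hx => ?_⟩,
      fun p => K (p.1, p.2), ?_, ?_, ?_⟩
    · have := hVi a _ hx
      rwa [A.sm_coe] at this
    · refine hK.comp (t := V ×ˢ univ) (ContMDiffOn.prodMk
        (contMDiff_subtype_val.comp contMDiff_fst).contMDiffOn contMDiffOn_snd) ?_
      exact fun p hp => ⟨hp.1, mem_univ _⟩
    · intro a x hx z
      have := hKe a x hx z
      simpa only [A.sm_coe] using this
    · exact fun x hx => hKh x hx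

end Topology

/-! ### Charts of the cut space -/

section CutChart

variable {E H : Type*} [NormedAddCommGroup E] [NormedSpace ℝ E] [TopologicalSpace H]
  {I : ModelWithCorners ℝ E H} {M : Type*} [TopologicalSpace M] [ChartedSpace H M]
  {A : LocalCircleAction M} {f : M → ℝ} {D : Set M}

/-- A map `g`, constant on boundary orbits, and a map `S`, inverse to it up to the relation, descend
to a chart. Since `U` is saturated, continuity can be checked in `M`. `S` itself need not be
continuous, only its class. -/
theorem CutDatum.exists_cutChart (C : CutDatum I A.sm f D) (hD : D ⊆ (A.dom : Set M)) {U : Set M}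
    (hU : IsOpen U) (hUs : ∀ x ∈ U, x ∈ I.boundary M → ∀ a, A.sm a x ∈ U) {T : Set E}
    (hT : IsOpen T) {g : M → E} {S : E → M} (hg : ContinuousOn g U)
    (hgs : ∀ x ∈ U, x ∈ I.boundary M → ∀ a, g (A.sm a x) = g x) (hgT : MapsTo g U T)
    (hS : ContinuousOn (fun v => cutMk I A (S v)) T) (hST : MapsTo S T U)
    (hSg : ∀ x ∈ U, cutMk I A (S (g x)) = cutMk I A x) (hgS : ∀ v ∈ T, g (S v) = v) :
    ∃ e : OpenPartialHomeomorph (CutSpace I A) E, e.source = cutMk I A '' U ∧ e.target = T ∧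
      (∀ x ∈ U, e (cutMk I A x) = g x) ∧ ∀ v, e.symm v = cutMk I A (S v) := by
  have hUo := C.isOpen_image_cutMk hD hU hUs
  have hval : ∀ x ∈ U, g (Function.surjInv (surjective_cutMk (I := I) (A := A)) (cutMk I A x)) =
      g x := by
    intro x hx
    rcases (C.cutMk_eq_iff hD).1 (Function.surjInv_eq surjective_cutMk (cutMk I A x)).symm with
      h | ⟨hb, a, ha⟩
    · rw [← h]
    · rw [← ha, hgs x hx hb]
  refine ⟨{ toFun := fun q => g (Function.surjInv (surjective_cutMk (I := I) (A := A)) q)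
            invFun := fun v => cutMk I A (S v)
            source := cutMk I A '' U
            target := T
            map_source' := ?_
            map_target' := fun v hv => ⟨S v, hST hv, rfl⟩
            left_inv' := ?_
            right_inv' := fun v hv => ?_
            open_source := hUo
            open_target := hT
            continuousOn_toFun := ?_
            continuousOn_invFun := hS }, rfl, rfl, hval, fun v => rfl⟩
  · rintro _ ⟨x, hx, rfl⟩
    rw [hval x hx]
    exact hgT hx
  · rintro _ ⟨x, hx, rfl⟩
    rw [hval x hx]
    exact hSg x hx
  · rw [hval _ (hST hv), hgS v hv]
  · rw [continuousOn_open_iff hUo]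
    intro W hW
    rw [isOpen_cut_iff, preimage_inter, C.preimage_image_cutMk hD hUs]
    have h1 : U ∩ cutMk I A ⁻¹' ((fun q => g (Function.surjInv
        (surjective_cutMk (I := I) (A := A)) q)) ⁻¹' W) = U ∩ g ⁻¹' W := by
      ext x
      simp only [mem_inter_iff, mem_preimage]
      exact and_congr_right fun hx => by rw [hval x hx]
    rw [h1]
    exact hg.isOpen_inter_preimage hU hW

/-- Interior points of the cut space. -/
theorem CutDatum.exists_interiorChart (C : CutDatum I A.sm f D) (hD : D ⊆ (A.dom : Set M)) (x₀ : M) :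
    ∃ e : OpenPartialHomeomorph (CutSpace I A) E,
      e.source = cutMk I A '' {x | x ∈ (extChartAt I x₀).source ∧
        extChartAt I x₀ x ∈ interior (range I) ∧ x ∈ I.interior M} ∧
      (∀ v ∈ e.target, v ∈ (extChartAt I x₀).target ∧ v ∈ interior (range I) ∧
        (extChartAt I x₀).symm v ∈ I.interior M) ∧
      (∀ x, x ∈ (extChartAt I x₀).source → extChartAt I x₀ x ∈ interior (range I) →
        x ∈ I.interior M → e (cutMk I A x) = extChartAt I x₀ x) ∧
      ∀ v, e.symm v = cutMk I A ((extChartAt I x₀).symm v) := by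
  have hb : ∀ {x}, x ∈ I.interior M → x ∉ I.boundary M := fun {x} hx =>
    (I.compl_boundary (M := M) ▸ hx : x ∈ (I.boundary M)ᶜ)
  have hO : IsOpen {x | x ∈ (extChartAt I x₀).source ∧ extChartAt I x₀ x ∈ interior (range I)} :=
    (continuousOn_extChartAt x₀).isOpen_inter_preimage (isOpen_extChartAt_source x₀)
      _root_.isOpen_interior
  have hT0 : IsOpen ((extChartAt I x₀).target ∩ interior (range I)) := by
    have : (extChartAt I x₀).target ∩ interior (range I) =
        I.symm ⁻¹' (chartAt H x₀).target ∩ interior (range I) := by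
      rw [extChartAt_target, inter_assoc, inter_eq_self_of_subset_right interior_subset]
    rw [this]
    exact ((chartAt H x₀).open_target.preimage I.continuous_symm).inter _root_.isOpen_interior
  have hcs : ContinuousOn (extChartAt I x₀).symm ((extChartAt I x₀).target ∩ interior (range I)) :=
    (continuousOn_extChartAt_symm x₀).mono inter_subset_left
  obtain ⟨e, he1, he2, he3, he4⟩ := C.exists_cutChart hD
    (U := {x | x ∈ (extChartAt I x₀).source ∧ extChartAt I x₀ x ∈ interior (range I)} ∩
      I.interior M)
    (hO.inter C.isOpen_interior) (fun x hx h => absurd h (hb hx.2))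
    (hcs.isOpen_inter_preimage hT0 C.isOpen_interior)
    (g := extChartAt I x₀) (S := (extChartAt I x₀).symm)
    ((continuousOn_extChartAt x₀).mono fun x hx => hx.1.1) (fun x hx h => absurd h (hb hx.2))
    (fun x hx => ⟨⟨(extChartAt I x₀).map_source hx.1.1, hx.1.2⟩, by
      rw [mem_preimage, (extChartAt I x₀).left_inv hx.1.1]; exact hx.2⟩)
    (continuous_cutMk.comp_continuousOn (hcs.mono inter_subset_left))
    (fun v hv => ⟨⟨(extChartAt I x₀).map_target hv.1.1, by
      rw [(extChartAt I x₀).right_inv hv.1.1]; exact hv.1.2⟩, hv.2⟩)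
    (fun x hx => by rw [(extChartAt I x₀).left_inv hx.1.1])
    (fun v hv => (extChartAt I x₀).right_inv hv.1.1)
  refine ⟨e, ?_, ?_, fun x h1 h2 h3 => he3 x ⟨⟨h1, h2⟩, h3⟩, he4⟩
  · rw [he1]
    congr 1
    ext x
    simp only [mem_inter_iff, mem_ofPred_eq, and_assoc]
  · rw [he2]
    exact fun v hv => ⟨hv.1.1, hv.1.2, hv.2⟩

end CutChart

/-! ### The chart of the cut space given by a tube -/

section TubeChart

variable {E H : Type*} [NormedAddCommGroup E] [NormedSpace ℝ E] [TopologicalSpace H]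
  {I : ModelWithCorners ℝ E H} {M : Type*} [TopologicalSpace M] [ChartedSpace H M]
  {σ : Circle → M → M} {f : M → ℝ} {D : Set M} {x₀ : M}

namespace Tube

/-- The coordinates `(√f θ, y)`. -/
noncomputable def coord (t : Tube I σ f D x₀) (x : M) : ℂ × t.F :=
  ((Real.sqrt (f x) : ℂ) * (t.θ x : ℂ), t.y x)

/-- A right inverse of `Tube.coord`. -/
noncomputable def par (t : Tube I σ f D x₀) (p : ℂ × t.F) : M :=
  σ (unitPart p.1) (t.s (sqNormFst p))

variable (t : Tube I σ f D x₀)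

theorem sqNormFst_coord (C : CutDatum I σ f D) (x : M) : sqNormFst (t.coord x) = (f x, t.y x) := by
  have h1 : ‖(t.coord x).1‖ = Real.sqrt (f x) := by
    rw [coord, norm_mul, Circle.norm_coe, mul_one, Complex.norm_real,
      Real.norm_of_nonneg (Real.sqrt_nonneg _)]
  rw [sqNormFst, h1, Real.sq_sqrt (C.f_nonneg x), coord]

theorem coord_mem (C : CutDatum I σ f D) {x : M} (hx : x ∈ t.U) :
    t.coord x ∈ diskBox t.F t.ε := by
  rw [← sqNormFst_mem, t.sqNormFst_coord C]
  exact t.mem_box x hx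

theorem s_mem_sq {p : ℂ × t.F} (hp : p ∈ diskBox t.F t.ε) : t.s (sqNormFst p) ∈ t.U :=
  t.s_mem _ (sqNormFst_mem.2 hp)

theorem par_mem {p : ℂ × t.F} (hp : p ∈ diskBox t.F t.ε) : t.par p ∈ t.U :=
  t.U_inv _ _ (t.s_mem_sq hp)

theorem f_par (C : CutDatum I σ f D) {p : ℂ × t.F} (hp : p ∈ diskBox t.F t.ε) :
    f (t.par p) = ‖p.1‖ ^ 2 := by
  rw [par, C.f_inv _ _ (t.U_subset (t.s_mem_sq hp)), t.f_s _ (sqNormFst_mem.2 hp), sqNormFst]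

theorem coord_par (C : CutDatum I σ f D) {p : ℂ × t.F} (hp : p ∈ diskBox t.F t.ε) :
    t.coord (t.par p) = p := by
  have h1 : t.θ (t.par p) = unitPart p.1 := by
    rw [par, t.θ_smul _ _ (t.s_mem_sq hp), t.θ_s _ (sqNormFst_mem.2 hp), mul_one]
  have h2 : t.y (t.par p) = p.2 := by
    rw [par, t.y_smul _ _ (t.s_mem_sq hp), t.y_s _ (sqNormFst_mem.2 hp), sqNormFst]
  rw [coord, h1, h2, t.f_par C hp, Real.sqrt_sq (norm_nonneg _), norm_mul_unitPart]

theorem par_coord (C : CutDatum I σ f D) {x : M} (hx : x ∈ t.U) (hf : 0 < f x) :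
    t.par (t.coord x) = x := by
  rw [par, t.sqNormFst_coord C]
  have : unitPart (t.coord x).1 = t.θ x := unitPart_mul (Real.sqrt_pos.2 hf) _
  rw [this, t.smul_s x hx]

theorem coord_smul (C : CutDatum I σ f D) (a : Circle) {x : M} (hx : x ∈ t.U) :
    t.coord (σ a x) = ((a : ℂ) * (t.coord x).1, (t.coord x).2) := by
  simp only [coord, C.f_inv a x (t.U_subset hx), t.θ_smul a x hx, t.y_smul a x hx, Circle.coe_mul]
  rw [mul_left_comm]

theorem continuousOn_coord (C : CutDatum I σ f D) : ContinuousOn t.coord t.U := by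
  have h1 : Continuous fun x => (Real.sqrt (f x) : ℂ) :=
    Complex.continuous_ofReal.comp (Real.continuous_sqrt.comp C.f_smooth.continuous)
  exact (h1.continuousOn.mul (contMDiff_circle_coe.continuous.comp_continuousOn
    t.θ_smooth.continuousOn)).prodMk t.y_smooth.continuousOn

theorem contMDiffOn_par (C : CutDatum I σ f D) :
    ContMDiffOn 𝓘(ℝ, ℂ × t.F) I ∞ t.par (diskBox t.F t.ε ∩ {p | p.1 ≠ 0}) := by
  intro p hp
  have h1 : ContMDiffWithinAt 𝓘(ℝ, ℂ × t.F) 𝓘(ℝ, ℂ) ∞ (fun p : ℂ × t.F => p.1)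
      (diskBox t.F t.ε ∩ {p | p.1 ≠ 0}) p := contDiff_fst.contMDiff.contMDiffAt.contMDiffWithinAt
  have h2 : ContMDiffWithinAt 𝓘(ℝ, ℂ × t.F) I ∞ (fun p => t.s (sqNormFst p))
      (diskBox t.F t.ε ∩ {p | p.1 ≠ 0}) p :=
    ContMDiffWithinAt.comp (t := halfBox t.F t.ε) p (t.s_smooth _ (sqNormFst_mem.2 hp.1))
      contDiff_sqNormFst.contMDiff.contMDiffAt.contMDiffWithinAt fun q hq => sqNormFst_mem.2 hq.1
  have h3 : ContMDiffWithinAt 𝓘(ℝ, ℂ) (𝓡 1) ∞ unitPart {w | w ≠ 0} p.1 :=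
    contMDiffOn_unitPart _ hp.2
  have h4 : ContMDiffWithinAt 𝓘(ℝ, ℂ × t.F) (𝓡 1) ∞ (fun p : ℂ × t.F => unitPart p.1)
      (diskBox t.F t.ε ∩ {p | p.1 ≠ 0}) p := h3.comp p h1 fun q hq => hq.2
  exact C.smul_contMDiffWithinAt h4 h2 (t.U_subset (t.s_mem_sq hp.1))

end Tube

variable {A : LocalCircleAction M}

namespace Tube

variable (t : Tube I A.sm f D x₀) (C : CutDatum I A.sm f D) (hD : D ⊆ (A.dom : Set M))
include C hD

/-- In the interior `par` inverts `coord`. On the boundary `w = 0` forgets the angle, so the point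
is recovered only up to its orbit, which is a single point of the cut space. -/
theorem cutMk_par_coord {x : M} (hx : x ∈ t.U) :
    cutMk I A (t.par (t.coord x)) = cutMk I A x := by
  rcases (C.f_nonneg x).lt_or_eq with h | h
  · rw [t.par_coord C hx h]
  · have hb : x ∈ I.boundary M := (C.f_zero x).1 h.symm
    have hs : t.s (f x, t.y x) = A.sm (t.θ x)⁻¹ x := by
      have h1 := C.inv_smul (t.θ x) (t.s (f x, t.y x))
      rw [t.smul_s x hx] at h1
      exact h1.symm
    rw [par, t.sqNormFst_coord C, hs, ← C.mul, C.cutMk_smul hD _ hb]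

/-- For `w = 0` every `a` satisfies the condition, so the default value of `unitPart` at `0` does
not affect the class. -/
theorem cutMk_par {p : ℂ × t.F} (hp : p ∈ diskBox t.F t.ε) (a : Circle)
    (ha : ‖p.1‖ * (a : ℂ) = p.1) :
    cutMk I A (A.sm a (t.s (sqNormFst p))) = cutMk I A (t.par p) := by
  have h1 : t.coord (A.sm a (t.s (sqNormFst p))) = p := by
    rw [t.coord_smul C a (t.s_mem_sq hp)]
    have h3 := sqNormFst_mem.2 hp
    rw [coord, t.θ_s _ h3, t.y_s _ h3, t.f_s _ h3]
    refine Prod.ext ?_ rfl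
    simp only [sqNormFst, Real.sqrt_sq (norm_nonneg _), Circle.coe_one, mul_one]
    rw [mul_comm, ha]
  rw [← t.cutMk_par_coord C hD (t.U_inv a _ (t.s_mem_sq hp)), h1]

theorem continuousOn_cutMk_par :
    ContinuousOn (fun p => cutMk I A (t.par p)) (diskBox t.F t.ε) := by
  intro p hp
  have hs : ContinuousWithinAt (fun p => t.s (sqNormFst p)) (diskBox t.F t.ε) p :=
    ContinuousWithinAt.comp (t := halfBox t.F t.ε)
      (t.s_smooth.continuousOn _ (sqNormFst_mem.2 hp))
      (contDiff_sqNormFst.continuous.continuousWithinAt) fun q hq => sqNormFst_mem.2 hq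
  by_cases h0 : p.1 = 0
  -- `unitPart` is discontinuous at `0`, but all phases give the same point of the cut space there.
  -- Compactness of the circle gives a neighbourhood that works for every phase simultaneously.
  · intro O hO
    rw [mem_nhds_iff] at hO
    obtain ⟨O', hO'O, hO', hpO'⟩ := hO
    have hz : t.s (sqNormFst p) ∈ I.boundary M := by
      rw [← C.f_zero, t.f_s _ (sqNormFst_mem.2 hp)]
      simp [sqNormFst, h0]
    have h1 := C.eventually_forall_smul_mem (hO'.preimage continuous_cutMk)
      (C.bdry hz) (fun a => by
        rw [mem_preimage, t.cutMk_par C hD hp a (by simp [h0])]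
        exact hpO')
    exact (hs.eventually h1).mono fun q hq => hO'O (hq _)
  · have h1 := (t.contMDiffOn_par C).continuousOn.continuousAt
      (((isOpen_diskBox t.ε).inter (isOpen_ne_fun continuous_fst continuous_const)).mem_nhds
        ⟨hp, h0⟩)
    exact (continuous_cutMk.continuousAt.comp h1).continuousWithinAt

theorem exists_chart : ∃ e : OpenPartialHomeomorph (CutSpace I A) E,
    e.source = cutMk I A '' t.U ∧ e.target = t.L.symm ⁻¹' diskBox t.F t.ε ∧
      (∀ x ∈ t.U, e (cutMk I A x) = t.L (t.coord x)) ∧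
      ∀ v, e.symm v = cutMk I A (t.par (t.L.symm v)) := by
  refine C.exists_cutChart hD t.isOpen_U (fun x hx _ a => t.U_inv a x hx)
    ((isOpen_diskBox t.ε).preimage t.L.symm.continuous)
    (g := fun x => t.L (t.coord x)) (S := fun v => t.par (t.L.symm v))
    (t.L.continuous.comp_continuousOn (t.continuousOn_coord C)) ?_ ?_ ?_
    (fun v hv => t.par_mem hv) ?_ ?_
  · intro x hx hb a
    rw [t.coord_smul C a hx]
    simp [coord, (C.f_zero x).2 hb]
  · intro x hx
    rw [mem_preimage, t.L.symm_apply_apply]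
    exact t.coord_mem C hx
  · exact (t.continuousOn_cutMk_par C hD).comp t.L.symm.continuous.continuousOn fun v hv => hv
  · intro x hx
    rw [t.L.symm_apply_apply, t.cutMk_par_coord C hD hx]
  · intro v hv
    rw [t.coord_par C hv, t.L.apply_symm_apply]

end Tube

end TubeChart

/-! ### Extending functions from charts of the cut space -/

section Extend

variable {E H : Type*} [NormedAddCommGroup E] [NormedSpace ℝ E] [TopologicalSpace H]
  {I : ModelWithCorners ℝ E H} {M : Type*} [TopologicalSpace M] [ChartedSpace H M]
  [IsManifold I ∞ M] [T2Space M] [FiniteDimensional ℝ E]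

omit [IsManifold I ∞ M] in
/-- Invariant bump functions around orbits. -/
theorem Tube.exists_bump {σ : Circle → M → M} {f : M → ℝ} {D : Set M} {x₀ : M}
    (t : Tube I σ f D x₀) (C : CutDatum I σ f D) {x₁ : M} (hx₁ : x₁ ∈ t.U) {O : Set M}
    (hO : IsOpen O) (hOi : ∀ a, ∀ x ∈ O, σ a x ∈ O) (hx₁O : x₁ ∈ O) :
    ∃ (b : M → ℝ) (B : Set M), ContMDiff I 𝓘(ℝ) ∞ b ∧ tsupport b ⊆ t.U ∩ O ∧
      (∀ a x, b (σ a x) = b x) ∧ IsOpen B ∧ (∀ a, ∀ x ∈ B, σ a x ∈ B) ∧ x₁ ∈ B ∧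
      ∀ x ∈ B, b x = 1 := by
  classical
  set Φ : M → ℝ × t.F := fun x => (f x, t.y x) with hΦ
  have hΦs : ContMDiffOn I 𝓘(ℝ, ℝ × t.F) ∞ Φ t.U :=
    C.f_smooth.contMDiffOn.prodMk_space t.y_smooth
  have hΦi : ∀ a, ∀ x ∈ t.U, Φ (σ a x) = Φ x := fun a x hx => by
    simp only [hΦ, C.f_inv a x (t.U_subset hx), t.y_smul a x hx]
  have hUi : ∀ a x, σ a x ∈ t.U ↔ x ∈ t.U := fun a x =>
    ⟨fun h => by simpa [C.inv_smul] using t.U_inv a⁻¹ _ h, t.U_inv a x⟩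
  have hsO : t.s (Φ x₁) ∈ O := by
    have h1 := C.inv_smul (t.θ x₁) (t.s (Φ x₁))
    rw [t.smul_s x₁ hx₁] at h1
    rw [← h1]
    exact hOi _ _ hx₁O
  -- The conditions are stated as implications so that they hold on a full neighbourhood in `ℝ × F`,
  -- although the slice exists only over nonnegative first coordinates.
  have hnhds : {q : ℝ × t.F | (0 ≤ q.1 → q ∈ halfBox t.F t.ε) ∧ (q ∈ halfBox t.F t.ε → t.s q ∈ O)} ∈
      𝓝 (Φ x₁) := by
    have h1 : ∀ᶠ q in 𝓝[halfBox t.F t.ε] (Φ x₁), t.s q ∈ O :=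
      (t.s_smooth.continuousOn _ (t.mem_box x₁ hx₁)).eventually (hO.eventually_mem hsO)
    have h2 : ∀ᶠ q in 𝓝 (Φ x₁), q.1 < t.ε ∧ ‖q.2‖ < t.ε :=
      (isOpen_prod_lt t.ε).eventually_mem (x := Φ x₁)
        ⟨(mem_halfBox.1 (t.mem_box x₁ hx₁)).1.2, (mem_halfBox.1 (t.mem_box x₁ hx₁)).2⟩
    filter_upwards [eventually_nhdsWithin_iff.1 h1, h2] with q hq1 hq2
    exact ⟨fun h => mem_halfBox.2 ⟨⟨h, hq2.1⟩, hq2.2⟩, hq1⟩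
  obtain ⟨r, hr, hrs⟩ := Metric.nhds_basis_closedBall.mem_iff.1 hnhds
  let ψ : ContDiffBump (Φ x₁) := ⟨r / 2, r, by positivity, by linarith⟩
  set b : M → ℝ := fun x => if x ∈ t.U then ψ (Φ x) else 0 with hb
  -- The points swept out over a closed half-ball form a compact, hence closed, subset of `M`. It
  -- contains the support of `b`, so the closed support stays in the tube and `b` is smooth after
  -- extension by zero.
  have hK : IsCompact ((fun p : Circle × (ℝ × t.F) => σ p.1 (t.s p.2)) ''
      (univ ×ˢ (Metric.closedBall (Φ x₁) r ∩ {q | 0 ≤ q.1}))) := by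
    have hc : IsCompact (Metric.closedBall (Φ x₁) r ∩ {q : ℝ × t.F | 0 ≤ q.1}) :=
      (isCompact_closedBall _ _).inter_right (isClosed_le continuous_const continuous_fst)
    refine (isCompact_univ.prod hc).image_of_continuousOn ?_
    have h1 : ContinuousOn (fun p : Circle × (ℝ × t.F) => (p.1, t.s p.2))
        (univ ×ˢ (Metric.closedBall (Φ x₁) r ∩ {q | 0 ≤ q.1})) :=
      continuousOn_fst.prodMk (t.s_smooth.continuousOn.comp continuousOn_snd
        fun p hp => (hrs hp.2.1).1 hp.2.2)
    exact C.continuousOn.comp h1 fun p hp =>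
      ⟨mem_univ _, t.U_subset (t.s_mem _ ((hrs hp.2.1).1 hp.2.2))⟩
  have hts : tsupport b ⊆ t.U ∩ O := by
    have h1 : Function.support b ⊆ (fun p : Circle × (ℝ × t.F) => σ p.1 (t.s p.2)) ''
        (univ ×ˢ (Metric.closedBall (Φ x₁) r ∩ {q | 0 ≤ q.1})) := by
      intro x hx
      have hxU : x ∈ t.U := by
        by_contra h
        exact hx (if_neg h)
      have hx' : ψ (Φ x) ≠ 0 := by simpa [hb, hxU] using hx
      have hx2 : Φ x ∈ Metric.ball (Φ x₁) r := by
        have : Φ x ∈ Function.support ψ := hx'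
        rwa [ψ.support_eq] at this
      exact ⟨(t.θ x, Φ x), ⟨mem_univ _, Metric.ball_subset_closedBall hx2, C.f_nonneg x⟩,
        t.smul_s x hxU⟩
    refine (closure_minimal h1 hK.isClosed).trans ?_
    rintro _ ⟨⟨a, q⟩, ⟨-, hq, hq0⟩, rfl⟩
    have hqb := (hrs hq).1 hq0
    exact ⟨t.U_inv a _ (t.s_mem q hqb), hOi a _ ((hrs hq).2 hqb)⟩
  refine ⟨b, t.U ∩ Φ ⁻¹' Metric.ball (Φ x₁) (r / 2), ?_, hts, ?_, ?_, ?_, ?_, ?_⟩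
  · refine contMDiff_of_tsupport fun x hx => ?_
    have hxU := (hts hx).1
    have h1 : ContMDiffAt I 𝓘(ℝ) ∞ (fun x => ψ (Φ x)) x :=
      ψ.contDiff.contMDiff.contMDiffAt.comp x ((hΦs x hxU).contMDiffAt (t.isOpen_U.mem_nhds hxU))
    refine h1.congr_of_eventuallyEq ?_
    filter_upwards [t.isOpen_U.mem_nhds hxU] with z hz
    simp [hb, hz]
  · intro a x
    by_cases h : x ∈ t.U
    · simp only [hb, hUi, h, if_true, hΦi a x h]
    · simp only [hb, hUi, h, if_false]
  · exact hΦs.continuousOn.isOpen_inter_preimage t.isOpen_U Metric.isOpen_ball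
  · rintro a x ⟨hx, hx'⟩
    refine ⟨t.U_inv a x hx, ?_⟩
    rwa [mem_preimage, hΦi a x hx]
  · exact ⟨hx₁, Metric.mem_ball_self (by positivity)⟩
  · rintro x ⟨hx, hx'⟩
    simp only [hb, hx, if_true]
    exact ψ.one_of_mem_closedBall (Metric.ball_subset_closedBall hx')

variable {A : LocalCircleAction M} {f : M → ℝ} {D : Set M}

omit [IsManifold I ∞ M] [T2Space M] [FiniteDimensional ℝ E] in
/-- Functions that are constant on boundary orbits descend to the cut space. -/
theorem CutDatum.exists_descend (C : CutDatum I A.sm f D) (hD : D ⊆ (A.dom : Set M)) {k : M → ℝ}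
    (hk : ∀ x ∈ I.boundary M, ∀ a, k (A.sm a x) = k x) :
    ∃ h : CutSpace I A → ℝ, ∀ x, h (cutMk I A x) = k x := by
  refine ⟨fun q => k (Function.surjInv surjective_cutMk q), fun x => ?_⟩
  rcases (C.cutMk_eq_iff hD).1 (Function.surjInv_eq surjective_cutMk (cutMk I A x)).symm with
    h | ⟨hb, a, ha⟩
  · exact congrArg k h.symm
  · exact (congrArg k ha).symm.trans (hk x hb a)

/-- The cut-off is supported where `f > f(x₁) / 2`. The product therefore vanishes near the
boundary, and the zero function is a witness there. -/
theorem CutDatum.extend_interior (C : CutDatum I A.sm f D) (hD : D ⊆ (A.dom : Set M)) {x₁ : M}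
    (hx₁ : x₁ ∈ I.interior M) {U : Set M} (hU : IsOpen U) (hxU : x₁ ∈ U) {k : M → ℝ}
    (hk : ContMDiffOn I 𝓘(ℝ) ∞ k U) :
    ∃ h ∈ cutFunctionsWrt I A f, ∀ᶠ x in 𝓝 x₁, h (cutMk I A x) = k x := by
  have hpos := C.interior_iff.1 hx₁
  have hO : IsOpen {x | f x₁ / 2 < f x} := isOpen_lt continuous_const C.f_smooth.continuous
  have hxO : x₁ ∈ {x | f x₁ / 2 < f x} := half_lt_self hpos
  obtain ⟨b, hb, hbU, hb1⟩ := Cutting.exists_bump I ((hU.inter hO).mem_nhds ⟨hxU, hxO⟩)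
  have hb0 : ∀ x, f x ≤ f x₁ / 2 → b x = 0 := fun x hx => by
    by_contra hne
    exact absurd (hbU (subset_tsupport b hne)).2 (not_lt.2 hx)
  obtain ⟨h, hh⟩ := C.exists_descend hD (k := fun x => b x * k x) fun x hx a => by
    have h1 : f x = 0 := (C.f_zero x).2 hx
    have h2 : f (A.sm a x) = 0 := by rw [C.f_inv a x (C.bdry hx), h1]
    simp only [hb0 x (by linarith), hb0 (A.sm a x) (by linarith), zero_mul]
  have hsm : ContMDiff I 𝓘(ℝ) ∞ fun x => b x * k x := by
    refine contMDiff_of_tsupport fun x hx => ?_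
    have hxU : x ∈ U := (hbU (tsupport_mul_subset_left hx)).1
    exact hb.contMDiffAt.mul ((hk x hxU).contMDiffAt (hU.mem_nhds hxU))
  refine ⟨h, ⟨?_, D ∩ {x | f x < f x₁ / 2}, fun x hx => hD hx.1, ?_, ?_, ?_, fun _ => 0,
    contMDiffOn_const, fun _ _ _ _ => rfl, ?_⟩, ?_⟩
  · simp only [hh]
    exact hsm.contMDiffOn
  · exact C.isOpen.inter (isOpen_lt C.f_smooth.continuous continuous_const)
  · intro x hx
    refine ⟨C.bdry hx, ?_⟩
    rw [mem_ofPred_eq, (C.f_zero x).2 hx]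
    exact half_pos hpos
  · rintro a x ⟨hx, hx'⟩
    refine ⟨C.maps a x hx, ?_⟩
    rwa [mem_ofPred_eq, C.f_inv a x hx]
  · rintro x ⟨-, hx⟩
    rw [hh, hb0 x hx.le, zero_mul]
  · filter_upwards [hb1] with x hx
    simp [hh, hx]

-- The witness is `K(x, z) = b(x) g(z θ(x), y(x))` with an invariant bump `b`. It is equivariant
-- since `θ(a x) = a θ(x)`, and at `z = √f` its argument is exactly `coord x`.
omit [IsManifold I ∞ M] in
theorem Tube.extend {x₀ : M} (t : Tube I A.sm f D x₀) (C : CutDatum I A.sm f D)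
    (hD : D ⊆ (A.dom : Set M)) {x₁ : M} (hx₁ : x₁ ∈ t.U) {g : ℂ × t.F → ℝ} (hg : ContDiff ℝ ∞ g) :
    ∃ h ∈ cutFunctionsWrt I A f, ∃ B : Set M, IsOpen B ∧ x₁ ∈ B ∧ (∀ a, ∀ x ∈ B, A.sm a x ∈ B) ∧
      ∀ x ∈ B, h (cutMk I A x) = g (t.coord x) := by
  obtain ⟨b, B, hb, hbU, hbi, hBo, hBi, hxB, hB1⟩ := t.exists_bump C hx₁ isOpen_univ
    (fun _ _ _ => mem_univ _) (mem_univ _)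
  rw [inter_univ] at hbU
  have hb0 : ∀ x, x ∉ t.U → b x = 0 := fun x hx => by
    by_contra hne
    exact hx (hbU (subset_tsupport b hne))
  set K : M × ℂ → ℝ := fun p => b p.1 * g (p.2 * (t.θ p.1 : ℂ), t.y p.1) with hK
  have hKs : ContMDiff (I.prod 𝓘(ℝ, ℂ)) 𝓘(ℝ) ∞ K := by
    refine contMDiff_of_tsupport fun p hp => ?_
    have hpU : p.1 ∈ t.U := by
      have h1 : tsupport K ⊆ Prod.fst ⁻¹' tsupport b := by
        refine closure_minimal (fun p hp => ?_) ((isClosed_tsupport b).preimage continuous_fst)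
        exact subset_tsupport b fun h0 => hp (by simp only [hK, h0, zero_mul])
      exact hbU (h1 hp)
    have h2 : ContMDiffAt (I.prod 𝓘(ℝ, ℂ)) (𝓡 1) ∞ (fun p : M × ℂ => t.θ p.1) p :=
      ContMDiffAt.comp p ((t.θ_smooth _ hpU).contMDiffAt (t.isOpen_U.mem_nhds hpU))
        contMDiffAt_fst
    have h3 : ContMDiffAt (I.prod 𝓘(ℝ, ℂ)) 𝓘(ℝ, t.F) ∞ (fun p : M × ℂ => t.y p.1) p :=
      ContMDiffAt.comp p ((t.y_smooth _ hpU).contMDiffAt (t.isOpen_U.mem_nhds hpU))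
        contMDiffAt_fst
    have h4 : ContMDiffAt (I.prod 𝓘(ℝ, ℂ)) 𝓘(ℝ, ℂ) ∞ (fun p : M × ℂ => (t.θ p.1 : ℂ)) p :=
      contMDiff_circle_coe.contMDiffAt.comp p h2
    have h5 : ContMDiffAt (I.prod 𝓘(ℝ, ℂ)) 𝓘(ℝ, ℂ) ∞ (fun p : M × ℂ => p.2 * (t.θ p.1 : ℂ)) p :=
      (contDiff_mul (𝕜 := ℝ) (𝔸 := ℂ) (n := ∞)).contMDiff.contMDiffAt.comp p
        (contMDiffAt_snd.prodMk_space h4)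
    exact (hb.contMDiffAt.comp p contMDiffAt_fst).mul
      (hg.contMDiff.contMDiffAt.comp p (h5.prodMk_space h3))
  have hKi : ∀ (a : Circle) x (z : ℂ), K (A.sm a x, z) = K (x, (a : ℂ) * z) := by
    intro a x z
    by_cases hx : x ∈ t.U
    · simp only [hK, hbi, t.θ_smul a x hx, t.y_smul a x hx, Circle.coe_mul]
      rw [mul_comm (a : ℂ) z, mul_assoc]
    · simp only [hK, hbi, hb0 x hx, zero_mul]
  obtain ⟨h, hh⟩ := C.exists_descend hD (k := fun x => b x * g (t.coord x)) fun x hx a => by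
    by_cases hxU : x ∈ t.U
    · simp only [hbi, t.coord_smul C a hxU]
      simp [Tube.coord, (C.f_zero x).2 hx]
    · simp only [hbi, hb0 x hxU, zero_mul]
  refine ⟨h, ⟨?_, D, hD, C.isOpen, C.bdry, C.maps, K, hKs.contMDiffOn, fun a x _ z => hKi a x z,
    fun x _ => ?_⟩, B, hBo, hxB, hBi, fun x hx => ?_⟩
  · intro x hx
    have hr : ContMDiffAt I 𝓘(ℝ, ℂ) ∞ (fun x => (Real.sqrt (f x) : ℂ)) x := by
      have h1 : ContMDiffAt I 𝓘(ℝ) ∞ (fun x => Real.sqrt (f x)) x :=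
        (Real.contDiffAt_sqrt (C.interior_iff.1 hx).ne').contMDiffAt.comp x
          C.f_smooth.contMDiffAt
      exact Complex.ofRealCLM.contDiff.contMDiff.contMDiffAt.comp x h1
    have h2 : ContMDiffAt I 𝓘(ℝ) ∞ (fun x => K (x, (Real.sqrt (f x) : ℂ))) x :=
      hKs.contMDiffAt.comp x (contMDiffAt_id.prodMk hr)
    refine (h2.congr_of_eventuallyEq (Filter.Eventually.of_forall fun z => ?_)).contMDiffWithinAt
    simp only [hh, hK, Tube.coord]
  · rw [hh]
    rfl
  · rw [hh, hB1 x hx, one_mul]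

end Extend

/-! ### Smoothness in the charts of the cut space -/

section SmoothInCharts

variable {E H : Type*} [NormedAddCommGroup E] [NormedSpace ℝ E] [TopologicalSpace H]
  {I : ModelWithCorners ℝ E H} {M : Type*} [TopologicalSpace M] [ChartedSpace H M]
  {A : LocalCircleAction M} {f : M → ℝ} {D : Set M} {x₀ : M}

/-- Another boundary defining function is, in a tube, `‖w‖ ^ 2` times a smooth function of
`(w, y)`, that is positive for `w = 0`. -/
theorem Tube.exists_quotient [FiniteDimensional ℝ E] (t : Tube I A.sm f D x₀)
    (C : CutDatum I A.sm f D) {f' : M → ℝ} {D' : Set M} (C' : CutDatum I A.sm f' D') :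
    ∃ u : ℂ × t.F → ℝ, ContDiffOn ℝ ∞ u (diskBox t.F t.ε) ∧
      (∀ p ∈ diskBox t.F t.ε, f' (t.s (sqNormFst p)) = ‖p.1‖ ^ 2 * u p) ∧
      ∀ y, (0, y) ∈ diskBox t.F t.ε → 0 < u (0, y) := by
  set g : ℝ × t.F → ℝ := fun q => f' (t.s q) with hg
  have hgs : ContDiffOn ℝ ∞ g (halfBox t.F t.ε) :=
    contMDiffOn_iff_contDiffOn.1 (C'.f_smooth.comp_contMDiffOn t.s_smooth)
  have hmem : ∀ y : t.F, ‖y‖ < t.ε → ((0 : ℝ), y) ∈ halfBox t.F t.ε := fun y hy =>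
    mem_halfBox.2 ⟨⟨le_rfl, t.ε_pos⟩, hy⟩
  have hbd : ∀ y : t.F, ‖y‖ < t.ε → t.s (0, y) ∈ I.boundary M := fun y hy => by
    rw [← C.f_zero, t.f_s _ (hmem y hy)]
  have hg0 : ∀ y, ‖y‖ < t.ε → g (0, y) = 0 := fun y hy => (C'.f_zero _).2 (hbd y hy)
  obtain ⟨u, hu, hug, hu0⟩ := exists_hadamard_quotient hgs hg0
  refine ⟨u, hu, hug, fun y hy => lt_of_le_of_ne ?_ (Ne.symm ?_)⟩
  -- `u` is nonnegative at `w = 0` by continuity, because `‖w‖² u` is a value of the nonnegative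
  -- function `f'`.
  · have hc : ContinuousAt u (0, y) :=
      hu.continuousOn.continuousAt ((isOpen_diskBox t.ε).mem_nhds hy)
    by_contra! hlt
    have h1 : ∀ᶠ p in 𝓝 ((0 : ℂ), y), u p < 0 ∧ p ∈ diskBox t.F t.ε :=
      (hc.eventually (gt_mem_nhds hlt)).and ((isOpen_diskBox t.ε).eventually_mem hy)
    have h2 : ContinuousAt (fun r : ℝ => ((r : ℂ), y)) 0 := by
      have : Continuous fun r : ℝ => ((r : ℂ), y) := by fun_prop
      exact this.continuousAt
    have h3 : ∀ᶠ r : ℝ in 𝓝 0, u ((r : ℂ), y) < 0 ∧ ((r : ℂ), y) ∈ diskBox t.F t.ε :=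
      h2.tendsto.eventually (by rwa [Complex.ofReal_zero])
    obtain ⟨δ, hδ, hδu⟩ := Metric.eventually_nhds_iff_ball.1 h3
    obtain ⟨h4, h5⟩ := hδu (δ / 2) (by
      rw [Metric.mem_ball, dist_zero_right, Real.norm_of_nonneg (by positivity)]; linarith)
    have h6 := hug _ h5
    have h7 : 0 ≤ g (sqNormFst (((δ / 2 : ℝ) : ℂ), y)) := C'.f_nonneg _
    rw [h6] at h7
    have h8 : 0 < ‖(((δ / 2 : ℝ) : ℂ))‖ ^ 2 := by
      rw [Complex.norm_real, Real.norm_of_nonneg (by positivity)]; positivity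
    nlinarith
  -- At `w = 0`, `u` is the derivative of `f'` along the slice in the direction of `f`. If it
  -- vanished, all derivatives of `f'` in the coordinates `(f, y)` would vanish there; by invariance
  -- `f'` depends on these coordinates only, so its differential would be zero at a boundary point.
  · intro hzero
    rw [hu0] at hzero
    have hy' : ‖y‖ < t.ε := hy.2
    have hz := hmem y hy'
    have hgd : HasFDerivWithinAt g (fderivWithin ℝ g (halfBox t.F t.ε) (0, y))
        (halfBox t.F t.ε) (0, y) := (hgs.differentiableOn (by simp) _ hz).hasFDerivWithinAt
    set G := fderivWithin ℝ g (halfBox t.F t.ε) (0, y) with hG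
    have hG0 : G = 0 := by
      have h1 : HasFDerivWithinAt (fun y : t.F => g (0, y))
          (G.comp (ContinuousLinearMap.inr ℝ ℝ t.F)) (Metric.ball 0 t.ε) y :=
        hgd.comp y (ContinuousLinearMap.inr ℝ ℝ t.F).hasFDerivAt.hasFDerivWithinAt
          fun y' hy' => hmem y' (by simpa using hy')
      have hyb : Metric.ball (0 : t.F) t.ε ∈ 𝓝 y := Metric.isOpen_ball.mem_nhds (by simpa using hy')
      have h2 : HasFDerivAt (fun y : t.F => g (0, y)) (0 : t.F →L[ℝ] ℝ) y := by
        refine (hasFDerivAt_const (0 : ℝ) y).congr_of_eventuallyEq ?_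
        filter_upwards [hyb] with y' hy'
        exact hg0 y' (by simpa using hy')
      have h3 := (h1.hasFDerivAt hyb).unique h2
      ext
      · simpa using hzero
      · have := DFunLike.congr_fun h3 ‹_›
        simpa using this
    set z := t.s (0, y) with hzdef
    have hzU : z ∈ t.U := t.s_mem _ hz
    have hzΦ : (f z, t.y z) = (0, y) := by rw [hzdef, t.f_s _ hz, t.y_s _ hz]
    have hzb := hbd y hy'
    refine C'.f_deriv z hzb ?_
    have hΦ : ContMDiffAt I 𝓘(ℝ, ℝ × t.F) ∞ (fun x => (f x, t.y x)) z :=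
      C.f_smooth.contMDiffAt.prodMk_space ((t.y_smooth z hzU).contMDiffAt (t.isOpen_U.mem_nhds hzU))
    have h1 : HasMFDerivAt I 𝓘(ℝ) (g ∘ fun x => (f x, t.y x)) z
        (G.comp (mfderiv I 𝓘(ℝ, ℝ × t.F) (fun x => (f x, t.y x)) z)) := by
      have h2 := (hΦ.mdifferentiableAt (by simp)).hasMFDerivAt.hasMFDerivWithinAt (s := t.U)
      have h3 : HasMFDerivWithinAt 𝓘(ℝ, ℝ × t.F) 𝓘(ℝ) g (halfBox t.F t.ε) (f z, t.y z) G := by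
        rw [hzΦ]
        exact hgd.hasMFDerivWithinAt
      exact (h3.comp z h2 fun x hx => t.mem_box x hx).hasMFDerivAt (t.isOpen_U.mem_nhds hzU)
    have h4 : (g ∘ fun x => (f x, t.y x)) =ᶠ[𝓝 z] f' := by
      filter_upwards [t.isOpen_U.mem_nhds hzU, C'.isOpen.mem_nhds (C'.bdry hzb)] with x hx hx'
      have h5 : t.s (f x, t.y x) ∈ D' := by
        rw [← C'.smul_mem_iff (a := t.θ x), t.smul_s x hx]
        exact hx'
      have h6 := C'.f_inv (t.θ x) _ h5
      rw [t.smul_s x hx] at h6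
      exact h6.symm
    have h5 := h1.congr_of_eventuallyEq h4.symm
    rw [h5.mfderiv, hG0]
    exact ContinuousLinearMap.zero_comp _

/-- Off `w = 0` the map `par` is smooth into the interior. At `w = 0` write `√f' = ‖w‖ √u`;
equivariance moves the phase of `w` from the point to the second argument of `K`, where it combines
with `‖w‖` to `√u w`, and both singular factors disappear. -/
theorem Tube.contDiffOn_cutFunction [FiniteDimensional ℝ E] (hA : IsFreeNearBoundary I A)
    (t : Tube I A.sm f D x₀) (C : CutDatum I A.sm f D) {h : CutSpace I A → ℝ}
    (hh : h ∈ cutFunctions I A) :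
    ContDiffOn ℝ ∞ (fun p => h (cutMk I A (t.par p))) (diskBox t.F t.ε) := by
  obtain ⟨f', hf', hint, V, hVd, hVo, hVb, hVi, K, hK, hKe, hKh⟩ :=
    (mem_cutFunctions_iff hA.boundary_subset).1 hh
  obtain ⟨D', -, C'⟩ := hf'.exists_cutDatum hA
  intro p hp
  refine ContDiffAt.contDiffWithinAt ?_
  by_cases h0 : p.1 = 0
  · obtain ⟨w, y⟩ := p
    obtain rfl : w = 0 := h0
    obtain ⟨u, hu, hug, hu0⟩ := t.exists_quotient C C'
    have hup := hu0 y hp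
    have hua : ContDiffAt ℝ ∞ u (0, y) := hu.contDiffAt ((isOpen_diskBox t.ε).mem_nhds hp)
    have hsa : ContMDiffAt 𝓘(ℝ, ℂ × t.F) I ∞ (fun p => t.s (sqNormFst p)) (0, y) :=
      (ContMDiffOn.comp (t := halfBox t.F t.ε) t.s_smooth
        contDiff_sqNormFst.contMDiff.contMDiffOn fun q hq => sqNormFst_mem.2 hq).contMDiffAt
        ((isOpen_diskBox t.ε).mem_nhds hp)
    have hsb : t.s (sqNormFst (0, y)) ∈ I.boundary M := by
      rw [← C.f_zero, t.f_s _ (sqNormFst_mem.2 hp)]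
      simp [sqNormFst]
    have hk : ContMDiffAt 𝓘(ℝ, ℂ × t.F) 𝓘(ℝ) ∞
        (fun p => K (t.s (sqNormFst p), (Real.sqrt (u p) : ℝ) • p.1)) (0, y) := by
      refine ContMDiffAt.comp (0, y) (g := K)
        (hK.contMDiffAt ((hVo.prod isOpen_univ).mem_nhds ⟨hVb hsb, mem_univ _⟩)) (hsa.prodMk ?_)
      exact ((hua.sqrt hup.ne').smul contDiffAt_fst).contMDiffAt
    rw [← contMDiffAt_iff_contDiffAt]
    refine hk.congr_of_eventuallyEq ?_
    filter_upwards [hsa.continuousAt.eventually (hVo.eventually_mem (hVb hsb)),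
      hsa.continuousAt.eventually (C'.isOpen.eventually_mem (C'.bdry hsb)),
      (isOpen_diskBox t.ε).mem_nhds hp, hua.continuousAt.eventually (lt_mem_nhds hup)]
      with q hq1 hq2 hq3 hq4
    have h2 : Real.sqrt (f' (t.par q)) = ‖q.1‖ * Real.sqrt (u q) := by
      rw [Tube.par, C'.f_inv _ _ hq2, hug q hq3, Real.sqrt_mul (by positivity),
        Real.sqrt_sq (norm_nonneg _)]
    have h3 : h (cutMk I A (t.par q)) = K (t.par q, ((Real.sqrt (f' (t.par q)) : ℝ) : ℂ)) :=
      hKh _ (hVi _ _ hq1)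
    rw [h3, h2, Tube.par, hKe _ _ hq1]
    congr 2
    rw [Complex.ofReal_mul, ← mul_assoc, mul_comm (unitPart q.1 : ℂ), norm_mul_unitPart,
      Complex.real_smul, mul_comm]
  · have h1 : ContMDiffAt 𝓘(ℝ, ℂ × t.F) I ∞ t.par p := (t.contMDiffOn_par C).contMDiffAt
      (((isOpen_diskBox t.ε).inter (isOpen_ne_fun continuous_fst continuous_const)).mem_nhds
        ⟨hp, h0⟩)
    have h2 : t.par p ∈ I.interior M := by
      rw [C.interior_iff, t.f_par C hp]
      have : 0 < ‖p.1‖ := norm_pos_iff.2 h0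
      positivity
    rw [← contMDiffAt_iff_contDiffAt]
    exact (hint.contMDiffAt (C.isOpen_interior.mem_nhds h2)).comp p h1

variable [IsManifold I ∞ M] [T2Space M] [FiniteDimensional ℝ E]

omit [IsManifold I ∞ M] in
theorem Tube.exists_functionChart (hA : IsFreeNearBoundary I A) (t : Tube I A.sm f D x₀)
    (C : CutDatum I A.sm f D) (hD : D ⊆ (A.dom : Set M)) :
    ∃ e : OpenPartialHomeomorph (CutSpace I A) E,
      IsFunctionChart (cutFunctionsWrt I A f) (cutFunctions I A) e ∧
      (∀ x ∈ t.U, cutMk I A x ∈ e.source) ∧ ∀ x ∈ t.U, e (cutMk I A x) = t.L (t.coord x) := by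
  obtain ⟨e, he1, he2, he3, he4⟩ := t.exists_chart C hD
  refine ⟨e, ⟨?_, ?_⟩, fun x hx => he1 ▸ mem_image_of_mem _ hx, he3⟩
  · rw [he1]
    rintro _ ⟨x, hx, rfl⟩ g hg
    obtain ⟨h, hh, B, hBo, hxB, hBi, hB⟩ := t.extend C hD hx (hg.comp t.L.contDiff)
    refine ⟨h, hh, ?_⟩
    have h1 : IsOpen (cutMk I A '' (B ∩ t.U)) := C.isOpen_image_cutMk hD (hBo.inter t.isOpen_U)
      fun x hx _ a => ⟨hBi a x hx.1, t.U_inv a x hx.2⟩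
    filter_upwards [h1.mem_nhds ⟨x, ⟨hxB, hx⟩, rfl⟩]
    rintro _ ⟨z, hz, rfl⟩
    rw [hB z hz.1, Function.comp_apply, Function.comp_apply, he3 z hz.2]
  · intro h hh
    have h1 := (t.contDiffOn_cutFunction hA C hh).comp t.L.symm.contDiff.contDiffOn
      (s := e.target) (by rw [he2]; exact fun v hv => hv)
    refine h1.congr fun v _ => ?_
    simp only [Function.comp_apply, he4]

theorem CutDatum.exists_interiorFunctionChart (C : CutDatum I A.sm f D)
    (hD : D ⊆ (A.dom : Set M)) {x₀ : M} (hx₀ : x₀ ∈ I.interior M) :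
    ∃ e : OpenPartialHomeomorph (CutSpace I A) E,
      IsFunctionChart (cutFunctionsWrt I A f) (cutFunctions I A) e ∧
      cutMk I A x₀ ∈ e.source ∧ ∀ᶠ x in 𝓝 x₀, e (cutMk I A x) = extChartAt I x₀ x := by
  obtain ⟨e, he1, he2, he3, he4⟩ := C.exists_interiorChart hD x₀
  have hx₀i : extChartAt I x₀ x₀ ∈ interior (range I) := hx₀
  refine ⟨e, ⟨?_, ?_⟩, ?_, ?_⟩
  · rw [he1]
    rintro _ ⟨x, ⟨hx1, hx2, hx3⟩, rfl⟩ g hg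
    have hk : ContMDiffOn I 𝓘(ℝ) ∞ (fun x => g (extChartAt I x₀ x)) (chartAt H x₀).source :=
      hg.contMDiff.comp_contMDiffOn contMDiffOn_extChartAt
    rw [extChartAt_source] at hx1
    obtain ⟨h, hh, hhe⟩ := C.extend_interior hD hx3 (chartAt H x₀).open_source hx1 hk
    refine ⟨h, hh, ?_⟩
    have h1 : ∀ᶠ z in 𝓝 x, extChartAt I x₀ z ∈ interior (range I) :=
      (continuousAt_extChartAt' (by rwa [extChartAt_source])).eventually
        (_root_.isOpen_interior.eventually_mem hx2)
    rw [Filter.EventuallyEq, ← C.map_nhds_interior hD hx3, Filter.eventually_map]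
    filter_upwards [hhe, h1, C.isOpen_interior.mem_nhds hx3,
      (chartAt H x₀).open_source.mem_nhds hx1] with z hz1 hz2 hz3 hz4
    rw [hz1, Function.comp_apply, he3 z (by rwa [extChartAt_source]) hz2 hz3]
  · rintro h ⟨f', hf', hint, -⟩
    have h1 : ContMDiffOn 𝓘(ℝ, E) 𝓘(ℝ) ∞
        (fun v => h (cutMk I A ((extChartAt I x₀).symm v))) e.target :=
      ContMDiffOn.comp (g := fun x => h (cutMk I A x)) hint
        ((contMDiffOn_extChartAt_symm x₀).mono fun v hv => (he2 v hv).1) fun v hv => (he2 v hv).2.2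
    refine h1.contDiffOn.congr fun v _ => ?_
    simp only [Function.comp_apply, he4]
  · rw [he1]
    exact ⟨x₀, ⟨mem_extChartAt_source x₀, hx₀i, hx₀⟩, rfl⟩
  · filter_upwards [extChartAt_source_mem_nhds (I := I) x₀,
      (continuousAt_extChartAt (I := I) x₀).eventually
        (_root_.isOpen_interior.eventually_mem hx₀i), C.isOpen_interior.mem_nhds hx₀]
      with x h1 h2 h3
    exact he3 x h1 h2 h3

end SmoothInCharts

/-! ### The manifold structure of the cut space -/

section CutManifold

variable {E H : Type*} [NormedAddCommGroup E] [NormedSpace ℝ E] [TopologicalSpace H]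
  {I : ModelWithCorners ℝ E H} {M : Type*} [TopologicalSpace M] [ChartedSpace H M]
  [IsManifold I ∞ M] [T2Space M]
  {A : LocalCircleAction M} {f : M → ℝ} {D : Set M}

/-- The piece to be glued at one boundary orbit: on the invariant set `W` of points whose whole
orbit maps into the region where `h = g`, the witness of `g` serves for `h`. The invariant bump
localises it. -/
theorem CutDatum.exists_local_extension (hI : IsHalfSpaceModel I) (C : CutDatum I A.sm f D)
    (hD : D ⊆ (A.dom : Set M)) {h g : CutSpace I A → ℝ} (hg : g ∈ cutFunctionsWrt I A f) {x : M}
    (hx : x ∈ I.boundary M) (hhg : h =ᶠ[𝓝 (cutMk I A x)] g) :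
    ∃ (b : M → ℝ) (B W : Set M) (K : M × ℂ → ℝ), ContMDiff I 𝓘(ℝ) ∞ b ∧ tsupport b ⊆ W ∧
      (∀ a x, b (A.sm a x) = b x) ∧ IsOpen B ∧ (∀ a, ∀ x ∈ B, A.sm a x ∈ B) ∧ x ∈ B ∧
      (∀ x ∈ B, b x = 1) ∧ IsOpen W ∧ W ⊆ D ∧
      ContMDiffOn (I.prod 𝓘(ℝ, ℂ)) 𝓘(ℝ) ∞ K (W ×ˢ univ) ∧
      (∀ (a : Circle), ∀ x ∈ W, ∀ z : ℂ, K (A.sm a x, z) = K (x, (a : ℂ) * z)) ∧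
      ∀ x ∈ W, h (cutMk I A x) = K (x, ((Real.sqrt (f x) : ℝ) : ℂ)) := by
  obtain ⟨-, V, hVd, hVo, hVb, hVi, K, hK, hKe, hKh⟩ := hg
  obtain ⟨O, hO, hOo, hxO⟩ := eventually_nhds_iff.1 hhg
  have := hI.1
  have hOo' := hOo.preimage (continuous_cutMk (I := I) (A := A))
  set W : Set M := {z | (z ∈ V ∧ z ∈ D) ∧ ∀ a, A.sm a z ∈ cutMk I A ⁻¹' O} with hW
  have hWo : IsOpen W := by
    rw [isOpen_iff_mem_nhds]
    rintro z ⟨⟨hzV, hzD⟩, hz⟩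
    filter_upwards [hVo.mem_nhds hzV, C.isOpen.mem_nhds hzD,
      C.eventually_forall_smul_mem hOo' hzD hz] with w h1 h2 h3
    exact ⟨⟨h1, h2⟩, h3⟩
  have hWi : ∀ a, ∀ z ∈ W, A.sm a z ∈ W := by
    rintro a z ⟨⟨hzV, hzD⟩, hz⟩
    exact ⟨⟨hVi a z hzV, C.maps a z hzD⟩, fun b => by rw [← C.mul]; exact hz _⟩
  have hxW : x ∈ W := ⟨⟨hVb hx, C.bdry hx⟩, fun a => by
    rw [mem_preimage, C.cutMk_smul hD a hx]; exact hxO⟩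
  obtain ⟨t⟩ := C.nonempty_tube hI hx
  have hxU : x ∈ t.U := by
    have := t.s_mem 0 (zero_mem_halfBox t.ε_pos)
    rwa [t.s_zero] at this
  obtain ⟨b, B, hb, hbW, hbi, hBo, hBi, hxB, hB1⟩ := t.exists_bump C hxU hWo hWi hxW
  refine ⟨b, B, W, K, hb, fun z hz => (hbW hz).2, hbi, hBo, hBi, hxB, hB1, hWo, fun z hz => hz.1.2,
    hK.mono (prod_mono (fun z hz => hz.1.1) subset_rfl), fun a z hz => hKe a z hz.1.1,
    fun z hz => ?_⟩
  have h1 := hz.2 1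
  rw [C.one] at h1
  rw [hO _ h1, hKh z hz.1.1]

/-- Telescoping. As soon as some `b j` with `j < n` equals `1` the sum is `1`, so bumps along a
countable cover give a partition of unity, still invariant when the bumps are. -/
theorem sum_mul_prod_one_sub (b : ℕ → ℝ) (n : ℕ) :
    ∑ i ∈ Finset.range n, b i * ∏ j ∈ Finset.range i, (1 - b j) =
      1 - ∏ j ∈ Finset.range n, (1 - b j) := by
  induction n with
  | zero => simp
  | succ n ih => rw [Finset.sum_range_succ, Finset.prod_range_succ, ih]; ring

/-- Membership in `cutFunctionsWrt` is a local condition. -/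
theorem CutDatum.mem_cutFunctionsWrt_of_locally [SecondCountableTopology M]
    (hI : IsHalfSpaceModel I) (C : CutDatum I A.sm f D) (hD : D ⊆ (A.dom : Set M))
    {h : CutSpace I A → ℝ} (hh : ∀ p, ∃ g ∈ cutFunctionsWrt I A f, h =ᶠ[𝓝 p] g) :
    h ∈ cutFunctionsWrt I A f := by
  have hint : ContMDiffOn I 𝓘(ℝ) ∞ (fun x => h (cutMk I A x)) (I.interior M) := by
    intro x hx
    obtain ⟨g, hg, hhg⟩ := hh (cutMk I A x)
    have h1 := hg.1.contMDiffAt (C.isOpen_interior.mem_nhds hx)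
    exact (h1.congr_of_eventuallyEq
      (continuous_cutMk.continuousAt.eventually hhg)).contMDiffWithinAt
  refine ⟨hint, ?_⟩
  -- Without boundary the empty neighbourhood satisfies the condition; otherwise the countable cover
  -- is nonempty and can be enumerated by `ℕ`.
  rcases (I.boundary M).eq_empty_or_nonempty with hempty | ⟨x₁, hx₁⟩
  · exact ⟨∅, empty_subset _, isOpen_empty, hempty.subset, by simp, fun _ => 0, contMDiffOn_const,
      by simp, by simp⟩
  choose g hg hhg using hh
  have key := fun x : I.boundary M =>
    C.exists_local_extension hI hD (hg (cutMk I A x)) x.2 (hhg (cutMk I A x))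
  choose b B W K hb hbW hbi hBo hBi hxB hB1 hWo hWD hK hKe hKh using key
  obtain ⟨T, hT, hTB⟩ := isOpen_iUnion_countable B hBo
  have hcov : ∀ x ∈ I.boundary M, ∃ i ∈ T, x ∈ B i := fun x hx => by
    have : x ∈ ⋃ i ∈ T, B i := hTB ▸ mem_iUnion.2 ⟨⟨x, hx⟩, hxB _⟩
    simpa using this
  have hTne : T.Nonempty := let ⟨i, hi, _⟩ := hcov x₁ hx₁; ⟨i, hi⟩
  obtain ⟨e, rfl⟩ := hT.exists_eq_range hTne
  set φ : ℕ → M → ℝ := fun n x => b (e n) x * ∏ j ∈ Finset.range n, (1 - b (e j) x) with hφ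
  have hφs : ∀ n, ContMDiff I 𝓘(ℝ) ∞ (φ n) := fun n =>
    (hb _).mul (contMDiff_finsetProd fun j _ => contMDiff_const.sub (hb _))
  have hφW : ∀ n, tsupport (φ n) ⊆ W (e n) := fun n =>
    (tsupport_mul_subset_left (f := b (e n))).trans (hbW _)
  have hφ0 : ∀ n x, x ∉ W (e n) → φ n x = 0 := fun n x hx => by
    by_contra hne
    exact hx (hφW n (subset_tsupport _ hne))
  have hφi : ∀ n a x, φ n (A.sm a x) = φ n x := fun n a x => by simp only [hφ, hbi]
  have hBW : ∀ n, B (e n) ⊆ W (e n) := fun n x hx =>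
    hbW _ (subset_tsupport _ (by rw [Function.mem_support, hB1 _ x hx]; exact one_ne_zero))
  -- On `B (e n)` the factor `1 - b (e n)` kills every term with index greater than `n`; the term
  -- `n` itself survives, hence `n + 1`. The infinite sums below are therefore locally finite.
  have hφB : ∀ n, ∀ x ∈ B (e n), ∀ m ∉ Finset.range (n + 1), φ m x = 0 := fun n x hx m hm => by
    refine mul_eq_zero_of_right _ (Finset.prod_eq_zero (i := n) ?_ ?_)
    · rw [Finset.mem_range] at hm ⊢; omega
    · rw [hB1 _ x hx, sub_self]
  have hsum : ∀ n, ∀ x ∈ B (e n), ∑ m ∈ Finset.range (n + 1), φ m x = 1 := fun n x hx => by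
    have h1 := sum_mul_prod_one_sub (fun j => b (e j) x) (n + 1)
    rw [Finset.prod_eq_zero (i := n) (Finset.self_mem_range_succ n) (by
      rw [hB1 _ x hx, sub_self]), sub_zero] at h1
    exact h1
  have hts : ∀ n, ∀ x ∈ B (e n), ∀ z, ∑' m, φ m x * K (e m) (x, z) =
      ∑ m ∈ Finset.range (n + 1), φ m x * K (e m) (x, z) := fun n x hx z =>
    tsum_eq_sum fun m hm => by rw [hφB n x hx m hm, zero_mul]
  have hP : ∀ n, ContMDiff (I.prod 𝓘(ℝ, ℂ)) 𝓘(ℝ) ∞ fun p : M × ℂ => φ n p.1 * K (e n) p := by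
    intro n
    refine contMDiff_of_tsupport fun p hp => ?_
    have hpW : p.1 ∈ W (e n) := by
      have h1 : tsupport (fun p : M × ℂ => φ n p.1 * K (e n) p) ⊆ Prod.fst ⁻¹' tsupport (φ n) := by
        refine closure_minimal (fun p hp => ?_) ((isClosed_tsupport _).preimage continuous_fst)
        refine subset_tsupport _ fun h0 => hp ?_
        simp only [h0, zero_mul]
      exact hφW n (h1 hp)
    exact ((hφs n).contMDiffAt.comp p contMDiffAt_fst).mul
      ((hK (e n)).contMDiffAt (((hWo _).prod isOpen_univ).mem_nhds ⟨hpW, mem_univ _⟩))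
  refine ⟨⋃ n, B (e n), ?_, isOpen_iUnion fun n => hBo _, ?_, ?_,
    fun p => ∑' n, φ n p.1 * K (e n) p, ?_, ?_, ?_⟩
  · exact iUnion_subset fun n x hx => hD (hWD _ (hBW n hx))
  · intro x hx
    obtain ⟨_, ⟨n, rfl⟩, hn⟩ := hcov x hx
    exact mem_iUnion.2 ⟨n, hn⟩
  · intro a x hx
    obtain ⟨n, hn⟩ := mem_iUnion.1 hx
    exact mem_iUnion.2 ⟨n, hBi _ a x hn⟩
  · rintro ⟨x, z⟩ ⟨hx, -⟩
    obtain ⟨n, hn⟩ := mem_iUnion.1 hx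
    have h1 : ContMDiff (I.prod 𝓘(ℝ, ℂ)) 𝓘(ℝ) ∞
        fun p : M × ℂ => ∑ m ∈ Finset.range (n + 1), φ m p.1 * K (e m) p :=
      contMDiff_finsetSum fun m _ => hP m
    refine ((h1 (x, z)).congr_of_eventuallyEq ?_).contMDiffWithinAt
    filter_upwards [((hBo (e n)).preimage continuous_fst).mem_nhds
      (show (x, z) ∈ Prod.fst ⁻¹' B (e n) from hn)] with p hp
    exact hts n p.1 hp p.2
  · intro a x _ z
    refine tsum_congr fun n => ?_
    simp only [hφi]
    by_cases hxW : x ∈ W (e n)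
    · rw [hKe _ a x hxW]
    · rw [hφ0 n x hxW, zero_mul, zero_mul]
  · intro x hx
    obtain ⟨n, hn⟩ := mem_iUnion.1 hx
    have h1 : ∀ m ∈ Finset.range (n + 1), φ m x * K (e m) (x, ((Real.sqrt (f x) : ℝ) : ℂ)) =
        φ m x * h (cutMk I A x) := fun m _ => by
      by_cases hxW : x ∈ W (e m)
      · rw [hKh _ x hxW]
      · rw [hφ0 m x hxW, zero_mul, zero_mul]
    refine Eq.trans ?_ (hts n x hn _).symm
    rw [Finset.sum_congr rfl h1, ← Finset.sum_mul, hsum n x hn, one_mul]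

omit [IsManifold I ∞ M] [T2Space M] in
theorem cutFunctionsWrt_subset (hA : IsFreeNearBoundary I A) (hf : IsInvariantBDF I A f) :
    cutFunctionsWrt I A f ⊆ cutFunctions I A := fun _ hh =>
  (mem_cutFunctions_iff hA.boundary_subset).2 ⟨f, hf, hh⟩

/-- The cut space is a manifold, and its smooth functions can be computed with respect to any
invariant boundary defining function. -/
theorem cutFunctions_subset_and_nonempty [SecondCountableTopology M] (hI : IsHalfSpaceModel I)
    (hA : IsFreeNearBoundary I A) (hf : IsInvariantBDF I A f) :
    cutFunctions I A ⊆ cutFunctionsWrt I A f ∧ Nonempty (CutManifold I A) := by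
  have := hI.1
  obtain ⟨D, hD, C⟩ := hf.exists_cutDatum hA
  have hcover : ∀ p : CutSpace I A, ∃ e : OpenPartialHomeomorph (CutSpace I A) E,
      IsFunctionChart (cutFunctionsWrt I A f) (cutFunctions I A) e ∧ p ∈ e.source := by
    intro p
    obtain ⟨x, rfl⟩ := surjective_cutMk p
    by_cases hx : x ∈ I.boundary M
    · obtain ⟨t⟩ := C.nonempty_tube hI hx
      have hxU : x ∈ t.U := by
        have := t.s_mem 0 (zero_mem_halfBox t.ε_pos)
        rwa [t.s_zero] at this
      obtain ⟨e, he, hes, -⟩ := t.exists_functionChart hA C hD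
      exact ⟨e, he, hes x hxU⟩
    · obtain ⟨e, he, hes, -⟩ := C.exists_interiorFunctionChart hD (x₀ := x)
        (I.compl_boundary (M := M) ▸ hx)
      exact ⟨e, he, hes⟩
  have : LocallyCompactSpace M := Manifold.locallyCompact_of_finiteDimensional I
  have : SigmaCompactSpace (CutSpace I A) := sigmaCompactSpace_cutSpace
  have : T2Space (CutSpace I A) := C.t2Space hD
  have : SecondCountableTopology (CutSpace I A) :=
    secondCountable_of_charts (E := E) fun p => let ⟨e, _, he⟩ := hcover p; ⟨e, he⟩
  exact nonempty_manifoldStructure (cutFunctionsWrt_subset hA hf) hcover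
    fun h hh => C.mem_cutFunctionsWrt_of_locally hI hD hh

end CutManifold

/-! ### The map induced by an equivariant transverse map -/

section CutMap

variable {E H E' H' : Type*} [NormedAddCommGroup E] [NormedSpace ℝ E] [TopologicalSpace H]
  [NormedAddCommGroup E'] [NormedSpace ℝ E'] [TopologicalSpace H']
  {I : ModelWithCorners ℝ E H} {I' : ModelWithCorners ℝ E' H'}
  {M N : Type*} [TopologicalSpace M] [ChartedSpace H M] [TopologicalSpace N] [ChartedSpace H' N]
  {A : LocalCircleAction M} {B : LocalCircleAction N} {ψ : M → N} {f : N → ℝ}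
  {D : Set M} {D' : Set N}

theorem CutDatum.mono {σ : Circle → M → M} {f : M → ℝ} {D₁ : Set M} (C : CutDatum I σ f D)
    (hD₁ : D₁ ⊆ D) (ho : IsOpen D₁) (hb : I.boundary M ⊆ D₁) (hm : ∀ a, ∀ x ∈ D₁, σ a x ∈ D₁) :
    CutDatum I σ f D₁ where
  one := C.one
  mul := C.mul
  isOpen := ho
  bdry := hb
  maps := hm
  smoothOn := C.smoothOn.mono (prod_mono subset_rfl hD₁)
  free a x hx := C.free a x (hD₁ hx)
  f_smooth := C.f_smooth
  f_nonneg := C.f_nonneg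
  f_zero := C.f_zero
  f_deriv := C.f_deriv
  f_inv a x hx := C.f_inv a x (hD₁ hx)

/-- A map `ψ` that is equivariant on `D` and compatible with the boundary defining
functions. -/
structure TransverseDatum (I : ModelWithCorners ℝ E H) (I' : ModelWithCorners ℝ E' H')
    (A : LocalCircleAction M) (B : LocalCircleAction N) (ψ : M → N) (f : N → ℝ) (D : Set M)
    (D' : Set N) : Prop where
  smooth : ContMDiff I I' ∞ ψ
  source : CutDatum I A.sm (f ∘ ψ) D
  source_subset : D ⊆ (A.dom : Set M)
  target : CutDatum I' B.sm f D'
  target_subset : D' ⊆ (B.dom : Set N)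
  equivariant : ∀ a, ∀ x ∈ D, ψ (A.sm a x) = B.sm a (ψ x)

theorem IsEquivariantTransverse.exists_datum (hψ : IsEquivariantTransverse I I' A B ψ)
    (hA : IsFreeNearBoundary I A) (hB : IsFreeNearBoundary I' B) :
    ∃ f D D', IsInvariantBDF I' B f ∧ IsInvariantBDF I A (f ∘ ψ) ∧
      TransverseDatum I I' A B ψ f D D' := by
  obtain ⟨f, hf, hfψ⟩ := hψ.transverse
  obtain ⟨V, hV, hVe⟩ := hψ.equivariant
  obtain ⟨D, hD, C⟩ := hfψ.exists_cutDatum hA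
  obtain ⟨D', hD', C'⟩ := hf.exists_cutDatum hB
  obtain ⟨h1, h2, h3⟩ := hV.image hA.boundary_subset
  have heq : ∀ a, ∀ x ∈ Subtype.val '' V, ψ (A.sm a x) = B.sm a (ψ x) := by
    rintro a _ ⟨x, hx, rfl⟩
    obtain ⟨hx', he⟩ := hVe x hx
    rw [A.sm_coe, he a, B.sm_of_mem a hx']
  refine ⟨f, D ∩ Subtype.val '' V, D', hf, hfψ, hψ.smooth,
    C.mono inter_subset_left (C.isOpen.inter h1) (fun x hx => ⟨C.bdry hx, h2 hx⟩)
      fun a x hx => ⟨C.maps a x hx.1, h3 a x hx.2⟩,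
    fun x hx => hD hx.1, C', hD', fun a x hx => heq a x hx.2⟩

theorem continuous_cutMap (hψ : IsEquivariantTransverse I I' A B ψ) : Continuous (cutMap hψ) :=
  continuous_coinduced_dom.2 (continuous_cutMk.comp hψ.smooth.continuous)

namespace TransverseDatum

variable (Q : TransverseDatum I I' A B ψ f D D')
include Q

theorem boundary_iff {x : M} : ψ x ∈ I'.boundary N ↔ x ∈ I.boundary M := by
  rw [← Q.target.f_zero, ← Q.source.f_zero, Function.comp_apply]

theorem interior_iff {x : M} : ψ x ∈ I'.interior N ↔ x ∈ I.interior M := by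
  rw [Q.target.interior_iff, Q.source.interior_iff, Function.comp_apply]

/-- If `K` witnesses `h` with respect to `f`, then `(x, z) ↦ K(ψ(x), z)` witnesses the pullback with
respect to `f ∘ ψ`; no square root has to be transformed. -/
theorem comp_cutMap_mem (hψ : IsEquivariantTransverse I I' A B ψ) {h : CutSpace I' B → ℝ}
    (hh : h ∈ cutFunctionsWrt I' B f) : h ∘ cutMap hψ ∈ cutFunctionsWrt I A (f ∘ ψ) := by
  obtain ⟨hint, V, hVd, hVo, hVb, hVi, K, hK, hKe, hKh⟩ := hh
  refine ⟨?_, D ∩ ψ ⁻¹' V, fun x hx => Q.source_subset hx.1,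
    Q.source.isOpen.inter (hVo.preimage Q.smooth.continuous),
    fun x hx => ⟨Q.source.bdry hx, hVb (Q.boundary_iff.2 hx)⟩, ?_, fun p => K (ψ p.1, p.2),
    ?_, ?_, ?_⟩
  · exact ContMDiffOn.comp (g := fun x => h (cutMk I' B x)) hint Q.smooth.contMDiffOn
      fun x hx => Q.interior_iff.2 hx
  · rintro a x ⟨hx, hxV⟩
    refine ⟨Q.source.maps a x hx, ?_⟩
    rw [mem_preimage, Q.equivariant a x hx]
    exact hVi a _ hxV
  · exact hK.comp ((Q.smooth.comp contMDiff_fst).prodMk contMDiff_snd).contMDiffOn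
      fun p hp => ⟨hp.1.2, mem_univ _⟩
  · rintro a x ⟨hx, hxV⟩ z
    simp only [Q.equivariant a x hx]
    exact hKe a _ hxV z
  · rintro x ⟨hx, hxV⟩
    exact hKh _ hxV

theorem injective_cutMap (hψ : IsEquivariantTransverse I I' A B ψ) (hi : Function.Injective ψ) :
    Function.Injective (cutMap hψ) := by
  intro p q hpq
  obtain ⟨x, rfl⟩ := surjective_cutMk p
  obtain ⟨y, rfl⟩ := surjective_cutMk q
  rw [cutMap_cutMk, cutMap_cutMk] at hpq
  rcases (Q.target.cutMk_eq_iff Q.target_subset).1 hpq with h | ⟨hb, a, ha⟩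
  · rw [hi h]
  · have hb' := Q.boundary_iff.1 hb
    rw [← Q.equivariant a x (Q.source.bdry hb')] at ha
    rw [← hi ha, Q.source.cutMk_smul Q.source_subset a hb']

/-- An open set of `M_cut` lifts to `M` and is cut out there by an open `G` of `N`. The saturated
part of `G` has open image in `N_cut`; it still contains the image of the given point by
equivariance. -/
theorem isEmbedding_cutMap (hψ : IsEquivariantTransverse I I' A B ψ) (he : IsEmbedding ψ) :
    IsEmbedding (cutMap hψ) := by
  refine ⟨isInducing_iff_nhds.2 fun p => le_antisymm
    (continuous_cutMap hψ).continuousAt.le_comap fun S hS => ?_, Q.injective_cutMap hψ he.injective⟩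
  obtain ⟨x, rfl⟩ := surjective_cutMk p
  obtain ⟨O, hOS, hO, hxO⟩ := mem_nhds_iff.1 hS
  obtain ⟨G, hG, hGO⟩ := he.isInducing.isOpen_iff.1
    (hO.preimage (continuous_cutMk (I := I) (A := A)))
  have hmem : ∀ y, ψ y ∈ G ↔ cutMk I A y ∈ O := fun y => by
    rw [← mem_preimage, hGO, mem_preimage]
  refine Filter.mem_comap.2 ⟨_, (Q.target.isOpen_image_saturatedPart Q.target_subset hG).mem_nhds
    ⟨ψ x, ⟨(hmem x).2 hxO, fun hb a => ?_⟩, rfl⟩, ?_⟩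
  · have hb' := Q.boundary_iff.1 hb
    rw [← Q.equivariant a x (Q.source.bdry hb'), hmem, Q.source.cutMk_smul Q.source_subset a hb']
    exact hxO
  · intro q hq
    obtain ⟨y, rfl⟩ := surjective_cutMk q
    have h1 : ψ y ∈ cutMk I' B ⁻¹' (cutMk I' B '' saturatedPart I' B G) := hq
    rw [Q.target.preimage_image_cutMk Q.target_subset Q.target.saturatedPart_smul] at h1
    exact hOS ((hmem y).1 h1.1)

end TransverseDatum

end CutMap

/-! ### The differential of the induced map -/

section Differential

variable {E H E' H' : Type*} [NormedAddCommGroup E] [NormedSpace ℝ E] [TopologicalSpace H]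
  [NormedAddCommGroup E'] [NormedSpace ℝ E'] [TopologicalSpace H']
  {I : ModelWithCorners ℝ E H} {I' : ModelWithCorners ℝ E' H'}
  {M N : Type*} [TopologicalSpace M] [ChartedSpace H M] [TopologicalSpace N] [ChartedSpace H' N]
  {A : LocalCircleAction M} {B : LocalCircleAction N} {ψ : M → N} {f : N → ℝ}
  {D : Set M} {D' : Set N}

theorem HasMFDerivAt.clm_comp {V W : Type*} [NormedAddCommGroup V] [NormedSpace ℝ V]
    [NormedAddCommGroup W] [NormedSpace ℝ W] {G : M → V} {G' : E →L[ℝ] V} {x : M}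
    (h : HasMFDerivAt I 𝓘(ℝ, V) G x G') (ℓ : V →L[ℝ] W) :
    HasMFDerivAt I 𝓘(ℝ, W) (fun x => ℓ (G x)) x (ℓ.comp G') :=
  HasMFDerivAt.comp x (g := ℓ) ℓ.hasMFDerivAt h

/-- The linear algebra relating the differentials of `ψ` and of `ψ_cut`. -/
theorem injective_surjective_transfer {F F' : Type*} [AddCommGroup F] [Module ℝ F]
    [AddCommGroup F'] [Module ℝ F'] (P : ℝ × (ℝ × F) →ₗ[ℝ] ℝ × (ℝ × F')) (G : ℝ × F →ₗ[ℝ] F')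
    (h1 : ∀ v, (P v).2.1 = v.2.1) (h2 : ∀ v, (P v).2.2 = G v.2) :
    (Function.Injective P → Function.Injective fun v : F => G (0, v)) ∧
    (Function.Surjective P → Function.Surjective fun v : F => G (0, v)) := by
  constructor
  · intro hP
    have hP0 : ∀ v, P v = 0 → v = 0 := fun v hv => hP (by rw [hv, map_zero])
    have hker : ∀ v : F, G (0, v) = 0 → v = 0 := by
      intro v hv
      set c := (P (1, (0, 0))).1 with hc
      have hc0 : c ≠ 0 := fun h => by
        have := hP0 (1, (0, 0)) (Prod.ext h (Prod.ext (h1 _) (by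
          rw [h2]; exact map_zero G)))
        simp at this
      set d := (P (0, (0, v))).1 with hd
      -- `P` maps the angular axis to itself with factor `c ≠ 0`. The combination cancels the
      -- angular component of the image of `(0, 0, v)`, whose other components vanish already.
      have h3 : P (c • ((0 : ℝ), ((0 : ℝ), v)) - d • ((1 : ℝ), ((0 : ℝ), (0 : F)))) = 0 := by
        refine Prod.ext ?_ (Prod.ext ?_ ?_)
        · rw [map_sub, map_smul, map_smul, Prod.fst_sub, Prod.smul_fst, Prod.smul_fst, ← hc, ← hd]
          simp [mul_comm]
        · rw [h1]; simp
        · rw [h2]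
          have : (c • ((0 : ℝ), ((0 : ℝ), v)) - d • ((1 : ℝ), ((0 : ℝ), (0 : F)))).2 =
              c • ((0 : ℝ), v) := by simp
          rw [this, map_smul, hv, smul_zero]
          rfl
      have h4 := congrArg (fun w => w.2.2) (hP0 _ h3)
      simpa [hc0] using h4
    intro v w hvw
    rw [← sub_eq_zero]
    refine hker _ ?_
    have : ((0 : ℝ), v - w) = (0, v) - (0, w) := by simp
    rw [this, map_sub, sub_eq_zero]
    exact hvw
  · intro hP w
    obtain ⟨⟨u, a, v⟩, hv⟩ := hP (0, (0, w))
    have h3 := h1 (u, (a, v))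
    have h4 := h2 (u, (a, v))
    rw [hv] at h3 h4
    obtain rfl : (0 : ℝ) = a := h3
    exact ⟨v, h4.symm⟩

/-- The derivative at the origin of `(w, y) ↦ (w α(‖w‖ ^ 2, y), η(‖w‖ ^ 2, y))`. -/
theorem hasFDerivAt_twist {F F' : Type*} [NormedAddCommGroup F] [NormedSpace ℝ F]
    [NormedAddCommGroup F'] [NormedSpace ℝ F'] {ε : ℝ} (hε : 0 < ε) {α : ℝ × F → ℂ}
    {η : ℝ × F → F'} {α' : ℝ × F →L[ℝ] ℂ} {η' : ℝ × F →L[ℝ] F'}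
    (hα : HasFDerivWithinAt α α' (halfBox F ε) 0) (hη : HasFDerivWithinAt η η' (halfBox F ε) 0) :
    ∃ S : ℂ × F →L[ℝ] ℂ × F', (∀ p, S p = (α 0 * p.1, η' (0, p.2))) ∧
      HasFDerivAt (fun p : ℂ × F => (p.1 * α (sqNormFst p), η (sqNormFst p))) S 0 := by
  have h0 : sqNormFst (0 : ℂ × F) = 0 := by simp [sqNormFst]
  have hbox : diskBox F ε ∈ 𝓝 (0 : ℂ × F) := (isOpen_diskBox ε).mem_nhds (by simp [mem_diskBox, hε])
  -- `‖w‖²` has zero derivative at the origin, so the composites only see the direction `(0, y)`,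
  -- and the factor `w` leaves `α(0)` as the only contribution of `α`.
  have hsq : HasFDerivAt (sqNormFst : ℂ × F → ℝ × F)
      ((0 : ℂ × F →L[ℝ] ℝ).prod (ContinuousLinearMap.snd ℝ ℂ F)) 0 := by
    have h1 : HasFDerivAt (fun p : ℂ × F => ‖p.1‖ ^ 2) (0 : ℂ × F →L[ℝ] ℝ) 0 := by
      have := (hasFDerivAt_fst (𝕜 := ℝ) (p := (0 : ℂ × F))).norm_sq
      refine this.congr_fderiv ?_
      ext <;> simp
    exact h1.prodMk hasFDerivAt_snd
  have hα1 := (HasFDerivWithinAt.comp (t := halfBox F ε) (s := diskBox F ε) (0 : ℂ × F)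
    (g := α) (by rwa [h0]) hsq.hasFDerivWithinAt fun p hp => sqNormFst_mem.2 hp).hasFDerivAt hbox
  have hη1 := (HasFDerivWithinAt.comp (t := halfBox F ε) (s := diskBox F ε) (0 : ℂ × F)
    (g := η) (by rwa [h0]) hsq.hasFDerivWithinAt fun p hp => sqNormFst_mem.2 hp).hasFDerivAt hbox
  refine ⟨_, ?_, ((hasFDerivAt_fst (𝕜 := ℝ) (p := (0 : ℂ × F))).mul hα1).prodMk hη1⟩
  rintro ⟨w, y⟩
  simp [h0]

namespace TransverseDatum

variable (Q : TransverseDatum I I' A B ψ f D D')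
include Q

/-- The differential of `ψ` at a boundary point, in tubes. -/
theorem transfer_tube {x₀ : M} (t : Tube I A.sm (f ∘ ψ) D x₀)
    (t' : Tube I' B.sm f D' (ψ x₀)) {η' : ℝ × t.F →L[ℝ] t'.F}
    (hη : HasFDerivWithinAt (fun q => t'.y (ψ (t.s q))) η' (halfBox t.F t.ε) 0) :
    (Function.Injective (mfderiv I I' ψ x₀) → Function.Injective fun v : t.F => η' (0, v)) ∧
    (Function.Surjective (mfderiv I I' ψ x₀) → Function.Surjective fun v : t.F => η' (0, v)) := by
  have hxU : x₀ ∈ t.U := by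
    have := t.s_mem 0 (zero_mem_halfBox t.ε_pos)
    rwa [t.s_zero] at this
  have hψU : ψ x₀ ∈ t'.U := by
    have := t'.s_mem 0 (zero_mem_halfBox t'.ε_pos)
    rwa [t'.s_zero] at this
  obtain ⟨R, hR, hRi, hRs⟩ : ∃ R : E →L[ℝ] E', HasMFDerivAt I I' ψ x₀ R ∧
      (Function.Injective (mfderiv I I' ψ x₀) → Function.Injective R) ∧
      (Function.Surjective (mfderiv I I' ψ x₀) → Function.Surjective R) :=
    ⟨mfderiv I I' ψ x₀, ((Q.smooth x₀).mdifferentiableAt (by simp)).hasMFDerivAt, id, id⟩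
  have h1 : HasMFDerivAt I 𝓘(ℝ, ℝ × (ℝ × t'.F)) (fun x => (t'.τ (ψ x), (f (ψ x), t'.y (ψ x)))) x₀
      ((t'.T : E' →L[ℝ] ℝ × (ℝ × t'.F)).comp R) :=
    HasMFDerivAt.comp x₀ (g := fun x => (t'.τ x, (f x, t'.y x))) t'.hasMFDerivAt hR
  have hf1 := HasMFDerivAt.clm_comp h1
    ((ContinuousLinearMap.fst ℝ ℝ t'.F).comp (ContinuousLinearMap.snd ℝ ℝ (ℝ × t'.F)))
  have hf2 := HasMFDerivAt.clm_comp t.hasMFDerivAt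
    ((ContinuousLinearMap.fst ℝ ℝ t.F).comp (ContinuousLinearMap.snd ℝ ℝ (ℝ × t.F)))
  have hy1 := HasMFDerivAt.clm_comp h1
    ((ContinuousLinearMap.snd ℝ ℝ t'.F).comp (ContinuousLinearMap.snd ℝ ℝ (ℝ × t'.F)))
  have hfy := HasMFDerivAt.clm_comp t.hasMFDerivAt (ContinuousLinearMap.snd ℝ ℝ (ℝ × t.F))
  have hz : ((f ∘ ψ) x₀, t.y x₀) = (0 : ℝ × t.F) := by
    have h2 := t.f_s 0 (zero_mem_halfBox t.ε_pos)
    have h3 := t.y_s 0 (zero_mem_halfBox t.ε_pos)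
    rw [t.s_zero] at h2 h3
    exact Prod.ext h2 h3
  have hy2 : HasMFDerivAt I 𝓘(ℝ, t'.F)
      ((fun q => t'.y (ψ (t.s q))) ∘ fun x => ((f ∘ ψ) x, t.y x)) x₀
      (η'.comp ((ContinuousLinearMap.snd ℝ ℝ (ℝ × t.F)).comp
        (t.T : E →L[ℝ] ℝ × (ℝ × t.F)))) := by
    have h3 : HasMFDerivWithinAt 𝓘(ℝ, ℝ × t.F) 𝓘(ℝ, t'.F) (fun q => t'.y (ψ (t.s q)))
        (halfBox t.F t.ε) ((f ∘ ψ) x₀, t.y x₀) η' := by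
      rw [hz]
      exact hη.hasMFDerivWithinAt
    exact (h3.comp x₀ (hfy.hasMFDerivWithinAt (s := t.U)) fun x hx => t.mem_box x hx).hasMFDerivAt
      (t.isOpen_U.mem_nhds hxU)
  -- The `y`-coordinate of the target is invariant and `ψ` is equivariant, so it may be evaluated at
  -- the slice point of the orbit. Thus it depends on `(f, y)` only, not on the angle.
  have hyy : ((fun q => t'.y (ψ (t.s q))) ∘ fun x => ((f ∘ ψ) x, t.y x)) =ᶠ[𝓝 x₀]
      fun x => t'.y (ψ x) := by
    filter_upwards [t.isOpen_U.mem_nhds hxU,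
      Q.smooth.continuous.continuousAt.eventually (t'.isOpen_U.eventually_mem hψU)] with x hx hx'
    have hs := t.U_subset (t.s_mem _ (t.mem_box x hx))
    have h5 := Q.equivariant (t.θ x) _ hs
    rw [t.smul_s x hx] at h5
    have h6 : ψ (t.s ((f ∘ ψ) x, t.y x)) ∈ t'.U := by
      have := t'.U_inv (t.θ x)⁻¹ _ hx'
      rwa [h5, Q.target.inv_smul] at this
    have h7 := t'.y_smul (t.θ x) _ h6
    rw [← h5] at h7
    exact h7.symm
  have e1 := hasMFDerivAt_unique hf1 hf2
  have e2 := hasMFDerivAt_unique hy1 (hy2.congr_of_eventuallyEq hyy.symm)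
  have key := injective_surjective_transfer
    ((t'.T : E' →ₗ[ℝ] ℝ × (ℝ × t'.F)).comp ((R : E →ₗ[ℝ] E').comp
      (t.T.symm : ℝ × (ℝ × t.F) →ₗ[ℝ] E))) (η' : ℝ × t.F →ₗ[ℝ] t'.F) (fun v => by
        have h : (t'.T (R (t.T.symm v))).2.1 = (t.T (t.T.symm v)).2.1 :=
          DFunLike.congr_fun e1 (t.T.symm v)
        rwa [t.T.apply_symm_apply] at h) (fun v => by
        have h : (t'.T (R (t.T.symm v))).2.2 = η' (t.T (t.T.symm v)).2 :=
          DFunLike.congr_fun e2 (t.T.symm v)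
        rwa [t.T.apply_symm_apply] at h)
  constructor
  · intro h
    exact key.1 (t'.T.injective.comp ((hRi h).comp t.T.symm.injective))
  · intro h
    exact key.2 (t'.T.surjective.comp ((hRs h).comp t.T.symm.surjective))

variable [IsManifold I ∞ M] [T2Space M] [FiniteDimensional ℝ E]
  [IsManifold I' ∞ N] [T2Space N] [FiniteDimensional ℝ E']

/-- In suitable charts, the differential of `ψ_cut` is injective or surjective if that of `ψ`
is. -/
theorem exists_charts_interior (hψ : IsEquivariantTransverse I I' A B ψ) {x : M}
    (hx : x ∈ I.interior M) :
    ∃ (e : OpenPartialHomeomorph (CutSpace I A) E) (e' : OpenPartialHomeomorph (CutSpace I' B) E')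
      (T : E → E') (T' : E →L[ℝ] E'),
      IsFunctionChart (cutFunctionsWrt I A (f ∘ ψ)) (cutFunctions I A) e ∧
      IsFunctionChart (cutFunctionsWrt I' B f) (cutFunctions I' B) e' ∧
      cutMk I A x ∈ e.source ∧ cutMk I' B (ψ x) ∈ e'.source ∧
      HasFDerivAt T T' (e (cutMk I A x)) ∧
      (∀ᶠ q in 𝓝 (cutMk I A x), e' (cutMap hψ q) = T (e q)) ∧
      (Function.Injective (mfderiv I I' ψ x) → Function.Injective T') ∧
      (Function.Surjective (mfderiv I I' ψ x) → Function.Surjective T') := by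
  obtain ⟨e, he, hes, hee⟩ := Q.source.exists_interiorFunctionChart Q.source_subset hx
  obtain ⟨e', he', hes', hee'⟩ := Q.target.exists_interiorFunctionChart Q.target_subset
    (Q.interior_iff.2 hx)
  refine ⟨e, e', writtenInExtChartAt I I' x ψ, mfderiv I I' ψ x, he, he', hes, hes', ?_, ?_,
    id, id⟩
  · rw [hee.self_of_nhds]
    have h1 := ((Q.smooth x).mdifferentiableAt (by simp)).hasMFDerivAt.2
    exact h1.hasFDerivAt (mem_interior_iff_mem_nhds.1 hx)
  · rw [← Q.source.map_nhds_interior Q.source_subset hx, Filter.eventually_map]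
    filter_upwards [hee, Q.smooth.continuous.continuousAt.eventually hee',
      extChartAt_source_mem_nhds (I := I) x] with z hz hz' hz''
    rw [cutMap_cutMk, hz', hz, writtenInExtChartAt, Function.comp_apply, Function.comp_apply,
      (extChartAt I x).left_inv hz'']

/-- By equivariance `ψ_cut` is determined by `ψ` on the slice: in tube charts it is `(w, y) ↦ (w
α(‖w‖², y), η(‖w‖², y))`, where `α` and `η` are the angle and the `y`-coordinate of `ψ ∘ s`. The
tubes are centred at `x` and `ψ x`, so its differential is needed only at the origin, where it is
block diagonal with the unit complex number `α(0)` as one block. -/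
theorem exists_charts_boundary (hI : IsHalfSpaceModel I) (hI' : IsHalfSpaceModel I')
    (hA : IsFreeNearBoundary I A) (hB : IsFreeNearBoundary I' B)
    (hψ : IsEquivariantTransverse I I' A B ψ) {x : M} (hx : x ∈ I.boundary M) :
    ∃ (e : OpenPartialHomeomorph (CutSpace I A) E) (e' : OpenPartialHomeomorph (CutSpace I' B) E')
      (T : E → E') (T' : E →L[ℝ] E'),
      IsFunctionChart (cutFunctionsWrt I A (f ∘ ψ)) (cutFunctions I A) e ∧
      IsFunctionChart (cutFunctionsWrt I' B f) (cutFunctions I' B) e' ∧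
      cutMk I A x ∈ e.source ∧ cutMk I' B (ψ x) ∈ e'.source ∧
      HasFDerivAt T T' (e (cutMk I A x)) ∧
      (∀ᶠ q in 𝓝 (cutMk I A x), e' (cutMap hψ q) = T (e q)) ∧
      (Function.Injective (mfderiv I I' ψ x) → Function.Injective T') ∧
      (Function.Surjective (mfderiv I I' ψ x) → Function.Surjective T') := by
  obtain ⟨t⟩ := Q.source.nonempty_tube hI hx
  obtain ⟨t'⟩ := Q.target.nonempty_tube hI' (Q.boundary_iff.2 hx)
  have h0 := zero_mem_halfBox (F := t.F) t.ε_pos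
  have h0' := zero_mem_halfBox (F := t'.F) t'.ε_pos
  have hxU : x ∈ t.U := by
    have := t.s_mem 0 h0
    rwa [t.s_zero] at this
  have hψU : ψ x ∈ t'.U := by
    have := t'.s_mem 0 h0'
    rwa [t'.s_zero] at this
  obtain ⟨e, he, hes, hee⟩ := t.exists_functionChart hA Q.source Q.source_subset
  obtain ⟨e', he', hes', hee'⟩ := t'.exists_functionChart hB Q.target Q.target_subset
  have hψs : ContMDiffWithinAt 𝓘(ℝ, ℝ × t.F) I' ∞ (fun q => ψ (t.s q)) (halfBox t.F t.ε) 0 :=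
    Q.smooth.contMDiffAt.comp_contMDiffWithinAt 0 (t.s_smooth 0 h0)
  have hψU0 : ψ (t.s 0) ∈ t'.U := by rwa [t.s_zero]
  have hη : ContDiffWithinAt ℝ ∞ (fun q => t'.y (ψ (t.s q))) (halfBox t.F t.ε) 0 :=
    (((t'.y_smooth _ hψU0).contMDiffAt (t'.isOpen_U.mem_nhds hψU0)).comp_contMDiffWithinAt 0
      hψs).contDiffWithinAt
  have hα : ContDiffWithinAt ℝ ∞ (fun q => (t'.θ (ψ (t.s q)) : ℂ)) (halfBox t.F t.ε) 0 :=
    (contMDiff_circle_coe.contMDiffAt.comp_contMDiffWithinAt 0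
      (((t'.θ_smooth _ hψU0).contMDiffAt (t'.isOpen_U.mem_nhds hψU0)).comp_contMDiffWithinAt 0
        hψs)).contDiffWithinAt
  have hη' := (hη.differentiableWithinAt (by simp)).hasFDerivWithinAt
  have hα' := (hα.differentiableWithinAt (by simp)).hasFDerivWithinAt
  obtain ⟨S, hS, hSd⟩ := hasFDerivAt_twist t.ε_pos hα' hη'
  obtain ⟨hti, hts⟩ := Q.transfer_tube t t' hη'
  set η' := fderivWithin ℝ (fun q => t'.y (ψ (t.s q))) (halfBox t.F t.ε) 0 with hη'def
  have hc0 : t.coord x = 0 := by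
    have h2 := t.f_s 0 h0
    have h3 := t.y_s 0 h0
    rw [t.s_zero] at h2 h3
    rw [Tube.coord, h2, h3]
    simp
  have hα0 : (t'.θ (ψ (t.s 0)) : ℂ) ≠ 0 := Circle.coe_ne_zero _
  refine ⟨e, e', fun v => t'.L ((fun p : ℂ × t.F => (p.1 * (t'.θ (ψ (t.s (sqNormFst p))) : ℂ),
    t'.y (ψ (t.s (sqNormFst p))))) (t.L.symm v)),
    (t'.L : ℂ × t'.F →L[ℝ] E').comp (S.comp (t.L.symm : E →L[ℝ] ℂ × t.F)), he, he', hes x hxU,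
    hes' _ hψU, ?_, ?_, ?_, ?_⟩
  · rw [hee x hxU, hc0, map_zero]
    have h1 : HasFDerivAt (fun p : ℂ × t.F => (p.1 * (t'.θ (ψ (t.s (sqNormFst p))) : ℂ),
        t'.y (ψ (t.s (sqNormFst p))))) S (t.L.symm 0) := by rwa [map_zero]
    exact t'.L.hasFDerivAt.comp (0 : E) (h1.comp (0 : E) t.L.symm.hasFDerivAt)
  · have hWo : IsOpen (t.U ∩ ψ ⁻¹' t'.U) :=
      t.isOpen_U.inter (t'.isOpen_U.preimage Q.smooth.continuous)
    have hWi : ∀ a, ∀ z ∈ t.U ∩ ψ ⁻¹' t'.U, A.sm a z ∈ t.U ∩ ψ ⁻¹' t'.U := by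
      rintro a z ⟨hz, hz'⟩
      refine ⟨t.U_inv a z hz, ?_⟩
      rw [mem_preimage, Q.equivariant a z (t.U_subset hz)]
      exact t'.U_inv a _ hz'
    have h1 := Q.source.isOpen_image_cutMk Q.source_subset hWo fun z hz _ a => hWi a z hz
    filter_upwards [h1.mem_nhds ⟨x, ⟨hxU, hψU⟩, rfl⟩]
    rintro _ ⟨z, ⟨hz, hz'⟩, rfl⟩
    rw [cutMap_cutMk, hee' _ hz', hee z hz, t.L.symm_apply_apply]
    congr 1
    have hs := t.U_subset (t.s_mem _ (t.mem_box z hz))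
    have h5 := Q.equivariant (t.θ z) _ hs
    rw [t.smul_s z hz] at h5
    have h6 : ψ (t.s ((f ∘ ψ) z, t.y z)) ∈ t'.U := by
      have := t'.U_inv (t.θ z)⁻¹ _ hz'
      rwa [h5, Q.target.inv_smul] at this
    have h7 := t'.y_smul (t.θ z) _ h6
    have h8 := t'.θ_smul (t.θ z) _ h6
    rw [← h5] at h7 h8
    simp only [t.sqNormFst_coord Q.source]
    rw [Tube.coord, Tube.coord, h7, h8, Circle.coe_mul, mul_assoc]
    rfl
  · intro h
    have hSi : Function.Injective S := by
      rintro ⟨w, v⟩ ⟨w', v'⟩ hwv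
      rw [hS, hS, Prod.mk.injEq] at hwv
      exact Prod.ext (mul_left_cancel₀ hα0 hwv.1) (hti h hwv.2)
    exact t'.L.injective.comp (hSi.comp t.L.symm.injective)
  · intro h
    have hSs : Function.Surjective S := by
      rintro ⟨w, v⟩
      obtain ⟨v', hv'⟩ := hts h v
      refine ⟨((t'.θ (ψ (t.s 0)) : ℂ)⁻¹ * w, v'), ?_⟩
      rw [hS]
      exact Prod.ext (mul_inv_cancel_left₀ hα0 w) hv'
    exact t'.L.surjective.comp (hSs.comp t.L.symm.surjective)

end TransverseDatum

end Differential

/-! ### Properties of the induced map -/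

section Properties

variable {E H E' H' : Type*} [NormedAddCommGroup E] [NormedSpace ℝ E] [TopologicalSpace H]
  [NormedAddCommGroup E'] [NormedSpace ℝ E'] [TopologicalSpace H']
  {I : ModelWithCorners ℝ E H} {I' : ModelWithCorners ℝ E' H'}
  {M N : Type*} [TopologicalSpace M] [ChartedSpace H M] [TopologicalSpace N] [ChartedSpace H' N]
  [IsManifold I ∞ M] [T2Space M]
  [IsManifold I' ∞ N] [T2Space N] [SecondCountableTopology N]
  {A : LocalCircleAction M} {B : LocalCircleAction N} {ψ : M → N}

-- Membership on the target may be tested with the particular `f` for which `f ∘ ψ` is again a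
-- boundary defining function; this is where independence of `f` is used.
omit [IsManifold I ∞ M] [T2Space M] in
theorem IsEquivariantTransverse.comp_cutMap_mem (hI' : IsHalfSpaceModel I')
    (hA : IsFreeNearBoundary I A) (hB : IsFreeNearBoundary I' B)
    (hψ : IsEquivariantTransverse I I' A B ψ) {h : CutSpace I' B → ℝ} (hh : h ∈ cutFunctions I' B) :
    h ∘ cutMap hψ ∈ cutFunctions I A := by
  obtain ⟨f, D, D', hf, hfψ, Q⟩ := hψ.exists_datum hA hB
  exact cutFunctionsWrt_subset hA hfψ
    (Q.comp_cutMap_mem hψ ((cutFunctions_subset_and_nonempty hI' hB hf).1 hh))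

variable [ChartedSpace E (CutSpace I A)] [IsManifold 𝓘(ℝ, E) ∞ (CutSpace I A)]
  [T2Space (CutSpace I A)]
  [ChartedSpace E' (CutSpace I' B)] [IsManifold 𝓘(ℝ, E') ∞ (CutSpace I' B)]
  [T2Space (CutSpace I' B)]

omit [IsManifold I ∞ M] [T2Space M]
  [T2Space (CutSpace I A)] [IsManifold 𝓘(ℝ, E) ∞ (CutSpace I A)] in
theorem IsEquivariantTransverse.contMDiff_cutMap (hI' : IsHalfSpaceModel I')
    (hA : IsFreeNearBoundary I A) (hB : IsFreeNearBoundary I' B)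
    (hF : ∀ h : CutSpace I A → ℝ, ContMDiff 𝓘(ℝ, E) 𝓘(ℝ) ∞ h ↔ h ∈ cutFunctions I A)
    (hG : ∀ h : CutSpace I' B → ℝ, ContMDiff 𝓘(ℝ, E') 𝓘(ℝ) ∞ h ↔ h ∈ cutFunctions I' B)
    (hψ : IsEquivariantTransverse I I' A B ψ) :
    ContMDiff 𝓘(ℝ, E) 𝓘(ℝ, E') ∞ (cutMap hψ) := by
  have := hI'.1
  exact contMDiff_of_forall_comp (continuous_cutMap hψ) fun g hg =>
    (hF _).2 (hψ.comp_cutMap_mem hI' hA hB ((hG g).1 hg))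

theorem IsEquivariantTransverse.mfderiv_cutMap (hI : IsHalfSpaceModel I)
    (hI' : IsHalfSpaceModel I') (hA : IsFreeNearBoundary I A) (hB : IsFreeNearBoundary I' B)
    (hF : ∀ h : CutSpace I A → ℝ, ContMDiff 𝓘(ℝ, E) 𝓘(ℝ) ∞ h ↔ h ∈ cutFunctions I A)
    (hG : ∀ h : CutSpace I' B → ℝ, ContMDiff 𝓘(ℝ, E') 𝓘(ℝ) ∞ h ↔ h ∈ cutFunctions I' B)
    (hψ : IsEquivariantTransverse I I' A B ψ) (x : M) :
    (Function.Injective (mfderiv I I' ψ x) →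
      Function.Injective (mfderiv 𝓘(ℝ, E) 𝓘(ℝ, E') (cutMap hψ) (cutMk I A x))) ∧
    (Function.Surjective (mfderiv I I' ψ x) →
      Function.Surjective (mfderiv 𝓘(ℝ, E) 𝓘(ℝ, E') (cutMap hψ) (cutMk I A x))) := by
  have := hI.1
  have := hI'.1
  obtain ⟨f, D, D', hf, hfψ, Q⟩ := hψ.exists_datum hA hB
  obtain ⟨e, e', T, T', he, he', hxe, hxe', hT, hTe, hi, hs⟩ :=
    (em (x ∈ I.boundary M)).elim (Q.exists_charts_boundary hI hI' hA hB hψ) fun h =>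
      Q.exists_charts_interior hψ (I.compl_boundary (M := M) ▸ h)
  have hφ := (hψ.contMDiff_cutMap hI' hA hB hF hG).mdifferentiable (by simp) (cutMk I A x)
  have key := mfderiv_comp_functionChart hF (cutFunctionsWrt_subset hA hfψ) hG
    (cutFunctionsWrt_subset hB hf) he he' hφ hxe hxe' hT hTe
  exact ⟨fun h => key.1 (hi h), fun h => key.2 (hs h)⟩

theorem IsEquivariantTransverse.isImmersion_cutMap (hI : IsHalfSpaceModel I)
    (hI' : IsHalfSpaceModel I') (hA : IsFreeNearBoundary I A) (hB : IsFreeNearBoundary I' B)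
    (hF : ∀ h : CutSpace I A → ℝ, ContMDiff 𝓘(ℝ, E) 𝓘(ℝ) ∞ h ↔ h ∈ cutFunctions I A)
    (hG : ∀ h : CutSpace I' B → ℝ, ContMDiff 𝓘(ℝ, E') 𝓘(ℝ) ∞ h ↔ h ∈ cutFunctions I' B)
    (hψ : IsEquivariantTransverse I I' A B ψ) (h : IsImmersion I I' ψ) :
    IsImmersion 𝓘(ℝ, E) 𝓘(ℝ, E') (cutMap hψ) := by
  refine ⟨hψ.contMDiff_cutMap hI' hA hB hF hG, fun p => ?_⟩
  obtain ⟨x, rfl⟩ := surjective_cutMk p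
  exact (hψ.mfderiv_cutMap hI hI' hA hB hF hG x).1 (h.2 x)

theorem IsEquivariantTransverse.isSubmersion_cutMap (hI : IsHalfSpaceModel I)
    (hI' : IsHalfSpaceModel I') (hA : IsFreeNearBoundary I A) (hB : IsFreeNearBoundary I' B)
    (hF : ∀ h : CutSpace I A → ℝ, ContMDiff 𝓘(ℝ, E) 𝓘(ℝ) ∞ h ↔ h ∈ cutFunctions I A)
    (hG : ∀ h : CutSpace I' B → ℝ, ContMDiff 𝓘(ℝ, E') 𝓘(ℝ) ∞ h ↔ h ∈ cutFunctions I' B)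
    (hψ : IsEquivariantTransverse I I' A B ψ) (h : IsSubmersion I I' ψ) :
    IsSubmersion 𝓘(ℝ, E) 𝓘(ℝ, E') (cutMap hψ) := by
  refine ⟨hψ.contMDiff_cutMap hI' hA hB hF hG, fun p => ?_⟩
  obtain ⟨x, rfl⟩ := surjective_cutMk p
  exact (hψ.mfderiv_cutMap hI hI' hA hB hF hG x).2 (h.2 x)

theorem IsEquivariantTransverse.isSmoothEmbedding_cutMap (hI : IsHalfSpaceModel I)
    (hI' : IsHalfSpaceModel I') (hA : IsFreeNearBoundary I A) (hB : IsFreeNearBoundary I' B)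
    (hF : ∀ h : CutSpace I A → ℝ, ContMDiff 𝓘(ℝ, E) 𝓘(ℝ) ∞ h ↔ h ∈ cutFunctions I A)
    (hG : ∀ h : CutSpace I' B → ℝ, ContMDiff 𝓘(ℝ, E') 𝓘(ℝ) ∞ h ↔ h ∈ cutFunctions I' B)
    (hψ : IsEquivariantTransverse I I' A B ψ) (h : IsSmoothEmbedding I I' ψ) :
    IsSmoothEmbedding 𝓘(ℝ, E) 𝓘(ℝ, E') (cutMap hψ) := by
  obtain ⟨f, D, D', hf, hfψ, Q⟩ := hψ.exists_datum hA hB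
  exact ⟨hψ.isImmersion_cutMap hI hI' hA hB hF hG h.1, Q.isEmbedding_cutMap hψ h.2⟩

end Properties

/-! ### Submanifolds -/

section Submanifold

/-- A smooth embedding is a diffeomorphism onto its image. -/
theorem IsSmoothEmbedding.isDiffeoOntoImage {E E' : Type*} [NormedAddCommGroup E] [NormedSpace ℝ E]
    [FiniteDimensional ℝ E] [NormedAddCommGroup E'] [NormedSpace ℝ E'] [FiniteDimensional ℝ E']
    {X Y : Type*} [TopologicalSpace X] [ChartedSpace E X] [IsManifold 𝓘(ℝ, E) ∞ X]
    [TopologicalSpace Y] [ChartedSpace E' Y] [IsManifold 𝓘(ℝ, E') ∞ Y] [T2Space Y]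
    {F : Set (X → ℝ)} {G : Set (Y → ℝ)}
    (hF : ∀ h : X → ℝ, ContMDiff 𝓘(ℝ, E) 𝓘(ℝ) ∞ h ↔ h ∈ F)
    (hG : ∀ h : Y → ℝ, ContMDiff 𝓘(ℝ, E') 𝓘(ℝ) ∞ h ↔ h ∈ G) {φ : X → Y}
    (hφ : IsSmoothEmbedding 𝓘(ℝ, E) 𝓘(ℝ, E') φ) : IsDiffeoOntoImage F G φ := by
  refine ⟨hφ.2.injective, fun h => ⟨fun hh => (hF _).1 fun x => ?_, fun hh => ?_⟩⟩
  · obtain ⟨O, hO, hxO, g, hg, hgh⟩ := hh ⟨φ x, x, rfl⟩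
    refine (((hG g).2 hg).comp hφ.1.1 x).congr_of_eventuallyEq ?_
    filter_upwards [(hO.preimage hφ.1.1.continuous).mem_nhds hxO] with z hz
    exact hgh ⟨φ z, z, rfl⟩ hz
  · rintro ⟨_, x, rfl⟩
    obtain ⟨O, g, hO, hxO, hg, hgh⟩ := hφ.exists_extension ((hF _).2 hh) x
    refine ⟨O, hO, hxO, g, (hG g).1 hg, ?_⟩
    rintro ⟨_, z, rfl⟩ hz
    exact hgh z hz

/-- The image of an embedding that is a diffeomorphism onto its image is a manifold. -/
theorem ManifoldStructure.nonempty_range {E : Type*} [NormedAddCommGroup E] [NormedSpace ℝ E]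
    [FiniteDimensional ℝ E] {X Y : Type*} [TopologicalSpace X] [TopologicalSpace Y]
    {F : Set (X → ℝ)} {G : Set (Y → ℝ)} (s : ManifoldStructure E X F) {φ : X → Y}
    (hφ : IsEmbedding φ) (hd : IsDiffeoOntoImage F G φ) {T : Set Y} (hT : range φ = T) :
    Nonempty (ManifoldStructure E T (subsetFunctions G T)) := by
  subst hT
  exact s.nonempty_of_homeomorph hφ.toHomeomorph hd.2

variable {E H E' H' : Type*} [NormedAddCommGroup E] [NormedSpace ℝ E] [TopologicalSpace H]
  [NormedAddCommGroup E'] [NormedSpace ℝ E'] [TopologicalSpace H']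
  {I : ModelWithCorners ℝ E H} {I' : ModelWithCorners ℝ E' H'}
  {N : Type*} [TopologicalSpace N] [ChartedSpace H' N] [T2Space N] {B : LocalCircleAction N}
  {S : Set N} [ChartedSpace H S] [IsManifold I ∞ S] [FiniteDimensional ℝ E]

/-- The inclusion of a submanifold is an embedding. -/
theorem isSmoothEmbedding_subtypeVal
    (hS : ∀ h : S → ℝ, ContMDiff I 𝓘(ℝ) ∞ h →
      h ∈ subsetFunctions {g : N → ℝ | ContMDiff I' 𝓘(ℝ) ∞ g} S)
    (hsm : ContMDiff I I' ∞ (Subtype.val : S → N)) :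
    IsSmoothEmbedding I I' (Subtype.val : S → N) := by
  refine ⟨⟨hsm, fun x => ?_⟩, IsEmbedding.subtypeVal⟩
  obtain ⟨g, hg, hge⟩ := exists_contMDiff_eventuallyEq I (chartAt H x).open_source
    (mem_chart_source H x) (contMDiffOn_extChartAt (I := I) (n := ∞) (x := x))
  have hgd := (hg.mdifferentiableAt (x := x) (by simp)).hasMFDerivAt
  have hinv : Function.Injective (mfderiv I 𝓘(ℝ, E) g x) := by
    rw [hge.mfderiv_eq]
    exact (isInvertible_mfderiv_extChartAt (mem_extChartAt_source x)).injective
  have hvd := (hsm.mdifferentiableAt (x := x) (by simp)).hasMFDerivAt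
  refine (injective_iff_map_eq_zero _).2 fun v hv => (injective_iff_map_eq_zero _).1 hinv v ?_
  apply (Module.finBasis ℝ E).equivFunL.injective
  refine Eq.trans ?_ (map_zero _).symm
  funext i
  set ℓ : E →L[ℝ] ℝ := (ContinuousLinearMap.proj i).comp
    ((Module.finBasis ℝ E).equivFunL : E →L[ℝ] (Fin (Module.finrank ℝ E) → ℝ)) with hℓ
  -- Each coordinate of a chart of `S` is locally the restriction of a smooth function on `N`, so a
  -- vector killed by the differential of the inclusion is killed by the differential of the chart.
  obtain ⟨O, hO, hxO, G, hG, hGe⟩ := hS (fun z => ℓ (g z)) (ℓ.contDiff.contMDiff.comp hg) x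
  have h1 := HasMFDerivAt.clm_comp hgd ℓ
  have h2 : HasMFDerivAt I 𝓘(ℝ) (G ∘ (Subtype.val : S → N)) x _ :=
    ((hG : ContMDiff I' 𝓘(ℝ) ∞ G).mdifferentiableAt (x := (x : N))
      (by simp)).hasMFDerivAt.comp x hvd
  have h3 := hasMFDerivAt_unique h1 (h2.congr_of_eventuallyEq (by
    filter_upwards [(hO.preimage continuous_subtype_val).mem_nhds hxO] with z hz
    exact hGe z hz))
  have h4 := DFunLike.congr_fun h3 v
  refine Eq.trans h4 ?_
  refine (congrArg (mfderiv I' 𝓘(ℝ) G (x : N)) hv).trans (map_zero _)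

/-- The restriction of the action to a submanifold. -/
theorem isFreeNearBoundary_restrict (hB : IsFreeNearBoundary I' B)
    (hS : ∀ h : S → ℝ, ContMDiff I 𝓘(ℝ) ∞ h →
      h ∈ subsetFunctions {g : N → ℝ | ContMDiff I' 𝓘(ℝ) ∞ g} S)
    (hsm : ContMDiff I I' ∞ (Subtype.val : S → N))
    (hbdry : ∀ x ∈ I.boundary S, (x : N) ∈ I'.boundary N)
    {V : Set B.dom} (hV : IsInvariantNhd I' B V)
    (hSV : ∀ (a : Circle), ∀ x ∈ V, (x : N) ∈ S → ((a • x : B.dom) : N) ∈ S) :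
    IsFreeNearBoundary I (B.restrict S V hV.isOpen hV.smul_mem hSV) := by
  set BS := B.restrict S V hV.isOpen hV.smul_mem hSV with hBS
  refine ⟨fun x hx => ⟨hB.boundary_subset _ (hbdry x hx), hV.boundary_mem _ (hbdry x hx)⟩, ?_, ?_⟩
  · have h1 : ContMDiff ((𝓡 1).prod I) I' ∞
        (fun p : Circle × BS.dom => (((p.1 • p.2 : BS.dom) : S) : N)) := by
      have h2 : ContMDiff ((𝓡 1).prod I) ((𝓡 1).prod I') ∞
          (fun p : Circle × BS.dom => (p.1, ((p.2 : S) : N))) :=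
        contMDiff_fst.prodMk (hsm.comp (contMDiff_subtype_val.comp contMDiff_snd))
      have h3 : ContMDiff ((𝓡 1).prod I) I' ∞
          (fun p : Circle × BS.dom => B.sm p.1 ((p.2 : S) : N)) := fun p =>
        (hB.contMDiffOn_sm.contMDiffAt ((isOpen_univ.prod B.dom.2).mem_nhds
          ⟨mem_univ _, p.2.2.fst⟩)).comp p (h2 p)
      refine h3.congr fun p => ?_
      exact (B.sm_of_mem p.1 p.2.2.fst).symm
    have h4 : ContMDiff ((𝓡 1).prod I) I ∞ (fun p : Circle × BS.dom => ((p.1 • p.2 : BS.dom) : S)) := by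
      -- Smoothness into `S` is tested on smooth functions of `S`; these extend locally to `N`,
      -- where the action is known to be smooth.
      refine contMDiff_of_forall_comp (continuous_induced_rng.2 h1.continuous) fun g hg p => ?_
      obtain ⟨O, hO, hxO, G, hG, hGe⟩ := hS g hg (p.1 • p.2 : BS.dom)
      refine ((hG : ContMDiff I' 𝓘(ℝ) ∞ G).comp h1 p).congr_of_eventuallyEq ?_
      filter_upwards [(hO.preimage h1.continuous).mem_nhds hxO] with z hz
      exact hGe _ hz
    intro p
    obtain ⟨r, hr, hrx⟩ := exists_contMDiffOn_retraction I BS.dom ⟨p.2, p.2.2⟩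
    have h5 := hr.comp_contMDiff h4 fun p => (p.1 • p.2 : BS.dom).2
    refine (h5.congr fun z => ?_) p
    exact (hrx _).symm
  · rintro a ⟨⟨x, hxS⟩, hx, hxV⟩ h
    refine hB.free a ⟨x, hx⟩ (Subtype.ext ?_)
    exact congrArg (fun z : BS.dom => ((z : S) : N)) h

end Submanifold

end Cutting

/-! ### The main theorem -/

theorem mainTheorem3
    {E H E' H' : Type*}
    [NormedAddCommGroup E] [NormedSpace ℝ E] [TopologicalSpace H]
    [NormedAddCommGroup E'] [NormedSpace ℝ E'] [TopologicalSpace H']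
    (I : ModelWithCorners ℝ E H) (I' : ModelWithCorners ℝ E' H')
    (hI : IsHalfSpaceModel I) (hI' : IsHalfSpaceModel I')
    (N : Type*) [TopologicalSpace N] [ChartedSpace H' N] [IsManifold I' ∞ N]
    [T2Space N] [SecondCountableTopology N]
    (B : LocalCircleAction N) (hB : IsFreeNearBoundary I' B) :
    (∀ (M : Type*) [TopologicalSpace M] [ChartedSpace H M] [IsManifold I ∞ M]
        [T2Space M] [SecondCountableTopology M]
        (A : LocalCircleAction M) (_hA : IsFreeNearBoundary I A)
        (ψ : M → N) (hψ : IsEquivariantTransverse I I' A B ψ),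
      Nonempty (CutManifold I A) ∧ Nonempty (CutManifold I' B) ∧
      ∀ (sM : CutManifold I A) (sN : CutManifold I' B),
        letI := sM.charted
        letI := sN.charted
        ContMDiff 𝓘(ℝ, E) 𝓘(ℝ, E') ∞ (cutMap hψ) ∧
        (IsImmersion I I' ψ → IsImmersion 𝓘(ℝ, E) 𝓘(ℝ, E') (cutMap hψ)) ∧
        (IsSubmersion I I' ψ → IsSubmersion 𝓘(ℝ, E) 𝓘(ℝ, E') (cutMap hψ)) ∧
        (IsSmoothEmbedding I I' ψ → IsSmoothEmbedding 𝓘(ℝ, E) 𝓘(ℝ, E') (cutMap hψ))) ∧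
    (∀ (S : Set N) [ChartedSpace H S] [IsManifold I ∞ S]
        (_hS : ∀ h : S → ℝ, ContMDiff I 𝓘(ℝ) ∞ h ↔
          h ∈ subsetFunctions {g : N → ℝ | ContMDiff I' 𝓘(ℝ) ∞ g} S)
        (_hbdry : ∀ x ∈ I.boundary S, (x : N) ∈ I'.boundary N)
        (V : Set B.dom) (hV : IsInvariantNhd I' B V)
        (hSV : ∀ (a : Circle), ∀ x ∈ V, (x : N) ∈ S → ((a • x : B.dom) : N) ∈ S)
        (hι : IsEquivariantTransverse I I' (B.restrict S V hV.isOpen hV.smul_mem hSV) B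
          (Subtype.val : S → N)),
      Nonempty (CutManifold I (B.restrict S V hV.isOpen hV.smul_mem hSV)) ∧
      Nonempty (CutManifold I' B) ∧
      Nonempty (ManifoldStructure E (cutMk I' B '' S)
        (subsetFunctions (cutFunctions I' B) (cutMk I' B '' S))) ∧
      range (cutMap hι) = cutMk I' B '' S ∧
      IsDiffeoOntoImage (cutFunctions I (B.restrict S V hV.isOpen hV.smul_mem hSV))
        (cutFunctions I' B) (cutMap hι) ∧
      ∀ (sM : CutManifold I (B.restrict S V hV.isOpen hV.smul_mem hSV)) (sN : CutManifold I' B),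
        letI := sM.charted
        letI := sN.charted
        IsSmoothEmbedding 𝓘(ℝ, E) 𝓘(ℝ, E') (cutMap hι)) := by
  have := hI.1
  have := hI'.1
  refine ⟨?_, ?_⟩
  · intro M _ _ _ _ _ A hA ψ hψ
    obtain ⟨f, hf, hfψ⟩ := hψ.transverse
    refine ⟨(cutFunctions_subset_and_nonempty hI hA hfψ).2,
      (cutFunctions_subset_and_nonempty hI' hB hf).2, fun sM sN => ?_⟩
    let := sM.charted
    let := sN.charted
    have := sM.isManifold
    have := sN.isManifold
    have := sM.t2
    have := sN.t2
    exact ⟨hψ.contMDiff_cutMap hI' hA hB sM.smooth_iff sN.smooth_iff,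
      hψ.isImmersion_cutMap hI hI' hA hB sM.smooth_iff sN.smooth_iff,
      hψ.isSubmersion_cutMap hI hI' hA hB sM.smooth_iff sN.smooth_iff,
      hψ.isSmoothEmbedding_cutMap hI hI' hA hB sM.smooth_iff sN.smooth_iff⟩
  · intro S _ _ hS hbdry V hV hSV hι
    have hA := isFreeNearBoundary_restrict hB (fun h => (hS h).1) hι.smooth hbdry hV hSV
    have hemb := isSmoothEmbedding_subtypeVal (fun h => (hS h).1) hι.smooth
    obtain ⟨f, hf, hfψ⟩ := hι.transverse
    obtain ⟨sS⟩ := (cutFunctions_subset_and_nonempty hI hA hfψ).2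
    obtain ⟨sN⟩ := (cutFunctions_subset_and_nonempty hI' hB hf).2
    have hrange : range (cutMap hι) = cutMk I' B '' S := by
      ext p
      constructor
      · rintro ⟨q, rfl⟩
        obtain ⟨x, rfl⟩ := surjective_cutMk q
        exact ⟨x, x.2, rfl⟩
      · rintro ⟨x, hx, rfl⟩
        exact ⟨cutMk I _ ⟨x, hx⟩, rfl⟩
    have key : ∀ (sM : CutManifold I (B.restrict S V hV.isOpen hV.smul_mem hSV))
        (sN : CutManifold I' B),
        letI := sM.charted
        letI := sN.charted
        IsSmoothEmbedding 𝓘(ℝ, E) 𝓘(ℝ, E') (cutMap hι) := fun sM sN => by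
      let := sM.charted
      let := sN.charted
      have := sM.isManifold
      have := sN.isManifold
      have := sM.t2
      have := sN.t2
      exact hι.isSmoothEmbedding_cutMap hI hI' hA hB sM.smooth_iff sN.smooth_iff hemb
    -- This assertion involves only the sets of functions, so a single choice of manifold structures
    -- proves it.
    have hdiff : IsDiffeoOntoImage (cutFunctions I (B.restrict S V hV.isOpen hV.smul_mem hSV))
        (cutFunctions I' B) (cutMap hι) := by
      let := sS.charted
      let := sN.charted
      have := sS.isManifold
      have := sN.isManifold
      have := sN.t2
      exact (key sS sN).isDiffeoOntoImage sS.smooth_iff sN.smooth_iff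
    exact ⟨⟨sS⟩, ⟨sN⟩, sS.nonempty_range (by
      let := sS.charted
      let := sN.charted
      exact (key sS sN).2) hdiff hrange, hrange, hdiff, key⟩
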